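/- Let $\Sigma\subset\mathbb{C}$ be a finite set with $0\in\Sigma$ and $\Sigma\cap(0,\infty)\neq\emptyset$, and let $\tau=\min(\Sigma\cap(0,\infty))$. Let $T(\Sigma)$ be the $\mathbb{Q}$-vector space spanned by all words over $\Sigma$, with the shuffle product $\sqcup\!\sqcup$, and write $\omega_\sigma$ for the letter $\sigma$. *Hyperlogarithms.* $L_{\omega_0^n}(z)=\frac{\log^n z}{n!}$ and otherwise $L_{\omega_\sigma w'}(z)=\int_0^z\frac{dz'}{z'-\sigma}L_{w'}(z')$ (along the straight segment), extended linearly to $T(\Sigma)$. *Regularization.* $\mathrm{reg}^\tau:T(\Sigma)\to T(\Sigma)$ is the unique linear map that is multiplicative for $\sqcup\!\sqcup$, fixes all words that do not begin with $\omega_\tau$, and annihilates $\omega_\tau^n$ for $n>0$. *Paths.* Let $z>\tau$ be real, and suppose it is fixed for every letter in $\Sigma\cap(0,z)$ whether it is passed above or below. For $a\in\{0,\tau\}$, a path $\gamma:[0,1]\to\mathbb{C}$ from $a$ to $z$ is called admissible if it is homotopic, through paths from $a$ to $z$ that do not meet $\Sigma$ at any time $t>0$, to a graph $t\mapsto a+t(z-a)+i\,h(t)$,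 $h:[0,1]\to\mathbb{R}$ continuous with $h(0)=h(1)=0$, that passes each letter in $\Sigma\cap(a,z)$ on the prescribed side and such that none of the curves $t\mapsto a+t(z-a)+i\,s\,h(t)$, $0<s\le1$, meets $\Sigma$ at any time $t>0$. Let $w=\omega_{\sigma_1}\cdots\omega_{\sigma_n}$ be a word over $\Sigma$ which is empty or has $\sigma_n\neq0$, let $\gamma$ be an admissible path from $0$ to $z$ and let $\delta$ be an admissible $C^1$ path from $\tau$ to $z$ (for the same choice of sides). Define $\int_\tau^z(\omega_{\rho_1}\cdots\omega_{\rho_k})$ as the iterated integral $$\int_{\delta}\omega_{\rho_1}\cdots\omega_{\rho_k}=\int_0^1\frac{d\delta(t)}{\delta(t)-\rho_1}\int_{\delta|_{[0,t]}}\omega_{\rho_2}\cdots\omega_{\rho_k}$$ for the words that are empty or have $\rho_k\neq\tau$, and extend it to a linear map $\int_\tau^z:T(\Sigma)\to\mathbb{C}$ by requiring $\int_\tau^z(u\sqcup\!\sqcup v)=\int_\tau^z(u)\cdot\int_\tau^z(v)$ and $$\int_\tau^z\omega_\tau=\pm i\pi+\log\frac{z-\tau}{\tau},$$ with the sign $+$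 if $\gamma$ passes below $\tau$ and $-$ if it passes above $\tau$. Then $\mathrm{reg}^\tau$ and $\int_\tau^z$ exist and are uniquely determined by these requirements, the germ of $L_w$ at $0$ can be continued analytically along $\gamma$, the analytic continuation of $L_{\omega_\tau}$ along $\gamma$ has the value $\int_\tau^z\omega_\tau$ at $z$, and the analytic continuation of $L_w$ along $\gamma$ has at $z$ the value $$\sum_{k=0}^n\int_\tau^z(\omega_{\sigma_1}\cdots\omega_{\sigma_k})\cdot L_{\mathrm{reg}^\tau(\omega_{\sigma_{k+1}}\cdots\omega_{\sigma_n})}(\tau).$$ -/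

import Mathlib

noncomputable section

namespace Hyperlogs

open Set Filter Topology

/-- The rational vector space spanned by all words over the alphabet `α`. -/
abbrev WordSpace (α : Type) : Type := List α →₀ ℚ

/-- A word, as a basis vector. -/
abbrev word {α : Type} (w : List α) : WordSpace α := Finsupp.single w 1

/-- The shuffle product of two words. -/
def shuffleWords {α : Type} : List α → List α → WordSpace α
  | [], v => word v
  | a :: u, [] => word (a :: u)
  | a :: u, b :: v =>
      (shuffleWords u (b :: v)).mapDomain (a :: ·) + (shuffleWords (a :: u) v).mapDomain (b :: ·)
termination_by u v => u.length + v.length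

/-- The shuffle product, extended bilinearly. -/
def shuffle {α : Type} (x y : WordSpace α) : WordSpace α :=
  x.sum fun u a => y.sum fun v b => (a * b) • shuffleWords u v

/-- The defining requirements on the shuffle regularization `reg_A^B`: it is linear and
multiplicative for the shuffle product, it fixes every word that neither begins with a letter of
`B` nor ends in a letter of `A`, and it annihilates the nonempty words all of whose letters lie in
`A`, or all of whose letters lie in `B`. -/
structure IsWordReg {α : Type} (A B : Set α) (reg : WordSpace α →ₗ[ℚ] WordSpace α) : Prop where
  map_shuffle : ∀ u v : List α, reg (shuffleWords u v) = shuffle (reg (word u)) (reg (word v))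
  map_regular : ∀ w : List α, (∀ σ ∈ w.head?, σ ∉ B) → (∀ σ ∈ w.getLast?, σ ∉ A) →
    reg (word w) = word w
  map_singular : ∀ w : List α, w ≠ [] → ((∀ σ ∈ w, σ ∈ A) ∨ (∀ σ ∈ w, σ ∈ B)) →
    reg (word w) = 0

open Classical in
/-- The hyperlogarithm `L_w(z)`: it is `(log z)^n / n!` for the word `0^n`, and otherwise
`L_{σ w'}(z) = ∫_0^z L_{w'}(z') dz' / (z' - σ)`, where the integral runs along the straight
segment `z' = s z`, `0 ≤ s ≤ 1`. -/
def hyperlog : List ℂ → ℂ → ℂ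
  | [], _ => 1
  | σ :: w, z =>
      if ∀ ρ ∈ σ :: w, ρ = 0 then
        Complex.log z ^ (w.length + 1) / ((w.length + 1).factorial : ℂ)
      else ∫ s in (0 : ℝ)..1, z / (s * z - σ) * hyperlog w (s * z)

/-- `w ↦ L_w(z)`, extended linearly. -/
def hyperlogLin {S : Finset ℂ} (x : WordSpace S) (z : ℂ) : ℂ :=
  x.sum fun w a => (a : ℂ) * hyperlog (w.map Subtype.val) z

/-- The iterated integral of the forms `dz / (z - σ_i)`, for the letters `σ_1, …, σ_n` of a word,
along the restriction of the path `γ` to `[0, t]`; the form of the first letter is integrated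
last. -/
def iterInt (γ : ℝ → ℂ) : List ℂ → ℝ → ℂ
  | [], _ => 1
  | σ :: w, t => ∫ s in (0 : ℝ)..t, deriv γ s / (γ s - σ) * iterInt γ w s

/-- The path `γ : [0, 1] → ℂ` from `a` to `z` is a deformation of the real segment `[a, z]` that
avoids the letters of `S` (except that it may start at one), passing above the letters in
`above` and below the other letters on the open segment. That is: `γ` is homotopic, through paths
from `a` to `z` that do not meet `S` after their start, to a graph
`t ↦ (a + t (z - a)) + i h(t)` over the segment, where `h` is positive at the letters in `above`
and negative at the other ones, and no letter off the segment lies on or between the graph and the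
segment. -/
def IsDeformedSegment (S : Finset ℂ) (above : Set ℝ) (a z : ℝ) (γ : ℝ → ℂ) : Prop :=
  ∃ (h : ℝ → ℝ) (H : ℝ × ℝ → ℂ),
    ContinuousOn h (Icc 0 1) ∧ h 0 = 0 ∧ h 1 = 0 ∧
    (∀ s ∈ Ioc (0 : ℝ) 1, ∀ t ∈ Ioc (0 : ℝ) 1,
      (⟨a + t * (z - a), s * h t⟩ : ℂ) ∉ S) ∧
    (∀ t ∈ Ioo (0 : ℝ) 1, ((a + t * (z - a) : ℝ) : ℂ) ∈ S →
      (a + t * (z - a) ∈ above → 0 < h t) ∧ (a + t * (z - a) ∉ above → h t < 0)) ∧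
    ContinuousOn H (Icc 0 1 ×ˢ Icc 0 1) ∧
    (∀ t ∈ Icc (0 : ℝ) 1, H (0, t) = γ t) ∧
    (∀ t ∈ Icc (0 : ℝ) 1, H (1, t) = ⟨a + t * (z - a), h t⟩) ∧
    (∀ s ∈ Icc (0 : ℝ) 1, H (s, 0) = a ∧ H (s, 1) = z) ∧
    (∀ s ∈ Icc (0 : ℝ) 1, ∀ t ∈ Ioc (0 : ℝ) 1, H (s, t) ∉ S)

/-- The function elements `F t`, `0 ≤ t ≤ 1`, form an analytic continuation of (the germ at `γ 0`
of) `f` along the path `γ : [0, 1] → ℂ`. -/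
structure IsAnalyticContinuation (f : ℂ → ℂ) (γ : ℝ → ℂ) (F : ℝ → ℂ → ℂ) : Prop where
  start : F 0 =ᶠ[𝓝 (γ 0)] f
  analytic : ∀ t ∈ Icc (0 : ℝ) 1, AnalyticAt ℂ (F t) (γ t)
  compatible : ∀ t ∈ Icc (0 : ℝ) 1, ∀ᶠ s in 𝓝[Icc 0 1] t, F s =ᶠ[𝓝 (γ s)] F t

/-- The value `± i π + log ((z - τ) / τ)`, with the sign `-` if `τ` is passed above and the sign
`+` if it is passed below. -/
def branchValue (above : Set ℝ) (τ z : ℝ) : ℂ :=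
  open Classical in
  (if τ ∈ above then -1 else 1) * (Complex.I * (Real.pi : ℂ)) + (Real.log ((z - τ) / τ) : ℂ)

/-- The defining requirements on the extension to all words of the iterated integrals along a path
`δ` that starts at the letter `τ`: they are the iterated integrals for the words that do not end
in `τ`, the map is linear and multiplicative for the shuffle product, and `τ ↦ c`. -/
structure IsExtendedIntegral {S : Finset ℂ} (τ : S) (δ : ℝ → ℂ) (c : ℂ)
    (I : WordSpace S →ₗ[ℚ] ℂ) : Prop where
  eq_iterInt : ∀ w : List S, τ ∉ w.getLast? → I (word w) = iterInt δ (w.map Subtype.val) 1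
  map_shuffle : ∀ u v : List S, I (shuffleWords u v) = I (word u) * I (word v)
  map_letter : I (word [τ]) = c

end Hyperlogs

end

/-!
The letter `τ` is a tangential base point. Near `τ` the function `L_w` is a polynomial in
`K = log (1 - p / τ) = L_{ω_τ}` with coefficients analytic at `τ`; so is a solution `E_u` of the
same differential equations that is normalized by `E_{ω_τ^n} = K ^ n / n!` and by tending to `0`
at `τ`, faster than any power of `K` grows, when `u` has a letter other than `τ`.

The shuffle algebra is a polynomial ring in the variable `ω_τ` over the kernel of the locally
nilpotent derivation that deletes a leading `τ`, and evaluation at `ω_τ = 0` is `reg^τ`. Hence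
`reg^τ` exists and is unique, every word is `∑ ω_τ^k ⧢ reg^τ (…)`, and the part of `L_w` that
survives at `τ` is `∑ K ^ k / k! * L_{reg^τ (…)} τ`. The derivation that deletes a final `τ`
gives the uniqueness of `∫_τ^z` in the same way.

Therefore `L_w` and `∑ E_{w.take k} * L_{reg^τ (w.drop k)} τ` satisfy, by induction on `w`,
the same differential equation on the segment from `0` to `τ`, and their difference tends to `0`
at `τ`; so they agree, and they remain equal under continuation along a common path to `z`. All
admissible paths can be deformed into graphs over the real axis through the heights allowed by the
prescribed sides. A graph from `τ` and a graph from `0` can be merged just to the right of `τ`,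
where passing below or above `τ` turns `K` into `log ((p - τ) / τ) ± i π`.
-/

noncomputable section

namespace Hyperlogs

open Set Filter Topology

/-! ### Locally nilpotent derivations -/

section LocallyNilpotent

variable {A B : Type*} [CommRing A] [Algebra ℚ A] [CommRing B] [Algebra ℚ B]
  {D : Derivation ℚ A A} {s : A}

/-- Every element is annihilated by some power of the derivation `D`. -/
def IsLocallyNilpotent (D : Derivation ℚ A A) : Prop :=
  ∀ a, ∃ n, D^[n] a = 0

/-- The divided power `a ^ n / n!`. -/
def divPow (a : A) (n : ℕ) : A := (n.factorial : ℚ)⁻¹ • a ^ n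

@[simp]
lemma divPow_zero (a : A) : divPow a 0 = 1 := by simp [divPow]

lemma divPow_mul_divPow (a : A) (m n : ℕ) :
    divPow a m * divPow a n = ((m + n).choose n : ℚ) • divPow a (m + n) := by
  rw [divPow, divPow, divPow, smul_mul_smul_comm, ← pow_add, smul_smul,
    Nat.add_choose, Nat.cast_div_charZero (Nat.factorial_mul_factorial_dvd_factorial_add m n)]
  congr 1
  push_cast
  field_simp

lemma mul_divPow (a : A) (n : ℕ) : a * divPow a n = ((n : ℚ) + 1) • divPow a (n + 1) := by
  have h : ((n : ℚ) + 1) ≠ 0 := by positivity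
  rw [divPow, divPow, mul_smul_comm, ← pow_succ', smul_smul, Nat.factorial_succ]
  congr 1
  push_cast
  field_simp

lemma map_divPow (f : A →ₐ[ℚ] B) (a : A) (n : ℕ) : f (divPow a n) = divPow (f a) n := by
  rw [divPow, map_smul, map_pow, divPow]

lemma dvd_divPow_succ (a : A) (n : ℕ) : a ∣ divPow a (n + 1) :=
  ⟨((n + 1).factorial : ℚ)⁻¹ • a ^ n, by rw [divPow, pow_succ', mul_smul_comm]⟩

lemma derivation_divPow_succ (hs : D s = 1) (n : ℕ) : D (divPow s (n + 1)) = divPow s n := by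
  have h : ((n : ℚ) + 1) ≠ 0 := by positivity
  rw [divPow, divPow, D.map_smul, D.leibniz_pow, hs, Nat.factorial_succ, add_tsub_cancel_right,
    smul_eq_mul, mul_one, ← Nat.cast_smul_eq_nsmul ℚ, smul_smul]
  congr 1
  push_cast
  field_simp

lemma derivation_iterate_of_le {a : A} {m n : ℕ} (h : D^[m] a = 0) (hmn : m ≤ n) :
    D^[n] a = 0 := by
  obtain ⟨k, rfl⟩ := Nat.exists_eq_add_of_le' hmn
  rw [Function.iterate_add_apply, h, iterate_map_zero]

lemma derivation_iterate_slice_mul (hs : D s = 1) (n : ℕ) (a : A) :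
    D^[n + 1] (s * a) = s * D^[n + 1] a + ((n : ℚ) + 1) • D^[n] a := by
  induction n with
  | zero => simp [hs]
  | succ n ih =>
    rw [Function.iterate_succ_apply', ih, map_add, D.map_smul, D.leibniz, hs,
      ← Function.iterate_succ_apply' D (n + 1), ← Function.iterate_succ_apply' D n]
    simp only [smul_eq_mul, mul_one, add_assoc]
    push_cast
    module

/-- The `n`-th term of the Dixmier map. -/
def dixmierTerm (D : Derivation ℚ A A) (s : A) (n : ℕ) : A →ₗ[ℚ] A :=
  (-1 : ℚ) ^ n • LinearMap.mulLeft ℚ (divPow s n) ∘ₗ (D : A →ₗ[ℚ] A) ^ n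

lemma dixmierTerm_apply (n : ℕ) (a : A) :
    dixmierTerm D s n a = (-1 : ℚ) ^ n • (divPow s n * D^[n] a) := by
  simp only [dixmierTerm, LinearMap.smul_apply, LinearMap.comp_apply, LinearMap.mulLeft_apply,
    Module.End.pow_apply, Derivation.coeFn_coe]

lemma derivation_sum_dixmierTerm (hs : D s = 1) (n : ℕ) (a : A) :
    D (∑ k ∈ Finset.range (n + 1), dixmierTerm D s k a) =
      (-1 : ℚ) ^ n • (divPow s n * D^[n + 1] a) := by
  induction n with
  | zero => simp [dixmierTerm_apply]
  | succ n ih =>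
    rw [Finset.sum_range_succ, map_add, ih, dixmierTerm_apply, D.map_smul, D.leibniz,
      derivation_divPow_succ hs, ← Function.iterate_succ_apply' D (n + 1), pow_succ]
    simp only [smul_eq_mul, mul_comm (D^[n + 1] a)]
    module

lemma sum_dixmierTerm_slice_mul (hs : D s = 1) (n : ℕ) (a : A) :
    ∑ k ∈ Finset.range (n + 1), dixmierTerm D s k (s * a) =
      (-1 : ℚ) ^ n • (divPow s n * (s * D^[n] a)) := by
  induction n with
  | zero => simp [dixmierTerm_apply]
  | succ n ih =>
    have h : divPow s n * (s * D^[n] a) = ((n : ℚ) + 1) • (divPow s (n + 1) * D^[n] a) := by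
      rw [← mul_assoc, mul_comm (divPow s n), mul_divPow, smul_mul_assoc]
    rw [Finset.sum_range_succ, ih, h, dixmierTerm_apply, derivation_iterate_slice_mul hs, mul_add,
      mul_smul_comm, pow_succ]
    module

lemma dixmierTerm_eq_zero {a : A} {N n : ℕ} (hN : D^[N] a = 0) (hn : N ≤ n) (s : A) :
    dixmierTerm D s n a = 0 := by
  rw [dixmierTerm_apply, derivation_iterate_of_le hN hn, mul_zero, smul_zero]

lemma hasFiniteSupport_dixmierTerm (hD : IsLocallyNilpotent D) (s a : A) :
    (Function.support fun n => dixmierTerm D s n a).Finite := by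
  obtain ⟨N, hN⟩ := hD a
  refine (Set.finite_lt_nat N).subset fun n hn => ?_
  by_contra h
  exact hn (dixmierTerm_eq_zero hN (not_lt.1 h) s)

/-- The Dixmier map `a ↦ ∑ (-s)ⁿ / n! * Dⁿ a` of a locally nilpotent derivation, as a linear map.
When `D s = 1`, it is the projection of `A = (ker D)[s]` onto `ker D` that sends `s` to `0`. -/
def dixmier (hD : IsLocallyNilpotent D) (s : A) : A →ₗ[ℚ] A where
  toFun a := ∑ᶠ n, dixmierTerm D s n a
  map_add' a b := by
    simp only [map_add]
    exact finsum_add_distrib (hasFiniteSupport_dixmierTerm hD s a)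
      (hasFiniteSupport_dixmierTerm hD s b)
  map_smul' c a := by
    simp only [map_smul, RingHom.id_apply]
    exact (smul_finsum' c (hasFiniteSupport_dixmierTerm hD s a)).symm

variable (hD : IsLocallyNilpotent D)

include hD

lemma dixmier_eq_sum {a : A} {N : ℕ} (hN : D^[N] a = 0) :
    dixmier hD s a = ∑ n ∈ Finset.range N, dixmierTerm D s n a := by
  refine finsum_eq_finsetSum_of_support_subset _ fun n hn => ?_
  by_contra h
  exact hn (dixmierTerm_eq_zero hN (by simpa using h) s)

lemma derivation_dixmier (hs : D s = 1) (a : A) : D (dixmier hD s a) = 0 := by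
  obtain ⟨N, hN⟩ := hD a
  have hN' := derivation_iterate_of_le hN (Nat.le_succ N)
  rw [dixmier_eq_sum hD hN', derivation_sum_dixmierTerm hs, hN', mul_zero, smul_zero]

lemma dixmier_of_derivation_eq_zero {a : A} (ha : D a = 0) : dixmier hD s a = a := by
  rw [dixmier_eq_sum hD (N := 1) ha]
  simp [dixmierTerm_apply]

lemma derivation_dixmier_comm {D' : Derivation ℚ A A} (hDD' : ∀ a, D (D' a) = D' (D a))
    (hs : D' s = 0) (a : A) : D' (dixmier hD s a) = dixmier hD s (D' a) := by
  obtain ⟨N, hN⟩ := hD a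
  have hiter (n : ℕ) : D^[n] (D' a) = D' (D^[n] a) :=
    (Function.Commute.iterate_left (f := D) (g := D') hDD' n) a
  have hpow (n : ℕ) : D' (divPow s n) = 0 := by
    rw [divPow, D'.map_smul, D'.leibniz_pow, hs, smul_zero, smul_zero, smul_zero]
  rw [dixmier_eq_sum hD hN, dixmier_eq_sum hD (N := N) (by rw [hiter, hN, map_zero]), map_sum]
  refine Finset.sum_congr rfl fun n _ => ?_
  rw [dixmierTerm_apply, dixmierTerm_apply, D'.map_smul, D'.leibniz, hpow, hiter, smul_zero,
    add_zero, smul_eq_mul]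

lemma dixmier_slice_mul (hs : D s = 1) (a : A) : dixmier hD s (s * a) = 0 := by
  obtain ⟨N, hN⟩ := hD a
  have hN' := derivation_iterate_of_le hN (Nat.le_succ N)
  rw [dixmier_eq_sum hD (N := N + 2), sum_dixmierTerm_slice_mul hs, hN', mul_zero, mul_zero,
    smul_zero]
  rw [derivation_iterate_slice_mul hs, hN', Function.iterate_succ_apply', hN']
  simp

lemma slice_dvd_sub_dixmier (s a : A) : s ∣ a - dixmier hD s a := by
  obtain ⟨N, hN⟩ := hD a
  rw [dixmier_eq_sum hD (derivation_iterate_of_le hN (Nat.le_succ N)), Finset.sum_range_succ',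
    dixmierTerm_apply 0]
  simp only [pow_zero, divPow_zero, one_mul, one_smul, Function.iterate_zero_apply,
    sub_add_cancel_right, dvd_neg]
  refine Finset.dvd_sum fun n _ => ?_
  rw [dixmierTerm_apply, ← mul_smul_comm]
  exact (dvd_divPow_succ s n).mul_right _

lemma dixmier_eq_of_dvd_sub (hs : D s = 1) {a b : A} (hb : D b = 0) (h : s ∣ a - b) :
    dixmier hD s a = b := by
  obtain ⟨q, hq⟩ := h
  rw [eq_add_of_sub_eq' hq, map_add, dixmier_slice_mul hD hs, add_zero,
    dixmier_of_derivation_eq_zero hD hb]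

lemma dixmier_mul (hs : D s = 1) (a b : A) :
    dixmier hD s (a * b) = dixmier hD s a * dixmier hD s b := by
  refine dixmier_eq_of_dvd_sub hD hs ?_ ?_
  · rw [D.leibniz, derivation_dixmier hD hs, derivation_dixmier hD hs, smul_zero, smul_zero,
      add_zero]
  · have h : a * b - dixmier hD s a * dixmier hD s b =
        (a - dixmier hD s a) * b + dixmier hD s a * (b - dixmier hD s b) := by ring
    rw [h]
    exact ((slice_dvd_sub_dixmier hD s a).mul_right b).add
      ((slice_dvd_sub_dixmier hD s b).mul_left _)

lemma eq_sum_divPow_mul_dixmier (hs : D s = 1) {a : A} {N : ℕ} (hN : D^[N] a = 0) :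
    a = ∑ k ∈ Finset.range N, divPow s k * dixmier hD s (D^[k] a) := by
  induction N generalizing a with
  | zero => simpa using hN
  | succ N ih =>
    have hderiv : D (a - ∑ k ∈ Finset.range (N + 1), divPow s k * dixmier hD s (D^[k] a)) = 0 := by
      have h := ih (a := D a) hN
      simp only [← Function.iterate_succ_apply] at h
      rw [Finset.sum_range_succ', map_sub, map_add, map_sum]
      simp only [D.leibniz, derivation_dixmier hD hs, derivation_divPow_succ hs, divPow_zero,
        mul_zero, zero_add, add_zero, one_mul, Function.iterate_zero_apply, smul_eq_mul]
      rw [sub_eq_zero]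
      exact h.trans (Finset.sum_congr rfl fun k _ => mul_comm _ _)
    have hdvd : s ∣ a - ∑ k ∈ Finset.range (N + 1), divPow s k * dixmier hD s (D^[k] a) := by
      rw [Finset.sum_range_succ', Function.iterate_zero_apply, divPow_zero, one_mul, add_comm,
        ← sub_sub]
      exact (slice_dvd_sub_dixmier hD s a).sub
        (Finset.dvd_sum fun k _ => (dvd_divPow_succ s k).mul_right _)
    rw [← sub_eq_zero, ← dixmier_of_derivation_eq_zero hD (s := s) hderiv]
    exact dixmier_eq_of_dvd_sub hD hs (map_zero D) (by simpa using hdvd)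

-- `A` is generated by `ker D` and `s`.
lemma algHom_ext_of_slice (hs : D s = 1) {f g : A →ₐ[ℚ] B} (hfg : ∀ a, D a = 0 → f a = g a)
    (h : f s = g s) : f = g := by
  ext a
  obtain ⟨N, hN⟩ := hD a
  rw [eq_sum_divPow_mul_dixmier hD hs hN, map_sum, map_sum]
  refine Finset.sum_congr rfl fun k _ => ?_
  rw [map_mul, map_mul, map_divPow, map_divPow, h, hfg _ (derivation_dixmier hD hs _)]

end LocallyNilpotent

/-! ### The shuffle algebra -/

section ShuffleProduct

variable {α : Type} {M : Type*} [AddCommGroup M] [Module ℚ M]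

lemma wordSpace_hom_ext {f g : WordSpace α →ₗ[ℚ] M} (h : ∀ w, f (word w) = g (word w)) : f = g :=
  Finsupp.lhom_ext' fun w => LinearMap.ext_ring (h w)

lemma wordSpace_bilin_ext {f g : WordSpace α →ₗ[ℚ] WordSpace α →ₗ[ℚ] M}
    (h : ∀ u v, f (word u) (word v) = g (word u) (word v)) : f = g :=
  wordSpace_hom_ext fun u => wordSpace_hom_ext fun v => h u v

lemma eqOn_supported_of_word {f g : WordSpace α →ₗ[ℚ] M} {P : Set (List α)}
    (h : ∀ w ∈ P, f (word w) = g (word w)) : EqOn f g (Finsupp.supported ℚ ℚ P) := by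
  rw [Finsupp.supported_eq_span_single]
  exact LinearMap.eqOn_span' (by rintro _ ⟨w, hw, rfl⟩; exact h w hw)

/-- The shuffle product as a bilinear map. -/
def shuffleLin : WordSpace α →ₗ[ℚ] WordSpace α →ₗ[ℚ] WordSpace α :=
  Finsupp.linearCombination ℚ fun u => Finsupp.linearCombination ℚ fun v => shuffleWords u v

lemma shuffleLin_word (u v : List α) : shuffleLin (word u) (word v) = shuffleWords u v := by
  simp [shuffleLin]

lemma shuffle_eq_shuffleLin (x y : WordSpace α) : shuffle x y = shuffleLin x y := by
  unfold shuffle shuffleLin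
  rw [Finsupp.linearCombination_apply, Finsupp.sum, Finsupp.sum, LinearMap.sum_apply]
  refine Finset.sum_congr rfl fun u _ => ?_
  rw [LinearMap.smul_apply, Finsupp.linearCombination_apply, Finsupp.smul_sum]
  simp only [mul_smul]

lemma shuffleWords_nil_left (v : List α) : shuffleWords [] v = word v := by
  simp [shuffleWords]

lemma shuffleWords_nil_right (u : List α) : shuffleWords u [] = word u := by
  cases u <;> simp [shuffleWords]

lemma shuffleWords_cons_cons (a b : α) (u v : List α) :
    shuffleWords (a :: u) (b :: v) =
      (shuffleWords u (b :: v)).mapDomain (a :: ·) +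
        (shuffleWords (a :: u) v).mapDomain (b :: ·) := by
  rw [shuffleWords]

lemma shuffleLin_nil_left (x : WordSpace α) : shuffleLin (word []) x = x := by
  suffices h : shuffleLin (word ([] : List α)) = LinearMap.id from DFunLike.congr_fun h x
  exact wordSpace_hom_ext fun v => by
    rw [shuffleLin_word, shuffleWords_nil_left, LinearMap.id_apply]

/-- The linear map that deletes a leading letter `a`, and kills the words that do not begin
with `a`. -/
def dropHead (a : α) : WordSpace α →ₗ[ℚ] WordSpace α :=
  Finsupp.lcomapDomain (a :: ·) List.cons_injective

/-- The linear map that deletes a final letter `a`, and kills the words that do not end in `a`. -/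
def dropLast (a : α) : WordSpace α →ₗ[ℚ] WordSpace α :=
  Finsupp.lcomapDomain (· ++ [a]) (List.append_left_injective [a])

lemma dropHead_apply (a : α) (x : WordSpace α) (u : List α) : dropHead a x u = x (a :: u) := rfl

lemma dropLast_apply (a : α) (x : WordSpace α) (u : List α) : dropLast a x u = x (u ++ [a]) := rfl

lemma dropHead_dropLast (a b : α) (x : WordSpace α) :
    dropHead a (dropLast b x) = dropLast b (dropHead a x) :=
  Finsupp.ext fun _ => rfl

lemma dropHead_iterate_apply (a : α) (n : ℕ) (x : WordSpace α) (u : List α) :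
    (dropHead a)^[n] x u = x (List.replicate n a ++ u) := by
  induction n generalizing x with
  | zero => rfl
  | succ n ih => rw [Function.iterate_succ_apply, ih, dropHead_apply]; rfl

lemma dropLast_iterate_apply (a : α) (n : ℕ) (x : WordSpace α) (u : List α) :
    (dropLast a)^[n] x u = x (u ++ List.replicate n a) := by
  induction n generalizing x with
  | zero => simp
  | succ n ih =>
    rw [Function.iterate_succ_apply, ih, dropLast_apply, List.replicate_succ', List.append_assoc]

lemma apply_eq_zero_of_sup_length_lt {x : WordSpace α} {w : List α}
    (h : x.support.sup List.length < w.length) : x w = 0 := by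
  by_contra hx
  exact h.not_ge (Finset.le_sup (f := List.length) (Finsupp.mem_support_iff.2 hx))

lemma exists_dropHead_iterate_eq_zero (a : α) (x : WordSpace α) : ∃ n, (dropHead a)^[n] x = 0 :=
  ⟨x.support.sup List.length + 1, Finsupp.ext fun u => by
    rw [dropHead_iterate_apply, apply_eq_zero_of_sup_length_lt (by
      rw [List.length_append, List.length_replicate]; lia), Finsupp.zero_apply]⟩

lemma exists_dropLast_iterate_eq_zero (a : α) (x : WordSpace α) : ∃ n, (dropLast a)^[n] x = 0 :=
  ⟨x.support.sup List.length + 1, Finsupp.ext fun u => by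
    rw [dropLast_iterate_apply, apply_eq_zero_of_sup_length_lt (by
      rw [List.length_append, List.length_replicate]; lia), Finsupp.zero_apply]⟩

lemma dropHead_iterate_word_of_length_lt (a : α) {w : List α} {n : ℕ} (h : w.length < n) :
    (dropHead a)^[n] (word w) = 0 := by
  ext u
  rw [dropHead_iterate_apply, Finsupp.single_eq_of_ne, Finsupp.zero_apply]
  rintro rfl
  simp at h

lemma dropHead_iterate_word [DecidableEq α] (a : α) (w : List α) (n : ℕ) :
    (dropHead a)^[n] (word w) = if w.take n = List.replicate n a then word (w.drop n) else 0 := by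
  ext u
  rw [dropHead_iterate_apply, word, Finsupp.single_apply]
  have key : w = List.replicate n a ++ u ↔ w.take n = List.replicate n a ∧ w.drop n = u :=
    ⟨fun hw => by simp [hw], fun hw => by rw [← hw.1, ← hw.2, List.take_append_drop]⟩
  simp only [key]
  split_ifs <;> simp_all

lemma dropHead_nil (a : α) : dropHead a (word []) = 0 := by
  ext u
  simp [dropHead_apply]

lemma dropLast_letter_self (a : α) : dropLast a (word [a]) = word [] := by
  classical
  ext u
  simp [dropLast_apply, Finsupp.single_apply]

lemma dropHead_cons [DecidableEq α] (a b : α) (u : List α) :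
    dropHead a (word (b :: u)) = if b = a then word u else 0 := by
  classical
  ext v
  split_ifs with h <;> simp [dropHead_apply, Finsupp.single_apply, h]

lemma dropHead_mapDomain_cons [DecidableEq α] (a b : α) (x : WordSpace α) :
    dropHead a (x.mapDomain (b :: ·)) = if b = a then x else 0 := by
  ext v
  split_ifs with h
  · rw [dropHead_apply, h, Finsupp.mapDomain_apply List.cons_injective]
  · rw [dropHead_apply, Finsupp.mapDomain_of_notMem_range, Finsupp.zero_apply]
    simp [h]

lemma dropHead_shuffleWords (a : α) (u v : List α) :
    dropHead a (shuffleWords u v) =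
      shuffleLin (dropHead a (word u)) (word v) + shuffleLin (word u) (dropHead a (word v)) := by
  classical
  rcases u with _ | ⟨b, u⟩
  · simp [shuffleWords_nil_left, dropHead_nil, shuffleLin_nil_left]
  rcases v with _ | ⟨c, v⟩
  · rw [shuffleWords_nil_right, dropHead_nil, map_zero, add_zero, dropHead_cons]
    split_ifs
    · rw [shuffleLin_word, shuffleWords_nil_right]
    · simp
  · rw [shuffleWords_cons_cons, map_add, dropHead_mapDomain_cons, dropHead_mapDomain_cons,
      dropHead_cons, dropHead_cons]
    congr 1 <;> split_ifs <;> simp [shuffleLin_word]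

lemma dropHead_shuffleLin (a : α) (x y : WordSpace α) :
    dropHead a (shuffleLin x y) = shuffleLin (dropHead a x) y + shuffleLin x (dropHead a y) := by
  suffices h : shuffleLin.compr₂ (dropHead a) =
      shuffleLin.comp (dropHead a) + shuffleLin.compl₂ (dropHead a) from
    LinearMap.congr_fun₂ h x y
  exact wordSpace_bilin_ext fun u v => by simpa [shuffleLin_word] using dropHead_shuffleWords a u v

lemma shuffleWords_apply_nil (u v : List α) :
    shuffleWords u v [] = word u [] * word v [] := by
  rcases u with _ | ⟨b, u⟩
  · simp [shuffleWords_nil_left]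
  rcases v with _ | ⟨c, v⟩
  · simp [shuffleWords_nil_right]
  · rw [shuffleWords_cons_cons, Finsupp.add_apply, Finsupp.mapDomain_of_notMem_range,
      Finsupp.mapDomain_of_notMem_range] <;> simp

lemma shuffleLin_apply_nil (x y : WordSpace α) : shuffleLin x y [] = x [] * y [] := by
  suffices h : shuffleLin.compr₂ (Finsupp.lapply []) =
      (LinearMap.mul ℚ ℚ).compl₁₂ (Finsupp.lapply ([] : List α)) (Finsupp.lapply []) from
    LinearMap.congr_fun₂ h x y
  exact wordSpace_bilin_ext fun u v => by simpa [shuffleLin_word] using shuffleWords_apply_nil u v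

lemma shuffleLin_comm (x y : WordSpace α) : shuffleLin x y = shuffleLin y x := by
  ext w
  induction w generalizing x y with
  | nil => rw [shuffleLin_apply_nil, shuffleLin_apply_nil, mul_comm]
  | cons a w ih =>
    rw [← dropHead_apply, ← dropHead_apply, dropHead_shuffleLin, dropHead_shuffleLin,
      Finsupp.add_apply, Finsupp.add_apply, ih, ih x, add_comm]

lemma shuffleLin_assoc (x y z : WordSpace α) :
    shuffleLin (shuffleLin x y) z = shuffleLin x (shuffleLin y z) := by
  ext w
  induction w generalizing x y z with
  | nil => simp only [shuffleLin_apply_nil, mul_assoc]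
  | cons a w ih =>
    simp only [← dropHead_apply, dropHead_shuffleLin, map_add, LinearMap.add_apply,
      Finsupp.add_apply, ih, add_assoc]

lemma dropLast_shuffleLin (a : α) (x y : WordSpace α) :
    dropLast a (shuffleLin x y) = shuffleLin (dropLast a x) y + shuffleLin x (dropLast a y) := by
  ext w
  induction w generalizing x y with
  | nil =>
    change dropHead a (shuffleLin x y) [] = _
    simp only [dropHead_shuffleLin, Finsupp.add_apply, shuffleLin_apply_nil]
    rfl
  | cons b w ih =>
    simp only [← dropHead_apply, dropHead_dropLast, dropHead_shuffleLin, map_add,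
      Finsupp.add_apply, ih]
    ring

/-- The words that do not begin with the letter `a`. -/
def notBeginningWith (a : α) : Set (List α) := {w | a ∉ w.head?}

/-- The words that do not end in the letter `a`. -/
def notEndingIn (a : α) : Set (List α) := {w | a ∉ w.getLast?}

lemma mem_supported_notBeginningWith {a : α} {x : WordSpace α} :
    x ∈ Finsupp.supported ℚ ℚ (notBeginningWith a) ↔ dropHead a x = 0 := by
  rw [Finsupp.mem_supported']
  refine ⟨fun h => Finsupp.ext fun u => h _ (by simp [notBeginningWith]), fun h w hw => ?_⟩
  obtain ⟨u, rfl⟩ := List.head?_eq_some_iff.1 (not_not.1 hw)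
  rw [← dropHead_apply, h, Finsupp.zero_apply]

lemma mem_supported_notEndingIn {a : α} {x : WordSpace α} :
    x ∈ Finsupp.supported ℚ ℚ (notEndingIn a) ↔ dropLast a x = 0 := by
  rw [Finsupp.mem_supported']
  refine ⟨fun h => Finsupp.ext fun u => h _ (by simp [notEndingIn]), fun h w hw => ?_⟩
  obtain ⟨u, rfl⟩ := List.getLast?_eq_some_iff.1 (not_not.1 hw)
  rw [← dropLast_apply, h, Finsupp.zero_apply]

lemma tail_mem_notEndingIn {a b : α} {u : List α} (h : b :: u ∈ notEndingIn a) :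
    u ∈ notEndingIn a := by
  cases u <;> simp_all [notEndingIn]

lemma cons_mem_notEndingIn {a b : α} {u : List α} (hu : u ≠ []) (h : u ∈ notEndingIn a) :
    b :: u ∈ notEndingIn a := by
  cases u <;> simp_all [notEndingIn]

lemma drop_mem_notEndingIn {a : α} {w : List α} (hw : w ∈ notEndingIn a) (k : ℕ) :
    w.drop k ∈ notEndingIn a := by
  intro h
  rw [List.getLast?_drop] at h
  split_ifs at h
  · simp at h
  · exact hw h

lemma replicate_mem_notEndingIn {a b : α} (h : b ≠ a) (n : ℕ) :
    List.replicate n b ∈ notEndingIn a := by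
  cases n <;> simp [notEndingIn, List.getLast?_replicate, h]

lemma shuffleLin_mem_notEndingIn {a : α} {x y : WordSpace α}
    (hx : x ∈ Finsupp.supported ℚ ℚ (notEndingIn a))
    (hy : y ∈ Finsupp.supported ℚ ℚ (notEndingIn a)) :
    shuffleLin x y ∈ Finsupp.supported ℚ ℚ (notEndingIn a) := by
  rw [mem_supported_notEndingIn] at *
  rw [dropLast_shuffleLin, hx, hy, map_zero (shuffleLin x), LinearMap.map_zero₂, add_zero]

lemma shuffleWords_letter_replicate (a : α) (n : ℕ) :
    shuffleWords [a] (List.replicate n a) = ((n : ℚ) + 1) • word (List.replicate (n + 1) a) := by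
  induction n with
  | zero => simp [shuffleWords_nil_right]
  | succ n ih =>
    rw [List.replicate_succ, shuffleWords_cons_cons, ih, shuffleWords_nil_left,
      Finsupp.mapDomain_smul, Finsupp.mapDomain_single, Finsupp.mapDomain_single,
      ← List.replicate_succ, ← List.replicate_succ]
    push_cast
    module

lemma perm_of_mem_support_shuffleWords (u v : List α) {w : List α}
    (hw : w ∈ (shuffleWords u v).support) : w.Perm (u ++ v) := by
  classical
  induction u generalizing v w with
  | nil =>
    rw [shuffleWords_nil_left] at hw
    rw [Finset.mem_singleton.1 (Finsupp.support_single_subset hw), List.nil_append]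
  | cons a u ihu =>
    induction v generalizing w with
    | nil =>
      rw [shuffleWords_nil_right] at hw
      rw [Finset.mem_singleton.1 (Finsupp.support_single_subset hw), List.append_nil]
    | cons b v ihv =>
      rw [shuffleWords_cons_cons] at hw
      rcases Finset.mem_union.1 (Finsupp.support_add hw) with hw | hw
      · obtain ⟨x, hx, rfl⟩ := Finset.mem_image.1 (Finsupp.mapDomain_support hw)
        exact (ihu (b :: v) hx).cons a
      · obtain ⟨x, hx, rfl⟩ := Finset.mem_image.1 (Finsupp.mapDomain_support hw)
        exact ((ihv hx).cons b).trans List.perm_middle.symm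

end ShuffleProduct

/-- The vector space `WordSpace α` with the shuffle product as multiplication. It is a type synonym,
since finitely supported functions already carry the pointwise product. -/
def ShuffleAlgebra (α : Type) : Type := WordSpace α

namespace ShuffleAlgebra

variable {α : Type} {B : Type*} [CommRing B] [Algebra ℚ B]

instance : AddCommGroup (ShuffleAlgebra α) := inferInstanceAs (AddCommGroup (WordSpace α))

instance : Module ℚ (ShuffleAlgebra α) := inferInstanceAs (Module ℚ (WordSpace α))

/-- The identity of `WordSpace α`, seen as a map to the shuffle algebra. -/
def of : WordSpace α ≃ₗ[ℚ] ShuffleAlgebra α := LinearEquiv.refl ℚ (WordSpace α)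

instance : CommRing (ShuffleAlgebra α) where
  __ := (inferInstance : AddCommGroup (ShuffleAlgebra α))
  mul x y := of (shuffleLin (of.symm x) (of.symm y))
  one := of (word [])
  left_distrib x y z := map_add (shuffleLin x) y z
  right_distrib x y z := LinearMap.map_add₂ shuffleLin x y z
  zero_mul x := LinearMap.map_zero₂ shuffleLin x
  mul_zero x := map_zero (shuffleLin x)
  mul_assoc := shuffleLin_assoc
  one_mul := shuffleLin_nil_left
  mul_one x := (shuffleLin_comm _ _).trans (shuffleLin_nil_left x)
  mul_comm := shuffleLin_comm

instance : Algebra ℚ (ShuffleAlgebra α) :=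
  Algebra.ofModule (fun c x y => LinearMap.map_smul₂ shuffleLin c x y)
    (fun c x y => map_smul (shuffleLin x) c y)

lemma of_nil : of (word ([] : List α)) = 1 := rfl

lemma of_shuffleLin (x y : WordSpace α) : of (shuffleLin x y) = of x * of y := rfl

lemma of_shuffleWords (u v : List α) :
    of (shuffleWords u v) = of (word u) * of (word v) := by
  rw [← of_shuffleLin, shuffleLin_word]

lemma of_shuffle (x y : WordSpace α) : of (shuffle x y) = of x * of y := by
  rw [← of_shuffleLin, shuffle_eq_shuffleLin]

/-- The algebra homomorphism given by a linear map that is multiplicative on words. -/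
def lift (f : WordSpace α →ₗ[ℚ] B) (h_one : f (word []) = 1)
    (h_mul : ∀ u v, f (shuffleWords u v) = f (word u) * f (word v)) : ShuffleAlgebra α →ₐ[ℚ] B :=
  .ofLinearMap (f ∘ₗ of.symm.toLinearMap) h_one fun x y => by
    suffices h : shuffleLin.compr₂ f = (LinearMap.mul ℚ B).compl₁₂ f f from
      LinearMap.congr_fun₂ h x y
    exact wordSpace_bilin_ext fun u v => by simpa [shuffleLin_word] using h_mul u v

/-- Deletion of a leading letter `a`, which is a derivation of the shuffle product. -/
def headDeriv (a : α) : Derivation ℚ (ShuffleAlgebra α) (ShuffleAlgebra α) :=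
  Derivation.mk' (of.toLinearMap ∘ₗ dropHead a ∘ₗ of.symm.toLinearMap) fun x y =>
    (dropHead_shuffleLin a x y).trans <| (add_comm _ _).trans <|
      congrArg (shuffleLin x (dropHead a y) + ·) (shuffleLin_comm _ _)

/-- Deletion of a final letter `a`, which is a derivation of the shuffle product. -/
def lastDeriv (a : α) : Derivation ℚ (ShuffleAlgebra α) (ShuffleAlgebra α) :=
  Derivation.mk' (of.toLinearMap ∘ₗ dropLast a ∘ₗ of.symm.toLinearMap) fun x y =>
    (dropLast_shuffleLin a x y).trans <| (add_comm _ _).trans <|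
      congrArg (shuffleLin x (dropLast a y) + ·) (shuffleLin_comm _ _)

lemma headDeriv_of (a : α) (x : WordSpace α) : headDeriv a (of x) = of (dropHead a x) := rfl

lemma lastDeriv_of (a : α) (x : WordSpace α) : lastDeriv a (of x) = of (dropLast a x) := rfl

lemma headDeriv_lastDeriv (a b : α) (x : ShuffleAlgebra α) :
    headDeriv a (lastDeriv b x) = lastDeriv b (headDeriv a x) :=
  dropHead_dropLast a b x

lemma headDeriv_iterate_of (a : α) (n : ℕ) (x : WordSpace α) :
    (headDeriv a)^[n] (of x) = of ((dropHead a)^[n] x) :=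
  (Function.Semiconj.iterate_right (f := of) (fun y => (headDeriv_of a y).symm) n x).symm

lemma isLocallyNilpotent_headDeriv (a : α) : IsLocallyNilpotent (headDeriv a) :=
  exists_dropHead_iterate_eq_zero a

lemma isLocallyNilpotent_lastDeriv (a : α) : IsLocallyNilpotent (lastDeriv a) :=
  exists_dropLast_iterate_eq_zero a

lemma headDeriv_letter (a : α) : headDeriv a (of (word [a])) = 1 := by
  classical
  rw [headDeriv_of, dropHead_cons, if_pos rfl, of_nil]

lemma lastDeriv_letter_self (a : α) : lastDeriv a (of (word [a])) = 1 :=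
  dropLast_letter_self a

lemma lastDeriv_letter_of_ne {a b : α} (h : b ≠ a) : lastDeriv a (of (word [b])) = 0 := by
  rw [lastDeriv_of, mem_supported_notEndingIn.1, map_zero]
  exact Finsupp.single_mem_supported _ _ (replicate_mem_notEndingIn h 1)

lemma of_replicate (a : α) (n : ℕ) :
    of (word (List.replicate n a)) = divPow (of (word [a])) n := by
  induction n with
  | zero => rw [List.replicate_zero, of_nil, divPow_zero]
  | succ n ih =>
    have h : ((n : ℚ) + 1) ≠ 0 := by positivity
    rw [← smul_right_inj h, ← mul_divPow, ← ih, ← of_shuffleWords, shuffleWords_letter_replicate,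
      map_smul]

end ShuffleAlgebra

section Regularization

open ShuffleAlgebra

variable {α : Type}

/-- The shuffle regularization `reg^τ`: the Dixmier map of the derivation that deletes a leading
letter `τ`, with respect to the slice `τ`. -/
def regularize (τ : α) : WordSpace α →ₗ[ℚ] WordSpace α :=
  of.symm.toLinearMap ∘ₗ dixmier (isLocallyNilpotent_headDeriv τ) (of (word [τ])) ∘ₗ
    of.toLinearMap

lemma of_regularize (τ : α) (x : WordSpace α) :
    of (regularize τ x) =
      dixmier (isLocallyNilpotent_headDeriv τ) (of (word [τ])) (of x) := rfl

lemma regularize_of_dropHead_eq_zero {τ : α} {x : WordSpace α} (h : dropHead τ x = 0) :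
    regularize τ x = x :=
  dixmier_of_derivation_eq_zero (isLocallyNilpotent_headDeriv τ) h

lemma dropHead_regularize (τ : α) (x : WordSpace α) : dropHead τ (regularize τ x) = 0 :=
  derivation_dixmier (isLocallyNilpotent_headDeriv τ) (headDeriv_letter τ) (of x)

lemma dropLast_regularize {τ a : α} (h : τ ≠ a) (x : WordSpace α) :
    dropLast a (regularize τ x) = regularize τ (dropLast a x) :=
  derivation_dixmier_comm (isLocallyNilpotent_headDeriv τ)
    (headDeriv_lastDeriv τ a) (lastDeriv_letter_of_ne h) (of x)

lemma regularize_mem_notEndingIn {τ a : α} (h : τ ≠ a) {x : WordSpace α}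
    (hx : x ∈ Finsupp.supported ℚ ℚ (notEndingIn a)) :
    regularize τ x ∈ Finsupp.supported ℚ ℚ (notEndingIn a) := by
  rw [mem_supported_notEndingIn] at *
  rw [dropLast_regularize h, hx, map_zero]

lemma regularize_mem_notBeginningWith (τ : α) (x : WordSpace α) :
    regularize τ x ∈ Finsupp.supported ℚ ℚ (notBeginningWith τ) :=
  mem_supported_notBeginningWith.2 (dropHead_regularize τ x)

lemma dropHead_eq_zero_of_mem_notBeginningWith {τ : α} {w : List α}
    (hw : w ∈ notBeginningWith τ) : dropHead τ (word w) = 0 :=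
  mem_supported_notBeginningWith.1 (Finsupp.single_mem_supported _ _ hw)

lemma regularize_replicate_succ (τ : α) (n : ℕ) :
    regularize τ (word (List.replicate (n + 1) τ)) = 0 := by
  have hdvd : of (word [τ]) ∣ of (word (List.replicate (n + 1) τ)) - 0 := by
    rw [of_replicate, sub_zero]
    exact dvd_divPow_succ _ n
  exact dixmier_eq_of_dvd_sub (isLocallyNilpotent_headDeriv τ) (headDeriv_letter τ) (map_zero _)
    hdvd

lemma isWordReg_regularize (τ : α) : IsWordReg ∅ {τ} (regularize τ) where
  map_shuffle u v := by
    rw [shuffle_eq_shuffleLin]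
    exact (congrArg _ (of_shuffleWords u v)).trans
      (dixmier_mul (isLocallyNilpotent_headDeriv τ) (headDeriv_letter τ) _ _)
  map_regular w hw _ := regularize_of_dropHead_eq_zero <|
    dropHead_eq_zero_of_mem_notBeginningWith fun h => hw τ h rfl
  map_singular w hne hw := by
    rcases hw with hw | hw
    · obtain ⟨σ, hσ⟩ := List.exists_mem_of_ne_nil w hne
      exact (hw σ hσ).elim
    · obtain ⟨n, hn⟩ := Nat.exists_eq_succ_of_ne_zero (List.length_pos_iff.2 hne).ne'
      rw [List.eq_replicate_of_mem hw, hn, regularize_replicate_succ]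

lemma IsWordReg.apply_of_dropHead_eq_zero {τ : α} {reg : WordSpace α →ₗ[ℚ] WordSpace α}
    (h : IsWordReg ∅ {τ} reg) {x : WordSpace α} (hx : dropHead τ x = 0) : reg x = x :=
  eqOn_supported_of_word (g := LinearMap.id) (P := notBeginningWith τ)
    (fun w hw => h.map_regular w (fun σ hσ hστ => hw (hστ ▸ hσ)) (by simp))
    (mem_supported_notBeginningWith.2 hx)

lemma IsWordReg.map_nil {τ : α} {reg : WordSpace α →ₗ[ℚ] WordSpace α} (h : IsWordReg ∅ {τ} reg) :
    reg (word []) = word [] :=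
  h.apply_of_dropHead_eq_zero (dropHead_nil τ)

/-- The algebra endomorphism of the shuffle algebra given by a regularization. -/
def IsWordReg.toAlgHom {τ : α} {reg : WordSpace α →ₗ[ℚ] WordSpace α} (h : IsWordReg ∅ {τ} reg) :
    ShuffleAlgebra α →ₐ[ℚ] ShuffleAlgebra α :=
  lift (of.toLinearMap ∘ₗ reg) (congrArg of h.map_nil) fun u v =>
    (congrArg of (h.map_shuffle u v)).trans (of_shuffle _ _)

lemma IsWordReg.unique {τ : α} {reg reg' : WordSpace α →ₗ[ℚ] WordSpace α}
    (h : IsWordReg ∅ {τ} reg) (h' : IsWordReg ∅ {τ} reg') : reg = reg' := by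
  have hletter : reg (word [τ]) = reg' (word [τ]) :=
    (h.map_singular [τ] (by simp) (by simp)).trans (h'.map_singular [τ] (by simp) (by simp)).symm
  have key : h.toAlgHom = h'.toAlgHom :=
    algHom_ext_of_slice (isLocallyNilpotent_headDeriv τ) (headDeriv_letter τ)
      (fun x hx => (h.apply_of_dropHead_eq_zero hx).trans (h'.apply_of_dropHead_eq_zero hx).symm)
      hletter
  exact LinearMap.ext fun x => DFunLike.congr_fun key (of x)

lemma word_eq_sum_shuffleLin_regularize (τ : α) (w : List α) :
    word w = ∑ k ∈ Finset.range (w.length + 1), shuffleLin (word (List.replicate k τ))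
      (regularize τ ((dropHead τ)^[k] (word w))) := by
  have hN : (headDeriv τ)^[w.length + 1] (of (word w)) = 0 := by
    rw [headDeriv_iterate_of, dropHead_iterate_word_of_length_lt τ (Nat.lt_succ_self _), map_zero]
  have htaylor := eq_sum_divPow_mul_dixmier (isLocallyNilpotent_headDeriv τ)
    (headDeriv_letter τ) hN
  simp only [← of_replicate, headDeriv_iterate_of, ← of_regularize, ← of_shuffleLin] at htaylor
  exact of.injective (htaylor.trans (map_sum of _ _).symm)

variable {S : Finset ℂ} {τ : S} {δ : ℝ → ℂ} {c : ℂ} {I J : WordSpace S →ₗ[ℚ] ℂ}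

lemma IsExtendedIntegral.map_nil (h : IsExtendedIntegral τ δ c I) : I (word []) = 1 := by
  rw [h.eq_iterInt [] (by simp), List.map_nil, iterInt]

lemma IsExtendedIntegral.unique (hI : IsExtendedIntegral τ δ c I)
    (hJ : IsExtendedIntegral τ δ c J) : I = J := by
  have key : lift I hI.map_nil hI.map_shuffle = lift J hJ.map_nil hJ.map_shuffle := by
    refine algHom_ext_of_slice (isLocallyNilpotent_lastDeriv τ) (lastDeriv_letter_self τ)
      (fun x hx => ?_) (hI.map_letter.trans hJ.map_letter.symm)
    exact eqOn_supported_of_word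
      (fun w hw => (hI.eq_iterInt w hw).trans (hJ.eq_iterInt w hw).symm)
      (mem_supported_notEndingIn.2 hx)
  exact LinearMap.ext fun x => DFunLike.congr_fun key (of x)

end Regularization

/-! ### Analytic continuation along paths -/

section Continuation

/-- The function elements `F t`, `t ∈ X`, form an analytic continuation along the restriction of
the path `γ` to `X`. -/
structure IsContinuationOn (γ : ℝ → ℂ) (F : ℝ → ℂ → ℂ) (X : Set ℝ) : Prop where
  analytic : ∀ t ∈ X, AnalyticAt ℂ (F t) (γ t)
  compatible : ∀ t ∈ X, ∀ᶠ s in 𝓝[X] t, F s =ᶠ[𝓝 (γ s)] F t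

lemma exists_ball_analyticOnNhd {f : ℂ → ℂ} {c : ℂ} (h : AnalyticAt ℂ f c) :
    ∃ r > 0, AnalyticOnNhd ℂ f (Metric.ball c r) := by
  obtain ⟨r, hr, h'⟩ := Metric.eventually_nhds_iff_ball.1 h.eventually_analyticAt
  exact ⟨r, hr, fun p hp => h' p hp⟩

lemma eventuallyEq_of_analyticOnNhd {f g : ℂ → ℂ} {U : Set ℂ} (hU : IsOpen U)
    (hc : IsPreconnected U) (hf : AnalyticOnNhd ℂ f U) (hg : AnalyticOnNhd ℂ g U) {p q : ℂ}
    (hp : p ∈ U) (hq : q ∈ U) (h : f =ᶠ[𝓝 p] g) : f =ᶠ[𝓝 q] g :=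
  (hf.eqOn_of_preconnected_of_eventuallyEq hg hc hp h).eventuallyEq_of_mem (hU.mem_nhds hq)

variable {γ : ℝ → ℂ} {F G : ℝ → ℂ → ℂ} {X : Set ℝ}

lemma tendsto_eventuallyEq {f g : ℂ → ℂ} {t : ℝ} (hγ : ContinuousWithinAt γ X t)
    (h : f =ᶠ[𝓝 (γ t)] g) : ∀ᶠ s in 𝓝[X] t, f =ᶠ[𝓝 (γ s)] g :=
  hγ.eventually h.eventuallyEq_nhds

lemma IsContinuationOn.mono {Y : Set ℝ} (h : IsContinuationOn γ F Y) (hXY : X ⊆ Y) :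
    IsContinuationOn γ F X :=
  ⟨fun t ht => h.analytic t (hXY ht),
    fun t ht => (h.compatible t (hXY ht)).filter_mono (nhdsWithin_mono _ hXY)⟩

lemma IsContinuationOn.const {f : ℂ → ℂ} (h : ∀ t ∈ X, AnalyticAt ℂ f (γ t)) :
    IsContinuationOn γ (fun _ => f) X :=
  ⟨h, fun _ _ => Eventually.of_forall fun _ => EventuallyEq.rfl⟩

lemma IsContinuationOn.congr_path {γ' : ℝ → ℂ} (h : IsContinuationOn γ F X)
    (h' : ∀ t ∈ X, γ' t = γ t) :
    IsContinuationOn γ' F X := by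
  refine ⟨fun t ht => by rw [h' t ht]; exact h.analytic t ht, fun t ht => ?_⟩
  filter_upwards [h.compatible t ht, self_mem_nhdsWithin] with s hs hsX
  rwa [h' s hsX]

lemma IsContinuationOn.unique (hX : IsPreconnected X) (hγ : ContinuousOn γ X)
    (hF : IsContinuationOn γ F X)
    (hG : IsContinuationOn γ G X) {t₀ : ℝ} (ht₀ : t₀ ∈ X) (h : F t₀ =ᶠ[𝓝 (γ t₀)] G t₀) {t : ℝ}
    (ht : t ∈ X) : F t =ᶠ[𝓝 (γ t)] G t := by
  refine hX.induction₂' (fun s t => F s =ᶠ[𝓝 (γ s)] G s → F t =ᶠ[𝓝 (γ t)] G t) (fun t ht => ?_)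
    (fun _ _ _ _ _ _ h1 h2 h => h2 (h1 h)) ht₀ ht h
  obtain ⟨r₁, hr₁, h₁⟩ := exists_ball_analyticOnNhd (hF.analytic t ht)
  obtain ⟨r₂, hr₂, h₂⟩ := exists_ball_analyticOnNhd (hG.analytic t ht)
  set r := min r₁ r₂
  have hr : 0 < r := lt_min hr₁ hr₂
  have h₁' : AnalyticOnNhd ℂ (F t) (Metric.ball (γ t) r) :=
    h₁.mono (Metric.ball_subset_ball (min_le_left _ _))
  have h₂' : AnalyticOnNhd ℂ (G t) (Metric.ball (γ t) r) :=
    h₂.mono (Metric.ball_subset_ball (min_le_right _ _))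
  have hmem : ∀ᶠ s in 𝓝[X] t, γ s ∈ Metric.ball (γ t) r :=
    (hγ t ht) (Metric.ball_mem_nhds _ hr)
  have hpc : IsPreconnected (Metric.ball (γ t) r) := (convex_ball _ _).isPreconnected
  filter_upwards [hF.compatible t ht, hG.compatible t ht, hmem] with s hFs hGs hs
  constructor
  · intro h
    have := eventuallyEq_of_analyticOnNhd Metric.isOpen_ball hpc h₁' h₂'
      (Metric.mem_ball_self hr) hs h
    exact (hFs.trans this).trans hGs.symm
  · intro h
    exact eventuallyEq_of_analyticOnNhd Metric.isOpen_ball hpc h₁' h₂' hs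
      (Metric.mem_ball_self hr) ((hFs.symm.trans h).trans hGs)

lemma IsContinuationOn.glue {a b c : ℝ} (hab : a ≤ b) (hbc : b ≤ c) (hγ : ContinuousOn γ (Icc a c))
    (hF : IsContinuationOn γ F (Icc a b)) (hG : IsContinuationOn γ G (Icc b c))
    (h : F b =ᶠ[𝓝 (γ b)] G b) :
    IsContinuationOn γ (fun t => if t ≤ b then F t else G t) (Icc a c) := by
  constructor
  · intro t ht
    by_cases htb : t ≤ b
    · simpa only [htb, if_true] using hF.analytic t ⟨ht.1, htb⟩
    · simpa only [htb, if_false] using hG.analytic t ⟨(not_le.1 htb).le, ht.2⟩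
  · intro t ht
    rcases lt_trichotomy t b with htb | rfl | htb
    · have h1 : ∀ᶠ s in 𝓝[Icc a c] t, s < b :=
        (eventually_lt_nhds htb).filter_mono nhdsWithin_le_nhds
      have h2 := hF.compatible t ⟨ht.1, htb.le⟩
      rw [eventually_nhdsWithin_iff] at h2 h1 ⊢
      filter_upwards [h1, h2] with s hs1 hs2 hs
      simpa only [(hs1 hs).le, htb.le, if_true] using hs2 ⟨hs.1, (hs1 hs).le⟩
    · have h1 := hF.compatible t ⟨hab, le_rfl⟩
      have h2 := hG.compatible t ⟨le_rfl, hbc⟩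
      have h3 := tendsto_eventuallyEq (hγ t ht) h
      rw [eventually_nhdsWithin_iff] at h1 h2 h3 ⊢
      filter_upwards [h1, h2, h3] with s hs1 hs2 hs3 hs
      by_cases hst : s ≤ t
      · simpa only [hst, le_rfl, if_true] using hs1 ⟨hs.1, hst⟩
      · simpa only [hst, le_rfl, if_true, if_false] using
          (hs2 ⟨(not_le.1 hst).le, hs.2⟩).trans (hs3 hs).symm
    · have h1 : ∀ᶠ s in 𝓝[Icc a c] t, b < s :=
        (eventually_gt_nhds htb).filter_mono nhdsWithin_le_nhds
      have h2 := hG.compatible t ⟨htb.le, ht.2⟩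
      rw [eventually_nhdsWithin_iff] at h2 h1 ⊢
      filter_upwards [h1, h2] with s hs1 hs2 hs
      simpa only [not_le.2 (hs1 hs), not_le.2 htb, if_false] using hs2 ⟨(hs1 hs).le, hs.2⟩

lemma IsContinuationOn.comp {φ : ℝ → ℝ} {Y : Set ℝ} (h : IsContinuationOn γ F Y)
    (hφ : ContinuousOn φ X)
    (hm : MapsTo φ X Y) : IsContinuationOn (γ ∘ φ) (F ∘ φ) X :=
  ⟨fun _ ht => h.analytic _ (hm ht), fun _ ht =>
    (hφ.continuousWithinAt ht).tendsto_nhdsWithin hm |>.eventually (h.compatible _ (hm ht))⟩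

lemma IsContinuationOn.mul (hF : IsContinuationOn γ F X) (hG : IsContinuationOn γ G X) :
    IsContinuationOn γ (fun t p => F t p * G t p) X :=
  ⟨fun t ht => (hF.analytic t ht).mul (hG.analytic t ht), fun t ht => by
    filter_upwards [hF.compatible t ht, hG.compatible t ht] with s h1 h2 using h1.mul h2⟩

lemma IsContinuationOn.sum {ι : Type*} (s : Finset ι) {F : ι → ℝ → ℂ → ℂ}
    (h : ∀ i ∈ s, IsContinuationOn γ (F i) X) :
    IsContinuationOn γ (fun t p => ∑ i ∈ s, F i t p) X :=
  ⟨fun t ht => Finset.analyticAt_fun_sum _ fun i hi => (h i hi).analytic t ht, fun t ht => by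
    have : ∀ᶠ r in 𝓝[X] t, ∀ i ∈ s, F i r =ᶠ[𝓝 (γ r)] F i t :=
      (Finset.eventually_all s).2 fun i hi => (h i hi).compatible t ht
    filter_upwards [this] with r hr
    have := (Finset.eventually_all s).2 hr
    filter_upwards [this] with p hp using Finset.sum_congr rfl hp⟩

lemma IsContinuationOn.const_mul (c : ℂ) (hF : IsContinuationOn γ F X) :
    IsContinuationOn γ (fun t p => c * F t p) X :=
  (IsContinuationOn.const fun _ _ => analyticAt_const (v := c)).mul hF

lemma IsContinuationOn.map_deriv (hF : IsContinuationOn γ F X) :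
    IsContinuationOn γ (fun t => deriv (F t)) X :=
  ⟨fun t ht => (hF.analytic t ht).deriv, fun t ht => by
    filter_upwards [hF.compatible t ht] with s h1 using h1.deriv⟩

lemma IsContinuationOn.continuousOn_apply (hγ : ContinuousOn γ X) (hF : IsContinuationOn γ F X) :
    ContinuousOn (fun t => F t (γ t)) X := by
  intro t ht
  have h1 : ContinuousWithinAt (fun s => F t (γ s)) X t :=
    (hF.analytic t ht).continuousAt.comp_continuousWithinAt (hγ t ht)
  refine h1.congr_of_eventuallyEq ?_ rfl
  filter_upwards [hF.compatible t ht] with s hs using hs.eq_of_nhds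

lemma exists_eventuallyEq_add_const {f g : ℂ → ℂ} {c : ℂ} (hf : AnalyticAt ℂ f c)
    (hg : AnalyticAt ℂ g c) (h : deriv f =ᶠ[𝓝 c] deriv g) :
    ∃ k : ℂ, f =ᶠ[𝓝 c] fun p => g p + k := by
  obtain ⟨r, hr, h'⟩ := Metric.eventually_nhds_iff_ball.1
    ((hf.eventually_analyticAt.and hg.eventually_analyticAt).and h)
  obtain ⟨k, hk⟩ := Metric.isOpen_ball.exists_eq_add_of_deriv_eq (𝕜 := ℂ)
    (convex_ball c r).isPreconnected
    (fun p hp => ((h' p hp).1.1).differentiableAt.differentiableWithinAt)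
    (fun p hp => ((h' p hp).1.2).differentiableAt.differentiableWithinAt)
    (fun p hp => (h' p hp).2)
  exact ⟨k, hk.eventuallyEq_of_mem (Metric.ball_mem_nhds _ hr)⟩

lemma exists_analyticOnNhd_ball_primitive {f : ℂ → ℂ} {c : ℂ} (hf : AnalyticAt ℂ f c) :
    ∃ r > 0, ∃ P : ℂ → ℂ, AnalyticOnNhd ℂ P (Metric.ball c r) ∧
      ∀ p ∈ Metric.ball c r, deriv P =ᶠ[𝓝 p] f := by
  obtain ⟨r, hr, hr'⟩ := exists_ball_analyticOnNhd hf
  obtain ⟨P, hP⟩ := hr'.differentiableOn.isExactOn_ball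
  refine ⟨r, hr, P, DifferentiableOn.analyticOnNhd
    (fun p hp => (hP p hp).differentiableAt.differentiableWithinAt) Metric.isOpen_ball,
    fun p hp => ?_⟩
  exact eventuallyEq_of_mem (Metric.isOpen_ball.mem_nhds hp) fun q hq => (hP q hq).deriv

lemma exists_forall_Ioo_of_eventually_nhdsWithin_Icc {a b T : ℝ} {p : ℝ → Prop}
    (h : ∀ᶠ s in 𝓝[Icc a b] T, p s) : ∃ η > 0, ∀ s ∈ Ioo (T - η) (T + η), s ∈ Icc a b → p s := by
  obtain ⟨η, hη, h'⟩ := Metric.mem_nhdsWithin_iff.1 h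
  exact ⟨η, hη, fun s hs hs' => h' ⟨by rwa [Real.ball_eq_Ioo], hs'⟩⟩

lemma Icc_right_of_locally_extendable {a b : ℝ} (hab : a ≤ b) (C : ℝ → Prop) (ha : C a)
    (hmono : ∀ s t, a ≤ s → s ≤ t → t ≤ b → C t → C s)
    (hext : ∀ T ∈ Icc a b, ∃ η > 0, ∀ s t, s ∈ Ioo (T - η) (T + η) → t ∈ Ioo (T - η) (T + η) →
      a ≤ s → s ≤ t → t ≤ b → C s → C t) : C b := by
  refine (isPreconnected_Icc (a := a) (b := b)).induction₂' (fun s t => C s → C t)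
    (fun T hT => ?_) (fun _ _ _ _ _ _ h1 h2 h => h2 (h1 h)) ⟨le_rfl, hab⟩ ⟨hab, le_rfl⟩ ha
  obtain ⟨η, hη, h⟩ := hext T hT
  have hn : ∀ᶠ s in 𝓝[Icc a b] T, s ∈ Ioo (T - η) (T + η) :=
    mem_nhdsWithin_of_mem_nhds (Ioo_mem_nhds (by linarith) (by linarith))
  have hTm : T ∈ Ioo (T - η) (T + η) := ⟨by linarith, by linarith⟩
  filter_upwards [hn, self_mem_nhdsWithin] with s hs hs'
  rcases le_total s T with hsT | hsT
  · exact ⟨hmono s T hs'.1 hsT hT.2, h s T hs hTm hs'.1 hsT hT.2⟩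
  · exact ⟨h T s hTm hs hT.1 hsT hs'.2, hmono T s hT.1 hsT hs'.2⟩

lemma IsContinuationOn.glue_const {a b c : ℝ} (hab : a ≤ b) (hbc : b ≤ c)
    (hγ : ContinuousOn γ (Icc a c)) (hF : IsContinuationOn γ F (Icc a b)) {P : ℂ → ℂ}
    (hP : ∀ t ∈ Icc b c, AnalyticAt ℂ P (γ t)) (h : F b =ᶠ[𝓝 (γ b)] P) :
    IsContinuationOn γ (fun t => if t ≤ b then F t else P) (Icc a c) :=
  hF.glue hab hbc hγ (IsContinuationOn.const hP) h

lemma IsContinuationOn.extend_primitive {a s t : ℝ} (has : a ≤ s) (hst : s ≤ t)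
    (hγ : ContinuousOn γ (Icc a t)) (hF : IsContinuationOn γ F (Icc a s))
    (hFG : ∀ q ∈ Icc a s, deriv (F q) =ᶠ[𝓝 (γ q)] G q) {P : ℂ → ℂ}
    (hP : ∀ q ∈ Icc s t, AnalyticAt ℂ P (γ q))
    (hPG : ∀ q ∈ Icc s t, deriv P =ᶠ[𝓝 (γ q)] G q) :
    ∃ F' : ℝ → ℂ → ℂ, F' a = F a ∧ IsContinuationOn γ F' (Icc a t) ∧
      ∀ q ∈ Icc a t, deriv (F' q) =ᶠ[𝓝 (γ q)] G q := by
  have hs : s ∈ Icc s t := ⟨le_rfl, hst⟩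
  obtain ⟨k, hk⟩ := exists_eventuallyEq_add_const (hF.analytic s ⟨has, le_rfl⟩) (hP s hs)
    ((hFG s ⟨has, le_rfl⟩).trans (hPG s hs).symm)
  refine ⟨fun q => if q ≤ s then F q else fun p => P p + k, by simp [has],
    hF.glue_const has hst hγ (fun q hq => (hP q hq).add analyticAt_const) hk, fun q hq => ?_⟩
  by_cases hqs : q ≤ s
  · simpa only [hqs, if_true] using hFG q ⟨hq.1, hqs⟩
  · have hderiv : deriv (fun p => P p + k) = deriv P := funext fun p => deriv_add_const k
    simpa only [hqs, if_false, hderiv] using hPG q ⟨(not_le.1 hqs).le, hq.2⟩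

lemma IsContinuationOn.exists_primitive {a b : ℝ} (hab : a ≤ b) (hγ : ContinuousOn γ (Icc a b))
    (hG : IsContinuationOn γ G (Icc a b)) {f : ℂ → ℂ} (hf : AnalyticAt ℂ f (γ a))
    (hfG : deriv f =ᶠ[𝓝 (γ a)] G a) :
    ∃ F : ℝ → ℂ → ℂ, F a = f ∧ IsContinuationOn γ F (Icc a b) ∧
      ∀ t ∈ Icc a b, deriv (F t) =ᶠ[𝓝 (γ t)] G t := by
  refine Icc_right_of_locally_extendable hab (fun T => ∃ F : ℝ → ℂ → ℂ, F a = f ∧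
    IsContinuationOn γ F (Icc a T) ∧ ∀ t ∈ Icc a T, deriv (F t) =ᶠ[𝓝 (γ t)] G t) ?_ ?_ ?_
  · refine ⟨fun _ => f, rfl, IsContinuationOn.const fun t ht => ?_, fun t ht => ?_⟩ <;>
      rw [Icc_self, mem_singleton_iff] at ht <;> subst ht
    exacts [hf, hfG]
  · rintro s t _ hst _ ⟨F, hFa, hF, hFG⟩
    exact ⟨F, hFa, hF.mono (Icc_subset_Icc_right hst),
      fun r hr => hFG r ⟨hr.1, hr.2.trans hst⟩⟩
  · intro T hT
    obtain ⟨r, hr, P, hP, hPd⟩ := exists_analyticOnNhd_ball_primitive (hG.analytic T hT)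
    obtain ⟨η, hη, hN⟩ := exists_forall_Ioo_of_eventually_nhdsWithin_Icc
      ((hG.compatible T hT).and ((hγ T hT).eventually (Metric.ball_mem_nhds _ hr)))
    refine ⟨η, hη, ?_⟩
    rintro s t hs ht has hst htb ⟨F, hFa, hF, hFG⟩
    have hN' : ∀ q ∈ Icc s t, G q =ᶠ[𝓝 (γ q)] G T ∧ γ q ∈ Metric.ball (γ T) r := fun q hq =>
      hN q ⟨hs.1.trans_le hq.1, hq.2.trans_lt ht.2⟩ ⟨has.trans hq.1, hq.2.trans htb⟩
    obtain ⟨F', hF'a, hF'⟩ := hF.extend_primitive has hst (hγ.mono (Icc_subset_Icc_right htb)) hFG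
      (fun q hq => hP _ (hN' q hq).2) fun q hq => (hPd _ (hN' q hq).2).trans (hN' q hq).1.symm
    exact ⟨F', hF'a.trans hFa, hF'⟩

/-- The function elements `F t` form an analytic continuation on `[a, b]` along every path at
uniform distance less than `r` from `γ`. -/
def IsStableContinuation (γ : ℝ → ℂ) (F : ℝ → ℂ → ℂ) (r a b : ℝ) : Prop :=
  ∀ β : ℝ → ℂ, ContinuousOn β (Icc a b) → (∀ t ∈ Icc a b, dist (β t) (γ t) < r) →
    IsContinuationOn β F (Icc a b)

-- A path on `[a, s]` close to `γ` is extended to `[a, t]` by a translate of `γ`.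
lemma IsStableContinuation.restrict {r a s t : ℝ} (has : a ≤ s) (hst : s ≤ t)
    (hγ : ContinuousOn γ (Icc a t)) (h : IsStableContinuation γ F r a t) :
    IsStableContinuation γ F r a s := by
  intro β hβ hβγ
  have hmin : ContinuousOn (fun q : ℝ => min q s) (Icc a t) := by fun_prop
  have hmaps : MapsTo (fun q : ℝ => min q s) (Icc a t) (Icc a s) := fun q hq =>
    ⟨le_min hq.1 has, min_le_right _ _⟩
  have hext : ContinuousOn (fun q => β (min q s) + (γ q - γ (min q s))) (Icc a t) :=
    (hβ.comp hmin hmaps).add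
      (hγ.sub (hγ.comp hmin (hmaps.mono_right (Icc_subset_Icc_right hst))))
  have hdist : ∀ q ∈ Icc a t, dist (β (min q s) + (γ q - γ (min q s))) (γ q) < r := fun q hq => by
    have := hβγ (min q s) (hmaps hq)
    rw [dist_eq_norm] at this ⊢
    convert this using 2
    ring
  refine ((h _ hext hdist).mono (Icc_subset_Icc_right hst)).congr_path fun q hq => ?_
  simp [min_eq_left hq.2]

lemma IsStableContinuation.extend {r ρ a s t : ℝ} (hr : 0 < r) (has : a ≤ s)
    (hst : s ≤ t) (hF : IsStableContinuation γ F r a s) {P : ℂ → ℂ}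
    (hρ : 0 < ρ) (hP : ∀ q ∈ Icc s t, ∀ p, dist p (γ q) < ρ → AnalyticAt ℂ P p)
    (h : F s =ᶠ[𝓝 (γ s)] P) :
    ∃ r' > 0, IsStableContinuation γ (fun q => if q ≤ s then F q else P) r' a t := by
  obtain ⟨ε, hε, hball⟩ := Metric.eventually_nhds_iff_ball.1 h
  refine ⟨min r (min ε ρ), by positivity, fun β hβ hβγ => ?_⟩
  refine IsContinuationOn.glue_const has hst hβ
    (hF β (hβ.mono (Icc_subset_Icc_right hst)) fun q hq =>
    (hβγ q ⟨hq.1, hq.2.trans hst⟩).trans_le (min_le_left _ _)) (fun q hq => hP q hq _ ?_) ?_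
  · exact (hβγ q ⟨has.trans hq.1, hq.2⟩).trans_le ((min_le_right _ _).trans (min_le_right _ _))
  · refine eventuallyEq_of_mem (Metric.isOpen_ball.mem_nhds ?_) hball
    exact (hβγ s ⟨has, hst⟩).trans_le ((min_le_right _ _).trans (min_le_left _ _))

lemma IsContinuationOn.exists_stable {a b : ℝ} (hab : a ≤ b) (hγ : ContinuousOn γ (Icc a b))
    (hF : IsContinuationOn γ F (Icc a b)) :
    ∃ r > 0, ∃ F' : ℝ → ℂ → ℂ, F' a = F a ∧ IsStableContinuation γ F' r a b := by
  refine Icc_right_of_locally_extendable hab (fun T => ∃ r > 0, ∃ F' : ℝ → ℂ → ℂ, F' a = F a ∧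
    IsStableContinuation γ F' r a T) ?_ ?_ ?_
  · obtain ⟨r, hr, hr'⟩ := exists_ball_analyticOnNhd (hF.analytic a ⟨le_rfl, hab⟩)
    refine ⟨r, hr, fun _ => F a, rfl, fun β _ hβ => IsContinuationOn.const fun t ht => ?_⟩
    have h := hβ t ht
    rw [Icc_self, mem_singleton_iff] at ht
    subst ht
    exact hr' _ h
  · rintro s t has hst htb ⟨r, hr, F', hF'a, hF'⟩
    exact ⟨r, hr, F', hF'a, hF'.restrict has hst (hγ.mono (Icc_subset_Icc_right htb))⟩
  · intro T hT
    obtain ⟨ρ, hρ, hball⟩ := exists_ball_analyticOnNhd (hF.analytic T hT)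
    obtain ⟨η, hη, hN⟩ := exists_forall_Ioo_of_eventually_nhdsWithin_Icc
      ((hF.compatible T hT).and ((hγ T hT).eventually (Metric.ball_mem_nhds _ (half_pos hρ))))
    refine ⟨η, hη, ?_⟩
    rintro s t hs ht has hst htb ⟨r, hr, F', hF'a, hF'⟩
    have hγs : ContinuousOn γ (Icc a s) := hγ.mono (Icc_subset_Icc_right (hst.trans htb))
    have hF's : F' s =ᶠ[𝓝 (γ s)] F s :=
      IsContinuationOn.unique isPreconnected_Icc hγs (hF' γ hγs fun q _ => by simpa using hr)
        (hF.mono (Icc_subset_Icc_right (hst.trans htb))) (t₀ := a) ⟨le_rfl, has⟩ (by rw [hF'a])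
        ⟨has, le_rfl⟩
    have hnear : ∀ q ∈ Icc s t, ∀ p, dist p (γ q) < ρ / 2 → AnalyticAt ℂ (F T) p :=
      fun q hq p hp => hball p <| by
        have hqT := (hN q ⟨hs.1.trans_le hq.1, hq.2.trans_lt ht.2⟩
          ⟨has.trans hq.1, hq.2.trans htb⟩).2
        exact (dist_triangle p (γ q) (γ T)).trans_lt (by linarith)
    obtain ⟨r', hr', hext⟩ := hF'.extend hr has hst (half_pos hρ) hnear
      (hF's.trans (hN s hs ⟨has, hst.trans htb⟩).1)
    exact ⟨r', hr', _, by simp [has, hF'a], hext⟩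

lemma monodromy {H : ℝ × ℝ → ℂ} (hH : ContinuousOn H (Icc 0 1 ×ˢ Icc 0 1)) {a z : ℂ}
    (ha : ∀ s ∈ Icc (0 : ℝ) 1, H (s, 0) = a) (hz : ∀ s ∈ Icc (0 : ℝ) 1, H (s, 1) = z) {f : ℂ → ℂ}
    {Φ : ℝ → ℝ → ℂ → ℂ}
    (hΦ : ∀ s ∈ Icc (0 : ℝ) 1, IsContinuationOn (fun t => H (s, t)) (Φ s) (Icc 0 1))
    (hΦ0 : ∀ s ∈ Icc (0 : ℝ) 1, Φ s 0 =ᶠ[𝓝 a] f) : Φ 0 1 =ᶠ[𝓝 z] Φ 1 1 := by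
  have h0 : (0 : ℝ) ∈ Icc (0 : ℝ) 1 := ⟨le_rfl, zero_le_one⟩
  have h1 : (1 : ℝ) ∈ Icc (0 : ℝ) 1 := ⟨zero_le_one, le_rfl⟩
  refine (isPreconnected_Icc (a := (0 : ℝ)) (b := 1)).induction₂
    (fun s t => Φ s 1 =ᶠ[𝓝 z] Φ t 1) (fun s hs => ?_) (fun _ _ _ _ _ _ h1 h2 => h1.trans h2)
    (fun _ _ _ _ h => h.symm) h0 h1
  have hcont : ∀ s ∈ Icc (0 : ℝ) 1, ContinuousOn (fun t => H (s, t)) (Icc 0 1) := fun s hs =>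
    hH.comp (by fun_prop) fun t ht => ⟨hs, ht⟩
  obtain ⟨r, hr, F', hF'0, hF'⟩ := (hΦ s hs).exists_stable zero_le_one (hcont s hs)
  have huc := (isCompact_Icc.prod isCompact_Icc).uniformContinuousOn_of_continuous hH
  obtain ⟨η, hη, hη'⟩ := Metric.uniformContinuousOn_iff.1 huc r hr
  have hfin : ∀ s' ∈ Icc (0 : ℝ) 1, dist s' s < η → F' 1 =ᶠ[𝓝 z] Φ s' 1 := by
    intro s' hs' hd
    have h2 : IsContinuationOn (fun t => H (s', t)) F' (Icc 0 1) := hF' _ (hcont s' hs') fun t ht =>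
      hη' _ ⟨hs', ht⟩ _ ⟨hs, ht⟩ (by simpa [Prod.dist_eq, hη] using hd)
    have h3 := IsContinuationOn.unique isPreconnected_Icc (hcont s' hs') h2 (hΦ s' hs') h0
      (by simp only [ha s' hs', hF'0]; exact (hΦ0 s hs).trans (hΦ0 s' hs').symm) h1
    simpa only [hz s' hs'] using h3
  have hs0 := hfin s hs (by simpa using hη)
  filter_upwards [self_mem_nhdsWithin, mem_nhdsWithin_of_mem_nhds (Metric.ball_mem_nhds s hη)]
    with s' hs' hd
  exact hs0.symm.trans (hfin s' hs' hd)

lemma IsContinuationOn.div_sub {σ : ℂ} (hG : IsContinuationOn γ G X) (hσ : ∀ t ∈ X, γ t ≠ σ) :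
    IsContinuationOn γ (fun t p => G t p / (p - σ)) X :=
  ⟨fun t ht => (hG.analytic t ht).div (analyticAt_id.sub analyticAt_const)
    (sub_ne_zero.2 (hσ t ht)),
    fun t ht => by
      filter_upwards [hG.compatible t ht] with s hs
      filter_upwards [hs] with p hp
      rw [hp]⟩

lemma IsContinuationOn.update_left {a b : ℝ} (hγ : ContinuousOn γ (Icc a b))
    (hF : IsContinuationOn γ F (Ioc a b))
    {f : ℂ → ℂ} (hf : AnalyticAt ℂ f (γ a))
    (h : ∀ᶠ t in 𝓝[Ioc a b] a, F t =ᶠ[𝓝 (γ t)] f) :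
    IsContinuationOn γ (Function.update F a f) (Icc a b) := by
  have hne : ∀ t ∈ Icc a b, t ≠ a → t ∈ Ioc a b := fun t ht hta => ⟨ht.1.lt_of_ne' hta, ht.2⟩
  refine ⟨fun t ht => ?_, fun t ht => ?_⟩
  · rcases eq_or_ne t a with rfl | hta
    · rwa [Function.update_self]
    · rw [Function.update_of_ne hta]
      exact hF.analytic t (hne t ht hta)
  · rcases eq_or_ne t a with rfl | hta
    · rw [eventually_nhdsWithin_iff] at h ⊢
      filter_upwards [h] with s hs hsX
      rcases eq_or_ne s t with rfl | hst
      · rfl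
      · rw [Function.update_self, Function.update_of_ne hst]
        exact hs (hne s hsX hst)
    · have hcompat := hF.compatible t (hne t ht hta)
      rw [eventually_nhdsWithin_iff] at hcompat ⊢
      filter_upwards [hcompat, eventually_ne_nhds hta] with s hs hsa hsX
      rw [Function.update_of_ne hta, Function.update_of_ne hsa]
      exact hs (hne s hsX hsa)

lemma IsContinuationOn.exists_solution {a b : ℝ} (hab : a ≤ b) (hγ : ContinuousOn γ (Icc a b))
    {σ : ℂ}
    (hσ : ∀ t ∈ Ioc a b, γ t ≠ σ) (hG : IsContinuationOn γ G (Icc a b)) {f : ℂ → ℂ}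
    (hf : AnalyticAt ℂ f (γ a))
    (hfG : ∀ᶠ p in 𝓝 (γ a), p ≠ σ → deriv f p = G a p / (p - σ)) :
    ∃ F : ℝ → ℂ → ℂ, F a = f ∧ IsContinuationOn γ F (Icc a b) ∧
      ∀ t ∈ Ioc a b, ∀ᶠ p in 𝓝 (γ t), HasDerivAt (F t) (G t p / (p - σ)) p := by
  have hnear : ∀ᶠ t in 𝓝[Ioc a b] a, (fun p => G t p / (p - σ)) =ᶠ[𝓝 (γ t)] deriv f := by
    have hγa := (hγ a ⟨le_rfl, hab⟩).eventually hfG.eventually_nhds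
    filter_upwards [(hG.compatible a ⟨le_rfl, hab⟩).filter_mono
      (nhdsWithin_mono a Ioc_subset_Icc_self),
      hγa.filter_mono (nhdsWithin_mono a Ioc_subset_Icc_self),
      self_mem_nhdsWithin] with s hGs hfs hs
    filter_upwards [hGs, hfs, isOpen_ne.eventually_mem (hσ s hs)] with p hGp hfp hp
    rw [hGp, hfp hp]
  obtain ⟨F, hFa, hF, hFD⟩ := (((hG.mono Ioc_subset_Icc_self).div_sub hσ).update_left hγ hf.deriv
    hnear).exists_primitive hab hγ hf (by rw [Function.update_self])
  refine ⟨F, hFa, hF, fun t ht => ?_⟩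
  have hderiv := hFD t (Ioc_subset_Icc_self ht)
  rw [Function.update_of_ne ht.1.ne'] at hderiv
  filter_upwards [hderiv, (hF.analytic t (Ioc_subset_Icc_self ht)).eventually_analyticAt]
    with p hp hFp
  rw [← hp]
  exact hFp.differentiableAt.hasDerivAt

lemma IsContinuationOn.hasDerivAt_apply (hF : IsContinuationOn γ F X) {t : ℝ} (ht : X ∈ 𝓝 t)
    {γ' : ℂ}
    (hγ : HasDerivAt γ γ' t) :
    HasDerivAt (fun s => F s (γ s)) (γ' * deriv (F t) (γ t)) t := by
  have hcompat := hF.compatible t (mem_of_mem_nhds ht)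
  rw [nhdsWithin_eq_nhds.2 ht] at hcompat
  have hcomp := (hF.analytic t (mem_of_mem_nhds ht)).differentiableAt.hasDerivAt.comp_of_eq t hγ rfl
  rw [mul_comm]
  refine hcomp.congr_of_eventuallyEq ?_
  filter_upwards [hcompat] with s hs using hs.eq_of_nhds

lemma IsContinuationOn.integral_deriv_mul (hγ : ContDiffOn ℝ 1 γ (Icc 0 1))
    (hF : IsContinuationOn γ F (Icc 0 1))
    {t : ℝ} (ht : t ∈ Icc (0 : ℝ) 1) :
    ∫ s in (0 : ℝ)..t, deriv γ s * deriv (F s) (γ s) = F t (γ t) - F 0 (γ 0) := by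
  have hsub : Icc 0 t ⊆ Icc (0 : ℝ) 1 := Icc_subset_Icc_right ht.2
  have hder : ∀ s ∈ Ioo (0 : ℝ) 1, HasDerivAt γ (derivWithin γ (Icc 0 1) s) s := fun s hs =>
    ((hγ.differentiableOn one_ne_zero) s (Ioo_subset_Icc_self hs)).hasDerivWithinAt.hasDerivAt
      (Icc_mem_nhds hs.1 hs.2)
  have hcont : ContinuousOn (fun s => derivWithin γ (Icc 0 1) s * deriv (F s) (γ s)) (Icc 0 1) :=
    (hγ.continuousOn_derivWithin (uniqueDiffOn_Icc zero_lt_one) le_rfl).mul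
      (hF.map_deriv.continuousOn_apply hγ.continuousOn)
  rw [← intervalIntegral.integral_eq_sub_of_hasDerivAt_of_le ht.1
    ((hF.continuousOn_apply hγ.continuousOn).mono hsub)
    (fun s hs => hF.hasDerivAt_apply (Icc_mem_nhds hs.1 (hs.2.trans_le ht.2))
      (hder s ⟨hs.1, hs.2.trans_le ht.2⟩))
    (hcont.mono (by rwa [uIcc_of_le ht.1])).intervalIntegrable]
  refine intervalIntegral.integral_congr_ae ?_
  filter_upwards [MeasureTheory.Measure.ae_ne _ 1] with s hs1 hs
  rw [uIoc_of_le ht.1] at hs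
  rw [(hder s ⟨hs.1, (hs.2.trans ht.2).lt_of_ne hs1⟩).deriv]

lemma iterInt_cons_eq (hγ : ContDiffOn ℝ 1 γ (Icc 0 1)) {w : List ℂ} {σ : ℂ}
    (hF : IsContinuationOn γ F (Icc 0 1))
    (hFG : ∀ t ∈ Ioc (0 : ℝ) 1, ∀ᶠ p in 𝓝 (γ t), HasDerivAt (F t) (G t p / (p - σ)) p)
    (hF0 : F 0 (γ 0) = 0) (hG : ∀ t ∈ Icc (0 : ℝ) 1, iterInt γ w t = G t (γ t)) {t : ℝ}
    (ht : t ∈ Icc (0 : ℝ) 1) : iterInt γ (σ :: w) t = F t (γ t) := by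
  rw [iterInt, ← sub_zero (F t (γ t)), ← hF0, ← hF.integral_deriv_mul hγ ht]
  refine intervalIntegral.integral_congr_ae (Eventually.of_forall fun s hs => ?_)
  rw [uIoc_of_le ht.1] at hs
  rw [hG s ⟨hs.1.le, hs.2.trans ht.2⟩,
    (hFG s ⟨hs.1, hs.2.trans ht.2⟩).self_of_nhds.deriv]
  ring

end Continuation

/-! ### Polynomials in a logarithm -/

section LogPolynomials

variable {c : ℂ} {r : ℝ} {K : ℂ → ℂ} {Ω : Set ℂ} {m n : ℕ} {f g : ℂ → ℂ}

/-- Polynomials of degree at most `n` in the function `K`, which plays the role of a logarithm,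
with coefficients that are analytic on the disc of radius `r` about `c`. -/
def logPoly (c : ℂ) (r : ℝ) (K : ℂ → ℂ) (n : ℕ) : Submodule ℂ (ℂ → ℂ) :=
  .span ℂ {f | ∃ j ≤ n, ∃ b, AnalyticOnNhd ℂ b (Metric.ball c r) ∧ f = K ^ j * b}

/-- The elements of `logPoly c r K n` whose coefficients vanish at `c`. -/
def smallLogPoly (c : ℂ) (r : ℝ) (K : ℂ → ℂ) (n : ℕ) : Submodule ℂ (ℂ → ℂ) :=
  (logPoly c r K n).map (LinearMap.mulLeft ℂ fun p => p - c)

lemma pow_mul_mem_logPoly {j : ℕ} (hj : j ≤ n) {b : ℂ → ℂ}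
    (hb : AnalyticOnNhd ℂ b (Metric.ball c r)) : K ^ j * b ∈ logPoly c r K n :=
  Submodule.subset_span ⟨j, hj, b, hb, rfl⟩

lemma logPoly_mono (h : n ≤ m) : logPoly c r K n ≤ logPoly c r K m :=
  Submodule.span_mono fun _ ⟨j, hj, b, hb, hf⟩ => ⟨j, hj.trans h, b, hb, hf⟩

lemma smallLogPoly_mono (h : n ≤ m) : smallLogPoly c r K n ≤ smallLogPoly c r K m :=
  Submodule.map_mono (logPoly_mono h)

lemma mul_mem_smallLogPoly (hf : f ∈ logPoly c r K n) :
    (fun p => p - c) * f ∈ smallLogPoly c r K n :=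
  Submodule.mem_map_of_mem hf

lemma mul_mem_logPoly {b : ℂ → ℂ} (hb : AnalyticOnNhd ℂ b (Metric.ball c r))
    (hf : f ∈ logPoly c r K n) : b * f ∈ logPoly c r K n := by
  suffices h : logPoly c r K n ≤ (logPoly c r K n).comap (LinearMap.mulLeft ℂ b) from h hf
  refine Submodule.span_le.2 ?_
  rintro _ ⟨j, hj, e, he, rfl⟩
  rw [SetLike.mem_coe, Submodule.mem_comap, LinearMap.mulLeft_apply, mul_left_comm]
  exact pow_mul_mem_logPoly hj (hb.mul he)

lemma smallLogPoly_le_logPoly : smallLogPoly c r K n ≤ logPoly c r K n := by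
  rintro _ ⟨g, hg, rfl⟩
  exact mul_mem_logPoly (analyticOnNhd_id.sub analyticOnNhd_const) hg

lemma analyticOnNhd_of_mem_logPoly_zero (hf : f ∈ logPoly c r K 0) :
    AnalyticOnNhd ℂ f (Metric.ball c r) := by
  induction hf using Submodule.span_induction with
  | mem f hf =>
    obtain ⟨j, hj, b, hb, rfl⟩ := hf
    rwa [Nat.le_zero.1 hj, pow_zero, one_mul]
  | zero => exact analyticOnNhd_const
  | add f g _ _ hf hg => exact hf.add hg
  | smul a f _ hf => exact (analyticOnNhd_const (v := a)).smul hf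

lemma analyticOnNhd_dslope {b : ℂ → ℂ} {U : Set ℂ} (hU : IsOpen U) (hc : c ∈ U)
    (hb : AnalyticOnNhd ℂ b U) : AnalyticOnNhd ℂ (dslope b c) U :=
  ((Complex.differentiableOn_dslope (hU.mem_nhds hc)).2 hb.differentiableOn).analyticOnNhd hU

lemma exists_primitive_vanishing (hr : 0 < r) {b : ℂ → ℂ}
    (hb : AnalyticOnNhd ℂ b (Metric.ball c r)) :
    ∃ e, AnalyticOnNhd ℂ e (Metric.ball c r) ∧
      ∀ p ∈ Metric.ball c r, HasDerivAt (fun p => (p - c) * e p) (b p) p := by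
  obtain ⟨P, hP0, hP⟩ := (hb.differentiableOn.isExactOn_ball).with_val_at c 0
  have hPan : AnalyticOnNhd ℂ P (Metric.ball c r) :=
    DifferentiableOn.analyticOnNhd (fun p hp => (hP p hp).differentiableAt.differentiableWithinAt)
      Metric.isOpen_ball
  refine ⟨dslope P c, analyticOnNhd_dslope Metric.isOpen_ball (Metric.mem_ball_self hr) hPan, ?_⟩
  rwa [show (fun p => (p - c) * dslope P c p) = P from
    funext fun p => by simpa [hP0] using sub_smul_dslope P c p]

lemma hasDerivAt_pow_succ_div {p c : ℂ} (hK : HasDerivAt K (1 / (p - c)) p) (j : ℕ) :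
    HasDerivAt (fun q => K q ^ (j + 1) / ((j : ℂ) + 1)) (K p ^ j / (p - c)) p := by
  have hj : (j : ℂ) + 1 ≠ 0 := j.cast_add_one_ne_zero
  refine ((hK.fun_pow (j + 1)).div_const _).congr_deriv ?_
  push_cast
  field_simp

section Primitives

variable (hr : 0 < r) (hcΩ : c ∉ Ω) (hK : ∀ p ∈ Ω, HasDerivAt K (1 / (p - c)) p)

include hr hcΩ hK

-- Integration by parts lowers the degree in `K`.
lemma exists_primitive_pow_mul (j : ℕ) {b : ℂ → ℂ} (hb : AnalyticOnNhd ℂ b (Metric.ball c r)) :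
    ∃ F ∈ smallLogPoly c r K j, ∀ p ∈ Metric.ball c r ∩ Ω, HasDerivAt F (K p ^ j * b p) p := by
  induction j generalizing b with
  | zero =>
    obtain ⟨e, he, hbe⟩ := exists_primitive_vanishing hr hb
    refine ⟨_, mul_mem_smallLogPoly (pow_mul_mem_logPoly le_rfl he), fun p hp => ?_⟩
    rw [pow_zero, pow_zero, one_mul, one_mul]
    exact hbe p hp.1
  | succ j ih =>
    obtain ⟨e, he, hbe⟩ := exists_primitive_vanishing hr hb
    obtain ⟨G, hG, hG'⟩ := ih he
    refine ⟨_, add_mem (mul_mem_smallLogPoly (pow_mul_mem_logPoly le_rfl he))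
      (Submodule.smul_mem _ (-((j : ℂ) + 1)) (smallLogPoly_mono (Nat.le_succ j) hG)),
      fun p hp => ?_⟩
    have hpc : p - c ≠ 0 := sub_ne_zero.2 fun h => hcΩ (h ▸ hp.2)
    have hder := (((hK p hp.2).fun_pow (j + 1)).fun_mul (hbe p hp.1)).fun_add
      ((hG' p hp).const_mul (-((j : ℂ) + 1)))
    refine (hder.congr_of_eventuallyEq (Eventually.of_forall fun q => ?_)).congr_deriv ?_
    · simp only [Pi.add_apply, Pi.mul_apply, Pi.pow_apply, Pi.smul_apply, smul_eq_mul]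
      ring
    · push_cast
      field_simp
      ring

lemma exists_primitive_of_mem_logPoly (hf : f ∈ logPoly c r K n) :
    ∃ F ∈ smallLogPoly c r K n, ∀ p ∈ Metric.ball c r ∩ Ω, HasDerivAt F (f p) p := by
  induction hf using Submodule.span_induction with
  | mem f hf =>
    obtain ⟨j, hj, b, hb, rfl⟩ := hf
    obtain ⟨F, hF, hF'⟩ := exists_primitive_pow_mul hr hcΩ hK j hb
    exact ⟨F, smallLogPoly_mono hj hF, hF'⟩
  | zero => exact ⟨0, zero_mem _, fun p _ => hasDerivAt_const p 0⟩
  | add f g _ _ hf hg =>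
    obtain ⟨F, hF, hF'⟩ := hf
    obtain ⟨G, hG, hG'⟩ := hg
    exact ⟨F + G, add_mem hF hG, fun p hp => (hF' p hp).add (hG' p hp)⟩
  | smul a f _ hf =>
    obtain ⟨F, hF, hF'⟩ := hf
    exact ⟨a • F, Submodule.smul_mem _ a hF, fun p hp => (hF' p hp).const_smul a⟩

lemma exists_primitive_div_of_mem_logPoly (hf : f ∈ logPoly c r K n) :
    ∃ F ∈ logPoly c r K (n + 1), ∀ p ∈ Metric.ball c r ∩ Ω, HasDerivAt F (f p / (p - c)) p := by
  induction hf using Submodule.span_induction with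
  | mem f hf =>
    obtain ⟨j, hj, b, hb, rfl⟩ := hf
    obtain ⟨G, hG, hG'⟩ := exists_primitive_pow_mul hr hcΩ hK j
      (analyticOnNhd_dslope Metric.isOpen_ball (Metric.mem_ball_self hr) hb)
    have hconst : AnalyticOnNhd ℂ (fun _ => b c / ((j : ℂ) + 1)) (Metric.ball c r) :=
      analyticOnNhd_const
    refine ⟨_, add_mem (pow_mul_mem_logPoly (by lia : j + 1 ≤ n + 1) hconst)
      (logPoly_mono (by lia) (smallLogPoly_le_logPoly hG)), fun p hp => ?_⟩
    have hpc : p - c ≠ 0 := sub_ne_zero.2 fun h => hcΩ (h ▸ hp.2)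
    have hslope : b p = (p - c) * dslope b c p + b c := by
      rw [← smul_eq_mul, sub_smul_dslope, sub_add_cancel]
    have hder := ((hasDerivAt_pow_succ_div (hK p hp.2) j).mul_const (b c)).add (hG' p hp)
    refine (hder.congr_of_eventuallyEq (Eventually.of_forall fun q => ?_)).congr_deriv ?_
    · simp only [Pi.add_apply, Pi.mul_apply, Pi.pow_apply]
      ring
    · rw [Pi.mul_apply, Pi.pow_apply, hslope]
      field_simp
      ring
  | zero => exact ⟨0, zero_mem _, fun p _ => by simp⟩
  | add f g _ _ hf hg =>
    obtain ⟨F, hF, hF'⟩ := hf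
    obtain ⟨G, hG, hG'⟩ := hg
    refine ⟨F + G, add_mem hF hG, fun p hp => ?_⟩
    simpa only [Pi.add_apply, add_div] using (hF' p hp).add (hG' p hp)
  | smul a f _ hf =>
    obtain ⟨F, hF, hF'⟩ := hf
    refine ⟨a • F, Submodule.smul_mem _ a hF, fun p hp => ?_⟩
    simpa only [Pi.smul_apply, smul_eq_mul, mul_div_assoc] using (hF' p hp).const_smul a

end Primitives

/-- `f` tends to `0` along `l`, even after multiplication by an arbitrary power of `K`. -/
def IsNegligible (K : ℂ → ℂ) (l : Filter ℂ) (f : ℂ → ℂ) : Prop :=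
  ∀ j, Tendsto (fun p => K p ^ j * f p) l (𝓝 0)

variable {l : Filter ℂ}

lemma IsNegligible.tendsto (h : IsNegligible K l f) : Tendsto f l (𝓝 0) := by
  simpa using h 0

lemma IsNegligible.congr' (hf : IsNegligible K l f) (h : f =ᶠ[l] g) : IsNegligible K l g :=
  fun j => (hf j).congr' (h.mono fun p hp => by rw [hp])

lemma IsNegligible.zero : IsNegligible K l 0 := fun j => by
  simpa using tendsto_const_nhds

lemma IsNegligible.add (hf : IsNegligible K l f) (hg : IsNegligible K l g) :
    IsNegligible K l (f + g) := fun j => by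
  simpa [mul_add] using (hf j).add (hg j)

lemma IsNegligible.mul_of_tendsto {a : ℂ} (hf : IsNegligible K l f) (hg : Tendsto g l (𝓝 a)) :
    IsNegligible K l (f * g) := fun j => by
  simpa [mul_assoc] using (hf j).mul hg

lemma IsNegligible.pow_mul (hf : IsNegligible K l f) (k : ℕ) : IsNegligible K l (K ^ k * f) :=
  fun j => by simpa [pow_add, mul_assoc] using hf (j + k)

lemma IsNegligible.mul_logPoly (hr : 0 < r) (hl : l ≤ 𝓝 c) (hf : IsNegligible K l f)
    (hg : g ∈ logPoly c r K n) : IsNegligible K l (f * g) := by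
  induction hg using Submodule.span_induction with
  | mem g hg =>
    obtain ⟨j, -, b, hb, rfl⟩ := hg
    have hb' := (hb c (Metric.mem_ball_self hr)).continuousAt.tendsto.mono_left hl
    rw [← mul_assoc, mul_comm f]
    exact (hf.pow_mul j).mul_of_tendsto hb'
  | zero => simpa using IsNegligible.zero
  | add g h _ _ hg hh => simpa only [mul_add] using hg.add hh
  | smul a g _ hg =>
    intro j
    simpa [mul_left_comm] using (hg j).const_mul a

lemma isNegligible_of_mem_smallLogPoly (hr : 0 < r) (hl : l ≤ 𝓝 c)
    (hc : IsNegligible K l fun p => p - c) (hf : f ∈ smallLogPoly c r K n) :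
    IsNegligible K l f := by
  obtain ⟨g, hg, rfl⟩ := hf
  exact hc.mul_logPoly hr hl hg

end LogPolynomials

section TangentialPrimitives

lemma exists_list_recursion {α β : Type*} (Good : List α → β → Prop) (R : α → List α → β → β → Prop)
    (f₀ : β) (h0 : Good [] f₀)
    (hstep : ∀ σ u f, Good u f → ∃ F, Good (σ :: u) F ∧ R σ u f F) :
    ∃ E : List α → β, E [] = f₀ ∧ (∀ u, Good u (E u)) ∧ ∀ σ u, R σ u (E u) (E (σ :: u)) := by
  choose! next hnext hR using hstep
  let E : List α → β := fun u => u.rec f₀ fun σ u f => next σ u f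
  have hE : ∀ u, Good u (E u) := fun u => by
    induction u with
    | nil => exact h0
    | cons σ u ih => exact hnext σ u _ ih
  exact ⟨E, rfl, hE, fun σ u => hR σ u _ (hE u)⟩

variable {S : Finset ℂ} {τ : S} {r : ℝ} {K : ℂ → ℂ} {Ω : Set ℂ}

/-- The shape of the iterated primitives based at the letter `τ`, for a logarithm `K` of `p - τ`:
the divided powers of `K` for the powers of `τ`, and functions that vanish at `τ` up to
logarithms for the other words. -/
def IsTangential (τ : S) (r : ℝ) (K : ℂ → ℂ) (u : List S) (f : ℂ → ℂ) : Prop :=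
  ((∀ ρ ∈ u, ρ = τ) ∧ f = fun p => K p ^ u.length / (u.length.factorial : ℂ)) ∨
  ((¬ ∀ ρ ∈ u, ρ = τ) ∧ ∃ n, (u ∈ notEndingIn τ → n = 0) ∧ f ∈ smallLogPoly (τ : ℂ) r K n)

lemma analyticOnNhd_one_div_sub {U : Set ℂ} {σ : ℂ} (h : σ ∉ U) :
    AnalyticOnNhd ℂ (fun p => 1 / (p - σ)) U := fun _ hp =>
  analyticAt_const.div (analyticAt_id.sub analyticAt_const)
    (sub_ne_zero.2 (ne_of_mem_of_not_mem hp h))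

lemma eq_nil_of_mem_notEndingIn {u : List S} (hu : ∀ ρ ∈ u, ρ = τ) (h : u ∈ notEndingIn τ) :
    u = [] := by
  by_contra hne
  exact h (by rw [List.getLast?_eq_some_getLast hne, hu _ (List.getLast_mem hne)]; rfl)

lemma exists_isTangential_cons_self_of_forall_eq (hK : ∀ p ∈ Ω, HasDerivAt K (1 / (p - τ)) p)
    {u : List S} (hu : ∀ ρ ∈ u, ρ = τ) :
    ∃ F, IsTangential τ r K (τ :: u) F ∧ ∀ p ∈ Metric.ball (τ : ℂ) r ∩ Ω,
      HasDerivAt F (K p ^ u.length / (u.length.factorial : ℂ) / (p - τ)) p := by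
  refine ⟨_, Or.inl ⟨by simpa using hu, rfl⟩, fun p hp => ?_⟩
  have hder := (hasDerivAt_pow_succ_div (hK p hp.2) u.length).div_const (u.length.factorial : ℂ)
  refine (hder.congr_of_eventuallyEq (Eventually.of_forall fun q => ?_)).congr_deriv (by ring)
  simp only [List.length_cons, Nat.factorial_succ, Nat.cast_mul, Nat.cast_succ]
  rw [div_div]

section Step

variable (hr : 0 < r) (hcΩ : (τ : ℂ) ∉ Ω) (hK : ∀ p ∈ Ω, HasDerivAt K (1 / (p - τ)) p)
include hr hcΩ hK

lemma exists_primitive_div_sub_of_mem_logPoly {σ : ℂ} (hσ : σ ∉ Metric.ball (τ : ℂ) r) {n : ℕ}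
    {f : ℂ → ℂ} (hf : f ∈ logPoly (τ : ℂ) r K n) :
    ∃ F ∈ smallLogPoly (τ : ℂ) r K n,
      ∀ p ∈ Metric.ball (τ : ℂ) r ∩ Ω, HasDerivAt F (f p / (p - σ)) p := by
  obtain ⟨F, hF, hF'⟩ := exists_primitive_of_mem_logPoly hr hcΩ hK
    (mul_mem_logPoly (analyticOnNhd_one_div_sub hσ) hf)
  exact ⟨F, hF, fun p hp => by simpa [div_eq_inv_mul] using hF' p hp⟩

lemma exists_primitive_div_sub_of_mem_smallLogPoly
    (hS : ∀ σ : S, σ ≠ τ → (σ : ℂ) ∉ Metric.ball (τ : ℂ) r) (σ : S) {n : ℕ} {f : ℂ → ℂ}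
    (hf : f ∈ smallLogPoly (τ : ℂ) r K n) :
    ∃ F ∈ smallLogPoly (τ : ℂ) r K n,
      ∀ p ∈ Metric.ball (τ : ℂ) r ∩ Ω, HasDerivAt F (f p / (p - σ)) p := by
  rcases eq_or_ne σ τ with rfl | hσ
  · obtain ⟨g, hg, rfl⟩ := hf
    obtain ⟨F, hF, hF'⟩ := exists_primitive_of_mem_logPoly hr hcΩ hK hg
    refine ⟨F, hF, fun p hp => (hF' p hp).congr_deriv ?_⟩
    have hpc : p - σ ≠ 0 := sub_ne_zero.2 fun h => hcΩ (h ▸ hp.2)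
    rw [LinearMap.mulLeft_apply, Pi.mul_apply, mul_div_cancel_left₀ _ hpc]
  · exact exists_primitive_div_sub_of_mem_logPoly hr hcΩ hK (hS σ hσ) (smallLogPoly_le_logPoly hf)

lemma exists_isTangential_cons (hS : ∀ σ : S, σ ≠ τ → (σ : ℂ) ∉ Metric.ball (τ : ℂ) r) (σ : S)
    (u : List S) (f : ℂ → ℂ) (hf : IsTangential τ r K u f) :
    ∃ F, IsTangential τ r K (σ :: u) F ∧
      ∀ p ∈ Metric.ball (τ : ℂ) r ∩ Ω, HasDerivAt F (f p / (p - σ)) p := by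
  rcases hf with ⟨hu, rfl⟩ | ⟨hu, n, hn, hf⟩
  · rcases eq_or_ne σ τ with rfl | hσ
    · exact exists_isTangential_cons_self_of_forall_eq hK hu
    · have hmem : (fun p => K p ^ u.length / (u.length.factorial : ℂ)) ∈
          logPoly (τ : ℂ) r K u.length :=
        pow_mul_mem_logPoly le_rfl (analyticOnNhd_const (v := (u.length.factorial : ℂ)⁻¹))
      obtain ⟨F, hF, hF'⟩ := exists_primitive_div_sub_of_mem_logPoly hr hcΩ hK (hS σ hσ) hmem
      refine ⟨F, Or.inr ⟨fun h => hσ (h σ List.mem_cons_self), u.length, fun h => ?_, hF⟩, hF'⟩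
      rw [eq_nil_of_mem_notEndingIn hu (tail_mem_notEndingIn h), List.length_nil]
  · obtain ⟨F, hF, hF'⟩ := exists_primitive_div_sub_of_mem_smallLogPoly hr hcΩ hK hS σ hf
    exact ⟨F, Or.inr ⟨fun h => hu fun ρ hρ => h ρ (List.mem_cons_of_mem σ hρ), n,
      fun h => hn (tail_mem_notEndingIn h), hF⟩, hF'⟩

lemma exists_isTangential (hS : ∀ σ : S, σ ≠ τ → (σ : ℂ) ∉ Metric.ball (τ : ℂ) r) :
    ∃ E : List S → ℂ → ℂ, (E [] = fun _ => 1) ∧ (∀ u, IsTangential τ r K u (E u)) ∧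
      ∀ σ u, ∀ p ∈ Metric.ball (τ : ℂ) r ∩ Ω, HasDerivAt (E (σ :: u)) (E u p / (p - σ)) p :=
  exists_list_recursion (IsTangential τ r K)
    (fun σ _ f F => ∀ p ∈ Metric.ball (τ : ℂ) r ∩ Ω, HasDerivAt F (f p / (p - σ)) p)
    (fun _ => 1) (Or.inl ⟨by simp, by simp⟩) (exists_isTangential_cons hr hcΩ hK hS)

end Step

end TangentialPrimitives

/-! ### Hyperlogarithms near the origin -/

section ShuffleSystems

variable {S : Finset ℂ} {P : Set (List S)} {U : Set ℂ} {Y : List S → ℂ → ℂ} {l : Filter ℂ}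

/-- The linear extension of a family of functions indexed by words. -/
def evalLin (Y : List S → ℂ → ℂ) (p : ℂ) : WordSpace S →ₗ[ℚ] ℂ :=
  Finsupp.linearCombination ℚ fun w => Y w p

lemma evalLin_word (Y : List S → ℂ → ℂ) (p : ℂ) (w : List S) : evalLin Y p (word w) = Y w p := by
  simp [evalLin]

lemma evalLin_apply (Y : List S → ℂ → ℂ) (p : ℂ) (x : WordSpace S) :
    evalLin Y p x = ∑ w ∈ x.support, ((x w : ℚ) : ℂ) * Y w p := by
  simp only [evalLin, Finsupp.linearCombination_apply, Finsupp.sum, Rat.smul_def]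

lemma hyperlogLin_eq_evalLin (x : WordSpace S) (p : ℂ) :
    hyperlogLin x p = evalLin (fun w => hyperlog (w.map Subtype.val)) p x :=
  (evalLin_apply _ p x).symm

lemma evalLin_mapDomain_cons (Y : List S → ℂ → ℂ) (p : ℂ) (σ : S) (x : WordSpace S) :
    evalLin Y p (x.mapDomain (σ :: ·)) = ∑ w ∈ x.support, ((x w : ℚ) : ℂ) * Y (σ :: w) p := by
  rw [evalLin, Finsupp.linearCombination_mapDomain, ← evalLin_apply fun w => Y (σ :: w)]
  rfl

lemma tendsto_evalLin {x : WordSpace S} (h : ∀ w ∈ x.support, Tendsto (Y w) l (𝓝 0)) :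
    Tendsto (fun p => evalLin Y p x) l (𝓝 0) := by
  simp only [evalLin_apply]
  rw [show (0 : ℂ) = ∑ w ∈ x.support, ((x w : ℚ) : ℂ) * 0 by simp]
  exact tendsto_finsetSum _ fun w hw => (h w hw).const_mul _

lemma evalLin_shuffleLin {p : ℂ}
    (h : ∀ u ∈ P, ∀ v ∈ P, evalLin Y p (shuffleWords u v) = Y u p * Y v p) {x y : WordSpace S}
    (hx : x ∈ Finsupp.supported ℚ ℚ P) (hy : y ∈ Finsupp.supported ℚ ℚ P) :
    evalLin Y p (shuffleLin x y) = evalLin Y p x * evalLin Y p y := by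
  have hword : ∀ u ∈ P, evalLin Y p (shuffleLin (word u) y) =
      evalLin Y p (word u) * evalLin Y p y := fun u hu =>
    eqOn_supported_of_word (f := (evalLin Y p).comp (shuffleLin (word u)))
      (g := (LinearMap.mul ℚ ℂ (evalLin Y p (word u))).comp (evalLin Y p))
      (fun v hv => by simp [shuffleLin_word, h u hu v hv, evalLin_word]) hy
  exact eqOn_supported_of_word (f := (evalLin Y p).comp (shuffleLin.flip y))
    (g := ((LinearMap.mul ℚ ℂ).flip (evalLin Y p y)).comp (evalLin Y p))
    (fun u hu => by simpa [mul_comm] using hword u hu) hx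

/-- A set of words on which the recursive description of the shuffle product makes sense. -/
structure IsShuffleClosed (P : Set (List S)) : Prop where
  tail_mem : ∀ {σ u}, σ :: u ∈ P → u ∈ P
  cons_mem : ∀ {σ u}, u ≠ [] → u ∈ P → σ :: u ∈ P
  shuffleWords_mem : ∀ {u v}, u ∈ P → v ∈ P → shuffleWords u v ∈ Finsupp.supported ℚ ℚ P

lemma isShuffleClosed_univ : IsShuffleClosed (univ : Set (List S)) where
  tail_mem _ := mem_univ _
  cons_mem _ _ := mem_univ _
  shuffleWords_mem _ _ x _ := mem_univ x

lemma isShuffleClosed_notEndingIn (a : S) : IsShuffleClosed (notEndingIn a) where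
  tail_mem := tail_mem_notEndingIn
  cons_mem := cons_mem_notEndingIn
  shuffleWords_mem {u v} hu hv := by
    rw [← shuffleLin_word]
    exact shuffleLin_mem_notEndingIn (Finsupp.single_mem_supported _ _ hu)
      (Finsupp.single_mem_supported _ _ hv)

lemma ne_nil_of_mem_support_shuffleWords {u v x : List S} (h : u ≠ [] ∨ v ≠ [])
    (hx : x ∈ (shuffleWords u v).support) : x ≠ [] := by
  rintro rfl
  have hnil := List.nil_perm.1 (perm_of_mem_support_shuffleWords u v hx)
  exact h.elim (fun hu => hu (List.append_eq_nil_iff.1 hnil).1)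
    fun hv => hv (List.append_eq_nil_iff.1 hnil).2

lemma IsShuffleClosed.shuffleWords_mem_cons (hP : IsShuffleClosed P) {u v : List S} (hu : u ∈ P)
    (hv : v ∈ P) (h : u ≠ [] ∨ v ≠ []) (σ : S) :
    shuffleWords u v ∈ Finsupp.supported ℚ ℚ {x | σ :: x ∈ P} := fun _ hx =>
  hP.cons_mem (ne_nil_of_mem_support_shuffleWords h hx) (hP.shuffleWords_mem hu hv hx)

/-- On the open set `U`, the functions `Y u` for the words `u` in `P` are iterated primitives of
the forms `dp / (p - σ)`. -/
structure IsPrimitiveSystem (P : Set (List S)) (U : Set ℂ) (Y : List S → ℂ → ℂ) : Prop where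
  nil : Y [] = fun _ => 1
  hasDerivAt : ∀ {σ u}, σ :: u ∈ P → ∀ p ∈ U, HasDerivAt (Y (σ :: u)) (Y u p / (p - σ)) p

lemma IsPrimitiveSystem.hasDerivAt_evalLin_cons (hY : IsPrimitiveSystem P U Y) {σ : S}
    {x : WordSpace S} (hx : x ∈ Finsupp.supported ℚ ℚ {u | σ :: u ∈ P}) {p : ℂ} (hp : p ∈ U) :
    HasDerivAt (fun q => evalLin Y q (x.mapDomain (σ :: ·))) (evalLin Y p x / (p - σ)) p := by
  simp only [evalLin_mapDomain_cons]
  simp only [evalLin_apply, Finset.sum_div, mul_div_assoc]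
  exact HasDerivAt.fun_sum fun w hw => (hY.hasDerivAt (hx hw) p hp).const_mul _

lemma eqOn_of_hasDerivAt_of_tendsto [l.NeBot] (hU : IsOpen U) (hUc : IsPreconnected U)
    (hlU : U ∈ l) {f g f' : ℂ → ℂ} (hf : ∀ p ∈ U, HasDerivAt f (f' p) p)
    (hg : ∀ p ∈ U, HasDerivAt g (f' p) p) (hlim : Tendsto (fun p => f p - g p) l (𝓝 0)) :
    EqOn f g U := by
  obtain ⟨k, hk⟩ := hU.exists_eq_add_of_deriv_eq hUc
    (fun p hp => (hf p hp).differentiableAt.differentiableWithinAt)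
    (fun p hp => (hg p hp).differentiableAt.differentiableWithinAt)
    (fun p hp => (hf p hp).deriv.trans (hg p hp).deriv.symm)
  have hk0 : k = 0 := by
    refine tendsto_nhds_unique (Tendsto.congr' ?_ tendsto_const_nhds) hlim
    filter_upwards [hlU] with p hp
    rw [hk hp, add_sub_cancel_left]
  exact fun p hp => (hk hp).trans (by simp only [hk0, add_zero])

-- Both sides satisfy the same differential equation, because the recursion for the shuffle product
-- has the shape of the Leibniz rule.
lemma IsPrimitiveSystem.evalLin_shuffleWords [l.NeBot] (hY : IsPrimitiveSystem P U Y)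
    (hP : IsShuffleClosed P) (hU : IsOpen U) (hUc : IsPreconnected U) (hlU : U ∈ l)
    (hlim : ∀ u ∈ P, ∀ v ∈ P, u ≠ [] → v ≠ [] →
      Tendsto (fun p => Y u p * Y v p - evalLin Y p (shuffleWords u v)) l (𝓝 0)) :
    ∀ u ∈ P, ∀ v ∈ P, ∀ p ∈ U, evalLin Y p (shuffleWords u v) = Y u p * Y v p := by
  intro u
  induction u with
  | nil => intro _ v _ p _; rw [shuffleWords_nil_left, evalLin_word, hY.nil, one_mul]
  | cons σ u ihu =>
    intro hu v
    induction v with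
    | nil => intro _ p _; rw [shuffleWords_nil_right, evalLin_word, hY.nil, mul_one]
    | cons ρ v ihv =>
      intro hv p hp
      refine (eqOn_of_hasDerivAt_of_tendsto hU hUc hlU
        (fun p hp => (hY.hasDerivAt hu p hp).fun_mul (hY.hasDerivAt hv p hp)) (fun p hp => ?_)
        (hlim _ hu _ hv (List.cons_ne_nil _ _) (List.cons_ne_nil _ _)) hp).symm
      have hσ := hY.hasDerivAt_evalLin_cons
        (hP.shuffleWords_mem_cons (hP.tail_mem hu) hv (Or.inr (List.cons_ne_nil ρ v)) σ) hp
      have hρ := hY.hasDerivAt_evalLin_cons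
        (hP.shuffleWords_mem_cons hu (hP.tail_mem hv) (Or.inl (List.cons_ne_nil σ u)) ρ) hp
      rw [ihu (hP.tail_mem hu) _ hv p hp] at hσ
      rw [ihv (hP.tail_mem hv) p hp] at hρ
      simp only [shuffleWords_cons_cons, map_add]
      exact (hσ.fun_add hρ).congr_deriv (by ring)

end ShuffleSystems

section HyperlogNearOrigin

variable {S : Finset ℂ} {o : S} {V : Set ℂ} {σ : S} {u : List S}

/-- The hyperlogarithm of a word over `S`. -/
abbrev hlog (w : List S) : ℂ → ℂ := hyperlog (w.map Subtype.val)

lemma hlog_nil : hlog ([] : List S) = fun _ => 1 := by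
  ext p
  rw [hlog, List.map_nil, hyperlog]

lemma exists_ne_of_mem_notEndingIn {a : S} {w : List S} (hw : w ∈ notEndingIn a) (hne : w ≠ []) :
    ∃ ρ ∈ w, ρ ≠ a := by
  by_contra! h
  exact hne (eq_nil_of_mem_notEndingIn h hw)

lemma hlog_cons (ho : (o : ℂ) = 0) (h : σ :: u ∈ notEndingIn o) (p : ℂ) :
    hlog (σ :: u) p = ∫ s in (0 : ℝ)..1, p / (s * p - σ) * hlog u (s * p) := by
  obtain ⟨ρ, hρ, hρo⟩ := exists_ne_of_mem_notEndingIn h (List.cons_ne_nil σ u)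
  have hne : ¬ ∀ ρ ∈ (σ : ℂ) :: u.map Subtype.val, ρ = 0 := fun hall =>
    hρo <| Subtype.ext <| (hall ρ (List.mem_map_of_mem (f := Subtype.val) hρ)).trans ho.symm
  rw [hlog, List.map_cons, hyperlog, if_neg hne]

lemma hlog_zero (ho : (o : ℂ) = 0) (h : u ∈ notEndingIn o) (hu : u ≠ []) : hlog u 0 = 0 := by
  obtain ⟨σ, u, rfl⟩ := List.exists_cons_of_ne_nil hu
  simp [hlog_cons ho h]

lemma hlog_cons_eq_integral (ho : (o : ℂ) = 0) (h : σ :: u ∈ notEndingIn o) {g : ℂ → ℂ}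
    (hg : ∀ p ≠ 0, g p = hlog u p / (p - σ)) (p : ℂ) :
    hlog (σ :: u) p = ∫ s in (0 : ℝ)..1, p * g (s * p) := by
  rw [hlog_cons ho h]
  refine intervalIntegral.integral_congr_ae ?_
  filter_upwards [MeasureTheory.Measure.ae_ne MeasureTheory.volume (0 : ℝ)] with s hs _
  rcases eq_or_ne p 0 with rfl | hp
  · simp
  · rw [hg _ (mul_ne_zero (by exact_mod_cast hs) hp)]
    ring

lemma integral_segment_eq_sub {g Q : ℂ → ℂ} {p : ℂ}
    (hseg : ∀ s ∈ Icc (0 : ℝ) 1, (s : ℂ) * p ∈ V) (hg : ContinuousOn g V)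
    (hQ : ∀ p ∈ V, HasDerivAt Q (g p) p) : ∫ s in (0 : ℝ)..1, p * g (s * p) = Q p - Q 0 := by
  have hder : ∀ s ∈ uIcc (0 : ℝ) 1, HasDerivAt (fun s : ℝ => Q (s * p)) (p * g (s * p)) s := by
    intro s hs
    rw [uIcc_of_le zero_le_one] at hs
    have hline : HasDerivAt (fun s : ℝ => (s : ℂ) * p) p s := by
      simpa using (Complex.ofRealCLM.hasDerivAt (x := s)).mul_const p
    have hcomp := (hQ _ (hseg s hs)).comp s hline
    rwa [mul_comm] at hcomp
  have hintegrable : IntervalIntegrable (fun s : ℝ => p * g (s * p)) MeasureTheory.volume 0 1 := by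
    refine ContinuousOn.intervalIntegrable ?_
    rw [uIcc_of_le zero_le_one]
    exact continuousOn_const.mul (hg.comp (by fun_prop) hseg)
  simpa using intervalIntegral.integral_eq_sub_of_hasDerivAt hder hintegrable

section Domain

variable (ho : (o : ℂ) = 0) (hV : IsOpen V) (h0 : (0 : ℂ) ∈ V)
  (hS : ∀ σ : S, σ ≠ o → (σ : ℂ) ∉ V)
include ho hV h0 hS

-- If `σ = 0`, the integrand has a removable singularity at the origin.
lemma exists_analytic_integrand (h : σ :: u ∈ notEndingIn o) (hu : AnalyticOnNhd ℂ (hlog u) V) :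
    ∃ g : ℂ → ℂ, AnalyticOnNhd ℂ g V ∧ ∀ p, p ≠ 0 ∨ σ ≠ o → g p = hlog u p / (p - σ) := by
  by_cases hσ : σ = o
  · subst hσ
    have hne : u ≠ [] := by rintro rfl; simp [notEndingIn] at h
    refine ⟨dslope (hlog u) 0, analyticOnNhd_dslope hV h0 hu, fun p hp => ?_⟩
    rw [dslope_of_ne _ (hp.resolve_right fun h => h rfl), slope_def_field,
      hlog_zero ho (tail_mem_notEndingIn h) hne, ho, sub_zero]
  · exact ⟨fun p => hlog u p / (p - σ), by
      simpa only [mul_one_div] using hu.mul (analyticOnNhd_one_div_sub (hS σ hσ)), fun _ _ => rfl⟩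

lemma exists_hasDerivAt_hlog_cons (hVc : Convex ℝ V) (h : σ :: u ∈ notEndingIn o)
    (hu : AnalyticOnNhd ℂ (hlog u) V) :
    ∃ g : ℂ → ℂ, (∀ p, p ≠ 0 ∨ σ ≠ o → g p = hlog u p / (p - σ)) ∧
      ∀ p ∈ V, HasDerivAt (hlog (σ :: u)) (g p) p := by
  obtain ⟨g, hg, hgu⟩ := exists_analytic_integrand ho hV h0 hS h hu
  obtain ⟨Q, hQ⟩ := hVc.exists_forall_hasDerivWithinAt hg.differentiableOn
  have hQ' : ∀ p ∈ V, HasDerivAt Q (g p) p := fun p hp => (hQ p hp).hasDerivAt (hV.mem_nhds hp)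
  have hseg : ∀ p ∈ V, ∀ s ∈ Icc (0 : ℝ) 1, (s : ℂ) * p ∈ V := fun p hp s hs => by
    simpa using hVc.smul_mem_of_zero_mem h0 hp hs
  have hprim : EqOn (hlog (σ :: u)) (fun p => Q p - Q 0) V := fun p hp => by
    rw [hlog_cons_eq_integral ho h fun p hp => hgu p (Or.inl hp),
      integral_segment_eq_sub (hseg p hp) hg.continuousOn hQ']
  exact ⟨g, hgu, fun p hp => ((hQ' p hp).sub_const (Q 0)).congr_of_eventuallyEq
    (hprim.eventuallyEq_of_mem (hV.mem_nhds hp))⟩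

lemma analyticOnNhd_hlog (hVc : Convex ℝ V) {w : List S} (hw : w ∈ notEndingIn o) :
    AnalyticOnNhd ℂ (hlog w) V := by
  induction w with
  | nil => rw [hlog_nil]; exact analyticOnNhd_const
  | cons σ u ih =>
    obtain ⟨g, -, hg⟩ := exists_hasDerivAt_hlog_cons ho hV h0 hS hVc hw
      (ih (tail_mem_notEndingIn hw))
    exact DifferentiableOn.analyticOnNhd
      (fun p hp => (hg p hp).differentiableAt.differentiableWithinAt) hV

lemma hasDerivAt_hlog (hVc : Convex ℝ V) (hw : σ :: u ∈ notEndingIn o) {p : ℂ} (hp : p ∈ V)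
    (hpσ : p ≠ σ) : HasDerivAt (hlog (σ :: u)) (hlog u p / (p - σ)) p := by
  obtain ⟨g, hgu, hg⟩ := exists_hasDerivAt_hlog_cons ho hV h0 hS hVc hw
    (analyticOnNhd_hlog ho hV h0 hS hVc (tail_mem_notEndingIn hw))
  have hp0 : p ≠ 0 ∨ σ ≠ o := by
    by_contra! h
    exact hpσ (by rw [h.1, h.2, ho])
  rw [← hgu p hp0]
  exact hg p hp

end Domain

end HyperlogNearOrigin

/-! ### Behaviour at the letter `τ` -/

section SegmentFilters

/-- Approach to `t` along the segment from `0`. -/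
def toLetter (t : ℝ) : Filter ℂ := map (fun s : ℝ => (s : ℂ) * t) (𝓝[<] (1 : ℝ))

/-- Departure from `0` along the segment to `t`. -/
def fromZero (t : ℝ) : Filter ℂ := map (fun s : ℝ => (s : ℂ) * t) (𝓝[>] (0 : ℝ))

instance (t : ℝ) : (toLetter t).NeBot := by unfold toLetter; infer_instance

instance (t : ℝ) : (fromZero t).NeBot := by unfold fromZero; infer_instance

lemma toLetter_le (t : ℝ) : toLetter t ≤ 𝓝 (t : ℂ) := by
  have h : Continuous fun s : ℝ => (s : ℂ) * t := by fun_prop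
  simpa [toLetter, Tendsto] using (h.tendsto 1).mono_left (nhdsWithin_le_nhds (s := Iio 1))

lemma fromZero_le (t : ℝ) : fromZero t ≤ 𝓝 0 := by
  have h : Continuous fun s : ℝ => (s : ℂ) * t := by fun_prop
  simpa [fromZero, Tendsto] using (h.tendsto 0).mono_left (nhdsWithin_le_nhds (s := Ioi 0))

lemma eventually_toLetter {t : ℝ} {p : ℂ → Prop} (h : ∀ s ∈ Ioo (0 : ℝ) 1, p (s * t)) :
    ∀ᶠ q in toLetter t, p q :=
  eventually_map.2 <| mem_of_superset (Ioo_mem_nhdsLT zero_lt_one) h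

lemma eventually_fromZero {t : ℝ} {p : ℂ → Prop} (h : ∀ s ∈ Ioo (0 : ℝ) 1, p (s * t)) :
    ∀ᶠ q in fromZero t, p q :=
  eventually_map.2 <| mem_of_superset (Ioo_mem_nhdsGT zero_lt_one) h

/-- The square root of the relative distance to `t` along the segment from `0`. It dominates the
powers of the logarithm, and its inverse is integrable. -/
def sqrtDist (t : ℝ) (p : ℂ) : ℂ := (((1 - p.re / t) ^ (1 / 2 : ℝ) : ℝ) : ℂ)

lemma sqrtDist_segment {t : ℝ} (ht : 0 < t) (s : ℝ) :
    sqrtDist t ((s : ℂ) * t) = (((1 - s) ^ (1 / 2 : ℝ) : ℝ) : ℂ) := by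
  have hs : ((s : ℂ) * t).re / t = s := by simp [ht.ne']
  rw [sqrtDist, hs]

lemma tendsto_log_pow_mul_rpow (j : ℕ) :
    Tendsto (fun x : ℝ => Real.log x ^ j * x ^ (1 / 2 : ℝ)) (𝓝[>] 0) (𝓝 0) := by
  refine squeeze_zero_norm' ?_ (isLittleO_abs_log_rpow_rpow_nhdsGT_zero (j : ℝ)
    (show (-(1 / 2) : ℝ) < 0 by norm_num)).tendsto_div_nhds_zero
  filter_upwards [self_mem_nhdsWithin] with x hx
  have hx : 0 < x := hx
  rw [Real.rpow_natCast, Real.rpow_neg hx.le, div_inv_eq_mul, norm_mul, norm_pow,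
    Real.norm_eq_abs, Real.norm_of_nonneg (Real.rpow_nonneg hx.le _)]

variable {t : ℝ} {K : ℂ → ℂ}

lemma isNegligible_sqrtDist (ht : 0 < t)
    (hK : ∀ s ∈ Ico (0 : ℝ) 1, K ((s : ℂ) * t) = (Real.log (1 - s) : ℂ)) :
    IsNegligible K (toLetter t) (sqrtDist t) := by
  intro j
  have hsub : Tendsto (fun s : ℝ => 1 - s) (𝓝[<] 1) (𝓝[>] 0) := by
    refine tendsto_nhdsWithin_iff.2 ⟨?_, ?_⟩
    · have h : Continuous fun s : ℝ => 1 - s := by fun_prop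
      simpa using (h.tendsto 1).mono_left (nhdsWithin_le_nhds (s := Iio 1))
    · filter_upwards [self_mem_nhdsWithin] with s hs
      simpa using hs
  have hlim := (Complex.continuous_ofReal.tendsto 0).comp ((tendsto_log_pow_mul_rpow j).comp hsub)
  rw [Complex.ofReal_zero] at hlim
  refine tendsto_map'_iff.2 (hlim.congr' ?_)
  filter_upwards [Ioo_mem_nhdsLT zero_lt_one] with s hs
  simp only [Function.comp_apply, Complex.ofReal_mul, Complex.ofReal_pow]
  rw [hK s (Ioo_subset_Ico_self hs), sqrtDist_segment ht]

lemma isNegligible_sub_letter (ht : 0 < t)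
    (hK : ∀ s ∈ Ico (0 : ℝ) 1, K ((s : ℂ) * t) = (Real.log (1 - s) : ℂ)) :
    IsNegligible K (toLetter t) (fun p => p - t) := by
  have hneg := isNegligible_sqrtDist ht hK
  refine (hneg.mul_of_tendsto (hneg.tendsto.const_mul (-t : ℂ))).congr' <|
    eventually_toLetter fun s hs => ?_
  have hsq : (((1 - s) ^ (1 / 2 : ℝ) : ℝ) : ℂ) * (((1 - s) ^ (1 / 2 : ℝ) : ℝ) : ℂ) = 1 - s := by
    rw [← Complex.ofReal_mul, ← Real.rpow_add (by linarith [hs.2])]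
    norm_num
  rw [Pi.mul_apply, sqrtDist_segment ht, mul_left_comm, hsq]
  ring

lemma intervalIntegrable_of_sqrt_mul {q : ℝ → ℂ} (hq : ContinuousOn q (Ico 0 1))
    (hlim : Tendsto (fun s : ℝ => (((1 - s) ^ (1 / 2 : ℝ) : ℝ) : ℂ) * q s) (𝓝[<] 1) (𝓝 0)) :
    IntervalIntegrable q MeasureTheory.volume 0 1 := by
  set ψ : ℝ → ℂ := Function.update (fun s => (((1 - s) ^ (1 / 2 : ℝ) : ℝ) : ℂ) * q s) 1 0 with hψ
  have hψc : ContinuousOn ψ (Icc 0 1) := by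
    rw [hψ, continuousOn_update_iff, Icc_sdiff_right]
    refine ⟨ContinuousOn.mul ?_ hq, fun _ => hlim.mono_left (nhdsWithin_mono _ fun s hs => hs.2)⟩
    refine Complex.continuous_ofReal.comp_continuousOn ?_
    exact ContinuousOn.rpow_const (by fun_prop) fun s _ => Or.inr (by norm_num)
  have hinv : IntervalIntegrable (fun s : ℝ => (((1 - s) ^ (-(1 / 2) : ℝ) : ℝ) : ℂ))
      MeasureTheory.volume 0 1 := by
    have hrpow := (intervalIntegral.intervalIntegrable_rpow' (a := 0) (b := 1)
      (show (-1 : ℝ) < -(1 / 2) by norm_num)).comp_sub_left 1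
    rw [sub_self, sub_zero] at hrpow
    exact ⟨hrpow.symm.1.ofReal, hrpow.symm.2.ofReal⟩
  refine (hinv.mul_continuousOn (g := ψ) (by rwa [uIcc_of_le zero_le_one])).congr_uIoo
    fun s hs => ?_
  rw [uIoo_of_le zero_le_one] at hs
  have hcancel : (((1 - s) ^ (-(1 / 2) : ℝ) : ℝ) : ℂ) * (((1 - s) ^ (1 / 2 : ℝ) : ℝ) : ℂ) = 1 := by
    rw [← Complex.ofReal_mul, ← Real.rpow_add (by linarith [hs.2])]
    norm_num
  simp only [hψ, Function.update_of_ne hs.2.ne]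
  rw [← mul_assoc, hcancel, one_mul]

end SegmentFilters

/-- The local situation at the smallest positive letter `τ = t`: a convex neighbourhood `V` of
`[0, t)` without nonzero letters, a disc of radius `r` about `τ` without other letters, and a branch
`K` of `log (1 - p / τ)` on a set `Ω` that contains `V`. -/
structure LetterChart (S : Finset ℂ) (o τ : S) (t r : ℝ) (V Ω : Set ℂ) (K : ℂ → ℂ) : Prop where
  coe_o : (o : ℂ) = 0
  coe_τ : (τ : ℂ) = t
  t_pos : 0 < t
  r_pos : 0 < r
  r_lt : r < t
  isOpen_V : IsOpen V
  convex_V : Convex ℝ V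
  zero_mem : (0 : ℂ) ∈ V
  notMem_V : ∀ σ : S, σ ≠ o → (σ : ℂ) ∉ V
  segment_mem : ∀ s ∈ Ico (0 : ℝ) 1, (s : ℂ) * t ∈ V
  notMem_ball : ∀ σ : S, σ ≠ τ → (σ : ℂ) ∉ Metric.ball (τ : ℂ) r
  isOpen_Ω : IsOpen Ω
  V_subset : V ⊆ Ω
  notMem_Ω : (τ : ℂ) ∉ Ω
  hasDerivAt : ∀ p ∈ Ω, HasDerivAt K (1 / (p - τ)) p
  K_segment : ∀ s ∈ Ico (0 : ℝ) 1, K ((s : ℂ) * t) = (Real.log (1 - s) : ℂ)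
  preconnected : IsPreconnected (Metric.ball (τ : ℂ) r ∩ Ω)

/-- The part of `V` in the right half plane. -/
def right (V : Set ℂ) : Set ℂ := V ∩ {p | 0 < p.re}

namespace LetterChart

variable {S : Finset ℂ} {o τ : S} {t r : ℝ} {V Ω : Set ℂ} {K : ℂ → ℂ}
  (D : LetterChart S o τ t r V Ω K)
include D

lemma toLetter_le : toLetter t ≤ 𝓝 (τ : ℂ) := D.coe_τ ▸ Hyperlogs.toLetter_le t

lemma overlap_mem_toLetter : V ∩ Metric.ball (τ : ℂ) r ∈ toLetter t :=
  inter_mem (eventually_toLetter fun s hs => D.segment_mem s (Ioo_subset_Ico_self hs))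
    (D.toLetter_le (Metric.ball_mem_nhds _ D.r_pos))

lemma isNegligible_of_mem_smallLogPoly {n : ℕ} {f : ℂ → ℂ} (hf : f ∈ smallLogPoly (τ : ℂ) r K n) :
    IsNegligible K (toLetter t) f :=
  Hyperlogs.isNegligible_of_mem_smallLogPoly D.r_pos D.toLetter_le
    (by simpa only [D.coe_τ] using isNegligible_sub_letter D.t_pos D.K_segment) hf

lemma letter_ne_origin : τ ≠ o := by
  rintro rfl
  exact D.t_pos.ne (by exact_mod_cast D.coe_o.symm.trans D.coe_τ)

lemma isOpen_right : IsOpen (right V) :=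
  D.isOpen_V.inter (isOpen_lt continuous_const Complex.continuous_re)

lemma isPreconnected_right : IsPreconnected (right V) :=
  (D.convex_V.inter (convex_halfSpace_re_gt 0)).isPreconnected

lemma ne_of_mem_right {p : ℂ} (hp : p ∈ right V) (σ : S) : p ≠ σ := by
  rintro rfl
  rcases eq_or_ne σ o with rfl | hσ
  · simpa [D.coe_o] using hp.2
  · exact D.notMem_V σ hσ hp.1

lemma right_mem_fromZero : right V ∈ fromZero t :=
  eventually_fromZero fun s hs =>
    ⟨D.segment_mem s (Ioo_subset_Ico_self hs), by simpa using mul_pos hs.1 D.t_pos⟩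

lemma overlap_subset_right : V ∩ Metric.ball (τ : ℂ) r ⊆ right V := by
  rintro p ⟨hpV, hp⟩
  rw [Metric.mem_ball, dist_eq_norm, D.coe_τ] at hp
  have hre := (abs_lt.1 ((Complex.abs_re_le_norm (p - t)).trans_lt hp)).1
  rw [Complex.sub_re, Complex.ofReal_re] at hre
  have hrt := D.r_lt
  exact ⟨hpV, show 0 < p.re by linarith⟩

lemma isOpen_overlap : IsOpen (V ∩ Metric.ball (τ : ℂ) r) := D.isOpen_V.inter Metric.isOpen_ball

lemma isPreconnected_overlap : IsPreconnected (V ∩ Metric.ball (τ : ℂ) r) :=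
  (D.convex_V.inter (convex_ball _ _)).isPreconnected

lemma overlap_subset : V ∩ Metric.ball (τ : ℂ) r ⊆ Metric.ball (τ : ℂ) r ∩ Ω :=
  fun _ hp => ⟨hp.2, D.V_subset hp.1⟩

lemma analyticOnNhd_hlog {w : List S} (hw : w ∈ notEndingIn o) : AnalyticOnNhd ℂ (hlog w) V :=
  Hyperlogs.analyticOnNhd_hlog D.coe_o D.isOpen_V D.zero_mem D.notMem_V D.convex_V hw

lemma hasDerivAt_hlog {σ : S} {u : List S} (hw : σ :: u ∈ notEndingIn o) {p : ℂ} (hp : p ∈ V)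
    (hpσ : p ≠ σ) : HasDerivAt (hlog (σ :: u)) (hlog u p / (p - σ)) p :=
  Hyperlogs.hasDerivAt_hlog D.coe_o D.isOpen_V D.zero_mem D.notMem_V D.convex_V hw hp hpσ

lemma isPrimitiveSystem_hlog : IsPrimitiveSystem (notEndingIn o) (right V) hlog where
  nil := hlog_nil
  hasDerivAt h _ hp := D.hasDerivAt_hlog h hp.1 (D.ne_of_mem_right hp _)

lemma tendsto_hlog_fromZero {w : List S} (hw : w ∈ notEndingIn o) (hne : w ≠ []) :
    Tendsto (hlog w) (fromZero t) (𝓝 0) := by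
  have h := (D.analyticOnNhd_hlog hw 0 D.zero_mem).continuousAt.tendsto
  rw [hlog_zero D.coe_o hw hne] at h
  exact h.mono_left (fromZero_le t)

lemma evalLin_hlog_shuffleWords : ∀ u ∈ notEndingIn o, ∀ v ∈ notEndingIn o, ∀ p ∈ right V,
    evalLin hlog p (shuffleWords u v) = hlog u p * hlog v p := by
  refine D.isPrimitiveSystem_hlog.evalLin_shuffleWords (l := fromZero t)
    (isShuffleClosed_notEndingIn o) D.isOpen_right D.isPreconnected_right D.right_mem_fromZero ?_
  intro u hu v hv hune hvne
  simpa using ((D.tendsto_hlog_fromZero hu hune).mul (D.tendsto_hlog_fromZero hv hvne)).sub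
    (tendsto_evalLin fun w hw => D.tendsto_hlog_fromZero
      ((isShuffleClosed_notEndingIn o).shuffleWords_mem hu hv hw)
      (ne_nil_of_mem_support_shuffleWords (Or.inl hune) hw))

lemma eqOn_hlog_letter : EqOn (hlog [τ]) K (right V) := by
  have hτ : [τ] ∈ notEndingIn o := replicate_mem_notEndingIn D.letter_ne_origin 1
  have hK0 : K 0 = 0 := by simpa using D.K_segment 0 ⟨le_rfl, zero_lt_one⟩
  have hK := (D.hasDerivAt 0 (D.V_subset D.zero_mem)).continuousAt.tendsto.mono_left (fromZero_le t)
  rw [hK0] at hK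
  refine eqOn_of_hasDerivAt_of_tendsto D.isOpen_right D.isPreconnected_right D.right_mem_fromZero
    (D.isPrimitiveSystem_hlog.hasDerivAt hτ) (fun p hp => ?_)
    (by simpa using (D.tendsto_hlog_fromZero hτ (List.cons_ne_nil _ _)).sub hK)
  rw [hlog_nil]
  exact D.hasDerivAt p (D.V_subset hp.1)

lemma hlog_replicate (n : ℕ) {p : ℂ} (hp : p ∈ right V) :
    hlog (List.replicate n τ) p = K p ^ n / (n.factorial : ℂ) := by
  induction n with
  | zero => simp [hlog_nil]
  | succ n ih =>
    have hmem := fun n => replicate_mem_notEndingIn D.letter_ne_origin n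
    have hshuffle := D.evalLin_hlog_shuffleWords _ (hmem 1) _ (hmem n) p hp
    rw [List.replicate_one, shuffleWords_letter_replicate, map_smul, evalLin_word, ih,
      D.eqOn_hlog_letter hp, Rat.smul_def] at hshuffle
    have hn : (n : ℂ) + 1 ≠ 0 := by exact_mod_cast n.succ_ne_zero
    have hfac : (n.factorial : ℂ) ≠ 0 := by exact_mod_cast n.factorial_ne_zero
    push_cast at hshuffle
    rw [Nat.factorial_succ, Nat.cast_mul, Nat.cast_succ, pow_succ']
    field_simp at hshuffle ⊢
    linear_combination hshuffle

lemma hlog_eq_add_const {σ : S} {u : List S} (hw : σ :: u ∈ notEndingIn o) {F : ℂ → ℂ}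
    (hF : ∀ p ∈ V ∩ Metric.ball (τ : ℂ) r, HasDerivAt F (hlog u p / (p - σ)) p) :
    ∃ k, EqOn (hlog (σ :: u)) (fun p => F p + k) (V ∩ Metric.ball (τ : ℂ) r) := by
  have hL : ∀ p ∈ V ∩ Metric.ball (τ : ℂ) r, HasDerivAt (hlog (σ :: u)) (hlog u p / (p - σ)) p :=
    fun p hp => D.isPrimitiveSystem_hlog.hasDerivAt hw p (D.overlap_subset_right hp)
  exact D.isOpen_overlap.exists_eq_add_of_deriv_eq D.isPreconnected_overlap
    (fun p hp => (hL p hp).differentiableAt.differentiableWithinAt)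
    (fun p hp => (hF p hp).differentiableAt.differentiableWithinAt)
    (fun p hp => (hL p hp).deriv.trans (hF p hp).deriv.symm)

lemma exists_smallLogPoly_add_const {σ : S} {u : List S} (hw : σ :: u ∈ notEndingIn o)
    (hσ : σ ≠ τ) {n : ℕ} {f : ℂ → ℂ} (hf : f ∈ logPoly (τ : ℂ) r K n)
    (hfu : EqOn (hlog u) f (V ∩ Metric.ball (τ : ℂ) r)) :
    ∃ F ∈ smallLogPoly (τ : ℂ) r K n, ∃ k,
      EqOn (hlog (σ :: u)) (fun p => F p + k) (V ∩ Metric.ball (τ : ℂ) r) := by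
  obtain ⟨F, hF, hF'⟩ := exists_primitive_div_sub_of_mem_logPoly D.r_pos D.notMem_Ω D.hasDerivAt
    (D.notMem_ball σ hσ) hf
  exact ⟨F, hF, D.hlog_eq_add_const hw fun p hp => by
    rw [hfu hp]; exact hF' p (D.overlap_subset hp)⟩

lemma exists_logPoly_eqOn_hlog {w : List S} (hw : w ∈ notEndingIn o) :
    ∃ n, ∃ f ∈ logPoly (τ : ℂ) r K n, EqOn (hlog w) f (V ∩ Metric.ball (τ : ℂ) r) := by
  have hconst : ∀ n (k : ℂ), (fun _ => k) ∈ logPoly (τ : ℂ) r K n := fun n k => by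
    simpa using pow_mul_mem_logPoly (K := K) (Nat.zero_le n) (analyticOnNhd_const (v := k))
  induction w with
  | nil => exact ⟨0, _, hconst 0 1, fun p _ => by rw [hlog_nil]⟩
  | cons σ u ih =>
    obtain ⟨n, f, hf, hfu⟩ := ih (tail_mem_notEndingIn hw)
    rcases eq_or_ne σ τ with rfl | hσ
    · obtain ⟨F, hF, hF'⟩ :=
        exists_primitive_div_of_mem_logPoly D.r_pos D.notMem_Ω D.hasDerivAt hf
      obtain ⟨k, hk⟩ := D.hlog_eq_add_const hw (F := F) fun p hp => by
        rw [hfu hp]; exact hF' p (D.overlap_subset hp)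
      exact ⟨n + 1, _, add_mem hF (hconst _ k), hk⟩
    · obtain ⟨F, hF, k, hk⟩ := D.exists_smallLogPoly_add_const hw hσ hf hfu
      exact ⟨n, _, add_mem (smallLogPoly_le_logPoly hF) (hconst _ k), hk⟩

lemma intervalIntegrable_integrand {σ : S} {u : List S} (hσ : σ ≠ τ) (hu : u ∈ notEndingIn o)
    {g : ℂ → ℂ} (hg : ContinuousOn g V)
    (hgu : ∀ p ∈ V ∩ Metric.ball (τ : ℂ) r, g p = hlog u p / (p - σ)) :
    IntervalIntegrable (fun s : ℝ => g (s * t)) MeasureTheory.volume 0 1 := by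
  obtain ⟨n, f, hf, hfu⟩ := D.exists_logPoly_eqOn_hlog hu
  refine intervalIntegrable_of_sqrt_mul (hg.comp (by fun_prop) D.segment_mem) ?_
  have hlim := ((isNegligible_sqrtDist D.t_pos D.K_segment).mul_logPoly D.r_pos D.toLetter_le
    (mul_mem_logPoly (analyticOnNhd_one_div_sub (D.notMem_ball σ hσ)) hf)).tendsto
  have hlim' : Tendsto (fun p => sqrtDist t p * g p) (toLetter t) (𝓝 0) := by
    refine hlim.congr' ?_
    filter_upwards [D.overlap_mem_toLetter] with p hp
    simp only [Pi.mul_apply, hgu p hp, hfu hp]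
    ring
  refine (tendsto_map'_iff.1 hlim').congr fun s => ?_
  rw [Function.comp_apply, sqrtDist_segment D.t_pos]

lemma hlog_letter_eq_of_tendsto {σ : S} {u : List S} (hw : σ :: u ∈ notEndingIn o) (hσ : σ ≠ τ)
    {k : ℂ} (hk : Tendsto (hlog (σ :: u)) (toLetter t) (𝓝 k)) : hlog (σ :: u) τ = k := by
  have hu := tail_mem_notEndingIn hw
  obtain ⟨g, hg, hgu⟩ := exists_analytic_integrand D.coe_o D.isOpen_V D.zero_mem D.notMem_V hw
    (D.analyticOnNhd_hlog hu)
  have hintegrable := D.intervalIntegrable_integrand hσ hu hg.continuousOn fun p hp =>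
    hgu p (Or.inl (D.coe_o ▸ D.ne_of_mem_right (D.overlap_subset_right hp) o))
  rw [hlog_cons_eq_integral D.coe_o hw (fun p hp => hgu p (Or.inl hp)), D.coe_τ, ← sub_zero k]
  refine intervalIntegral.integral_eq_sub_of_hasDerivAt_of_tendsto zero_lt_one
    (f := fun s : ℝ => hlog (σ :: u) (s * t)) (fun s hs => ?_) (hintegrable.const_mul _)
    (tendsto_map'_iff.1 (D.tendsto_hlog_fromZero hw (List.cons_ne_nil _ _)))
    (tendsto_map'_iff.1 hk)
  have hline : HasDerivAt (fun s : ℝ => (s : ℂ) * t) t s := by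
    simpa using (Complex.ofRealCLM.hasDerivAt (x := s)).mul_const (t : ℂ)
  have hst : (s : ℂ) * t ∈ right V :=
    ⟨D.segment_mem s (Ioo_subset_Ico_self hs), by simpa using mul_pos hs.1 D.t_pos⟩
  have hder := (D.isPrimitiveSystem_hlog.hasDerivAt hw _ hst).comp s hline
  rwa [← hgu _ (Or.inl (D.coe_o ▸ D.ne_of_mem_right hst o)), mul_comm] at hder

lemma isNegligible_hlog_sub {w : List S} (hw : w ∈ notEndingIn o)
    (hwτ : w ∈ notBeginningWith τ) :
    IsNegligible K (toLetter t) (fun p => hlog w p - hlog w τ) := by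
  rcases w with _ | ⟨σ, u⟩
  · simp only [hlog_nil, sub_self]
    exact IsNegligible.zero
  have hσ : σ ≠ τ := by simpa [notBeginningWith] using hwτ
  obtain ⟨n, f, hf, hfu⟩ := D.exists_logPoly_eqOn_hlog (tail_mem_notEndingIn hw)
  obtain ⟨F, hF, k, hk⟩ := D.exists_smallLogPoly_add_const hw hσ hf hfu
  have hsmall := D.isNegligible_of_mem_smallLogPoly hF
  have heq : (fun p => F p + k) =ᶠ[toLetter t] hlog (σ :: u) :=
    (eventuallyEq_of_mem D.overlap_mem_toLetter hk).symm
  have hlim : Tendsto (hlog (σ :: u)) (toLetter t) (𝓝 k) := by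
    simpa using (hsmall.tendsto.add_const k).congr' heq
  rw [D.hlog_letter_eq_of_tendsto hw hσ hlim]
  exact hsmall.congr' (heq.mono fun p hp => eq_sub_of_add_eq hp)

end LetterChart

lemma shuffleWords_replicate {α : Type} (a : α) (m n : ℕ) :
    shuffleWords (List.replicate m a) (List.replicate n a) =
      ((m + n).choose n : ℚ) • word (List.replicate (m + n) a) :=
  ShuffleAlgebra.of.injective <| by
    rw [ShuffleAlgebra.of_shuffleWords, map_smul]
    simp only [ShuffleAlgebra.of_replicate, divPow_mul_divPow]

section RegularizedValues

variable {S : Finset ℂ} {o τ : S} {t r : ℝ} {V Ω : Set ℂ} {K : ℂ → ℂ}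

/-- The regularized value of a hyperlogarithm at the letter `τ`. -/
def regValue (τ : S) (v : List S) : ℂ := evalLin hlog (τ : ℂ) (regularize τ (word v))

lemma regularize_word_mem_notEndingIn (D : LetterChart S o τ t r V Ω K) {v : List S}
    (hv : v ∈ notEndingIn o) :
    regularize τ (word v) ∈ Finsupp.supported ℚ ℚ (notEndingIn o) :=
  regularize_mem_notEndingIn D.letter_ne_origin (Finsupp.single_mem_supported _ _ hv)

lemma isNegligible_evalLin_regularize_sub (D : LetterChart S o τ t r V Ω K) {v : List S}
    (hv : v ∈ notEndingIn o) : IsNegligible K (toLetter t)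
      (fun p => evalLin hlog p (regularize τ (word v)) - regValue τ v) := by
  intro k
  have hword : ∀ x ∈ (regularize τ (word v)).support,
      Tendsto (fun p => K p ^ k * (hlog x p - hlog x τ)) (toLetter t) (𝓝 0) := fun x hx =>
    D.isNegligible_hlog_sub (regularize_word_mem_notEndingIn D hv hx)
      (regularize_mem_notBeginningWith τ (word v) hx) k
  refine (tendsto_evalLin (Y := fun x p => K p ^ k * (hlog x p - hlog x τ)) hword).congr
    fun p => ?_
  simp only [regValue, evalLin_apply]
  rw [← Finset.sum_sub_distrib, Finset.mul_sum]
  exact Finset.sum_congr rfl fun x _ => by ring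

lemma hlog_eq_sum_regularize (D : LetterChart S o τ t r V Ω K) {w : List S}
    (hw : w ∈ notEndingIn o) {p : ℂ} (hp : p ∈ right V) :
    hlog w p = ∑ k ∈ Finset.range (w.length + 1), K p ^ k / (k.factorial : ℂ) *
      evalLin hlog p (regularize τ ((dropHead τ)^[k] (word w))) := by
  classical
  rw [← evalLin_word hlog p w]
  conv_lhs => rw [word_eq_sum_shuffleLin_regularize τ w]
  rw [map_sum]
  refine Finset.sum_congr rfl fun k _ => ?_
  have hmem : regularize τ ((dropHead τ)^[k] (word w)) ∈
      Finsupp.supported ℚ ℚ (notEndingIn o) := by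
    rw [dropHead_iterate_word]
    split_ifs
    · exact regularize_word_mem_notEndingIn D (drop_mem_notEndingIn hw k)
    · rw [map_zero]
      exact Submodule.zero_mem _
  rw [evalLin_shuffleLin (fun u hu v hv => D.evalLin_hlog_shuffleWords u hu v hv p hp)
    (Finsupp.single_mem_supported _ _ (replicate_mem_notEndingIn D.letter_ne_origin k)) hmem,
    evalLin_word, D.hlog_replicate k hp]

end RegularizedValues

/-- Iterated primitives based at the letter `τ`, on the slit disc: the normalization at `τ` is the
shape prescribed by `IsTangential`. -/
structure IsTangentialSystem {S : Finset ℂ} (τ : S) (r : ℝ) (Ω : Set ℂ) (K : ℂ → ℂ)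
    (E : List S → ℂ → ℂ) : Prop extends IsPrimitiveSystem univ (Metric.ball (τ : ℂ) r ∩ Ω) E where
  isTangential : ∀ u, IsTangential τ r K u (E u)

namespace IsTangentialSystem

variable {S : Finset ℂ} {o τ : S} {t r : ℝ} {V Ω : Set ℂ} {K : ℂ → ℂ} {E : List S → ℂ → ℂ}

lemma _root_.Hyperlogs.LetterChart.exists_isTangentialSystem (D : LetterChart S o τ t r V Ω K) :
    ∃ E : List S → ℂ → ℂ, IsTangentialSystem τ r Ω K E := by
  obtain ⟨E, hnil, htan, hder⟩ :=
    exists_isTangential D.r_pos D.notMem_Ω D.hasDerivAt D.notMem_ball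
  exact ⟨E, ⟨⟨hnil, fun _ => hder _ _⟩, htan⟩⟩

variable (T : IsTangentialSystem τ r Ω K E)
include T

lemma apply_replicate (n : ℕ) :
    E (List.replicate n τ) = fun p => K p ^ n / (n.factorial : ℂ) := by
  rcases T.isTangential (List.replicate n τ) with ⟨-, h⟩ | ⟨h, -⟩
  · simpa using h
  · exact (h fun ρ hρ => List.eq_of_mem_replicate hρ).elim

lemma isNegligible (D : LetterChart S o τ t r V Ω K) {u : List S} (hu : ¬ ∀ ρ ∈ u, ρ = τ) :
    IsNegligible K (toLetter t) (E u) := by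
  rcases T.isTangential u with ⟨h, -⟩ | ⟨-, n, -, h⟩
  · exact (hu h).elim
  · exact D.isNegligible_of_mem_smallLogPoly h

lemma tendsto_mul (D : LetterChart S o τ t r V Ω K) {u : List S} (hu : ¬ ∀ ρ ∈ u, ρ = τ)
    (v : List S) : Tendsto (fun p => E u p * E v p) (toLetter t) (𝓝 0) := by
  by_cases hv : ∀ ρ ∈ v, ρ = τ
  · rw [List.eq_replicate_of_mem hv, T.apply_replicate]
    have hlim := (T.isNegligible D hu v.length).div_const (v.length.factorial : ℂ)
    rw [zero_div] at hlim
    exact hlim.congr fun p => by ring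
  · simpa using (T.isNegligible D hu).tendsto.mul (T.isNegligible D hv).tendsto

lemma evalLin_shuffleWords_replicate (m n : ℕ) (p : ℂ) :
    evalLin E p (shuffleWords (List.replicate m τ) (List.replicate n τ)) =
      E (List.replicate m τ) p * E (List.replicate n τ) p := by
  have hm : (m.factorial : ℂ) ≠ 0 := by exact_mod_cast m.factorial_ne_zero
  have hn : (n.factorial : ℂ) ≠ 0 := by exact_mod_cast n.factorial_ne_zero
  have hmn : ((m + n).factorial : ℂ) ≠ 0 := by exact_mod_cast (m + n).factorial_ne_zero
  simp only [shuffleWords_replicate, map_smul, evalLin_word, T.apply_replicate, Rat.smul_def,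
    Rat.cast_natCast, ← Nat.choose_symm_add, Nat.cast_add_choose ℂ, pow_add]
  field_simp

lemma evalLin_shuffleWords (D : LetterChart S o τ t r V Ω K) (u v : List S) {p : ℂ}
    (hp : p ∈ Metric.ball (τ : ℂ) r ∩ Ω) : evalLin E p (shuffleWords u v) = E u p * E v p := by
  refine T.toIsPrimitiveSystem.evalLin_shuffleWords (l := toLetter t) isShuffleClosed_univ
    (Metric.isOpen_ball.inter D.isOpen_Ω) D.preconnected
    (mem_of_superset D.overlap_mem_toLetter D.overlap_subset) ?_ u (mem_univ _) v (mem_univ _) p hp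
  rintro u - v - - -
  by_cases huv : (∀ ρ ∈ u, ρ = τ) ∧ ∀ ρ ∈ v, ρ = τ
  · rw [List.eq_replicate_of_mem huv.1, List.eq_replicate_of_mem huv.2]
    simpa only [T.evalLin_shuffleWords_replicate, sub_self] using tendsto_const_nhds
  have hprod : Tendsto (fun p => E u p * E v p) (toLetter t) (𝓝 0) := by
    by_cases hu : ∀ ρ ∈ u, ρ = τ
    · simpa only [mul_comm] using T.tendsto_mul D (fun hv => huv ⟨hu, hv⟩) u
    · exact T.tendsto_mul D hu v
  have hshuffle : Tendsto (fun p => evalLin E p (shuffleWords u v)) (toLetter t) (𝓝 0) :=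
    tendsto_evalLin fun x hx => (T.isNegligible D fun hall => huv <| by
      have hperm := perm_of_mem_support_shuffleWords u v hx
      exact ⟨fun ρ hρ => hall ρ (hperm.mem_iff.2 (List.mem_append_left v hρ)),
        fun ρ hρ => hall ρ (hperm.mem_iff.2 (List.mem_append_right u hρ))⟩).tendsto
  simpa using hprod.sub hshuffle

lemma tendsto_hlog_sub_sum (D : LetterChart S o τ t r V Ω K) {w : List S}
    (hw : w ∈ notEndingIn o) :
    Tendsto (fun p => hlog w p - ∑ k ∈ Finset.range (w.length + 1),
      E (w.take k) p * regValue τ (w.drop k)) (toLetter t) (𝓝 0) := by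
  classical
  have hterm : ∀ k ∈ Finset.range (w.length + 1), Tendsto (fun p => K p ^ k / (k.factorial : ℂ) *
      evalLin hlog p (regularize τ ((dropHead τ)^[k] (word w))) -
        E (w.take k) p * regValue τ (w.drop k)) (toLetter t) (𝓝 0) := by
    intro k hk
    rw [dropHead_iterate_word]
    split_ifs with htake
    · have hlim := (isNegligible_evalLin_regularize_sub D (drop_mem_notEndingIn hw k)
        k).div_const (k.factorial : ℂ)
      rw [zero_div] at hlim
      rw [htake, T.apply_replicate]
      exact hlim.congr fun p => by ring
    · have hne : ¬ ∀ ρ ∈ w.take k, ρ = τ := fun hall => htake <| by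
        rw [List.eq_replicate_of_mem hall, List.length_take,
          min_eq_left (Nat.lt_succ_iff.1 (Finset.mem_range.1 hk))]
      simpa using ((T.isNegligible D hne).tendsto.mul_const (regValue τ (w.drop k))).neg
  have hsum := tendsto_finsetSum _ hterm
  rw [Finset.sum_const_zero] at hsum
  refine hsum.congr' ?_
  filter_upwards [D.overlap_mem_toLetter] with p hp
  rw [hlog_eq_sum_regularize D hw (D.overlap_subset_right hp), Finset.sum_sub_distrib]

-- Both sides solve the same differential equation, and their difference tends to `0` at `τ`.
lemma hlog_eq_sum (D : LetterChart S o τ t r V Ω K) {w : List S} (hw : w ∈ notEndingIn o) :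
    EqOn (hlog w) (fun p => ∑ k ∈ Finset.range (w.length + 1),
      E (w.take k) p * regValue τ (w.drop k)) (V ∩ Metric.ball (τ : ℂ) r) := by
  induction w with
  | nil =>
    intro p _
    simp [T.nil, regValue, regularize_of_dropHead_eq_zero (dropHead_nil τ), evalLin_word, hlog_nil]
  | cons σ u ih =>
    refine eqOn_of_hasDerivAt_of_tendsto D.isOpen_overlap D.isPreconnected_overlap
      D.overlap_mem_toLetter
      (fun p hp => D.isPrimitiveSystem_hlog.hasDerivAt hw p (D.overlap_subset_right hp))
      (fun p hp => ?_) (T.tendsto_hlog_sub_sum D hw)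
    rw [ih (tail_mem_notEndingIn hw) hp]
    simp only [List.length_cons, Finset.sum_range_succ' _ (u.length + 1), List.take_succ_cons,
      List.drop_succ_cons, List.take_zero, T.nil, List.drop_zero]
    refine ((HasDerivAt.fun_sum fun k _ => (T.hasDerivAt (mem_univ (σ :: u.take k)) p
      (D.overlap_subset hp)).mul_const (regValue τ (u.drop k))).add_const _).congr_deriv ?_
    rw [Finset.sum_div]
    exact Finset.sum_congr rfl fun k _ => by ring

end IsTangentialSystem

section ContinuableSystems

variable {S : Finset ℂ} {P : Set (List S)} {a : ℂ} {Y : List S → ℂ → ℂ}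

/-- Near the point `a`, which may be a letter, the functions `Y u` for the words `u` in `P` are
analytic iterated primitives of the forms `dp / (p - σ)`. -/
structure IsPrimitiveSystemAt (P : Set (List S)) (a : ℂ) (Y : List S → ℂ → ℂ) : Prop where
  tail_mem : ∀ {σ u}, σ :: u ∈ P → u ∈ P
  nil : Y [] = fun _ => 1
  analyticAt : ∀ {u}, u ∈ P → AnalyticAt ℂ (Y u) a
  deriv_eq : ∀ {σ u}, σ :: u ∈ P →
    ∀ᶠ p : ℂ in 𝓝 a, p ≠ σ → deriv (Y (σ :: u)) p = Y u p / (p - σ)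

lemma IsPrimitiveSystemAt.exists_continuation {b c : ℝ} (hbc : b ≤ c) {γ : ℝ → ℂ}
    (hγ : ContinuousOn γ (Icc b c)) (hγS : ∀ t ∈ Ioc b c, γ t ∉ S)
    (hY : IsPrimitiveSystemAt P (γ b) Y) :
    ∃ Φ : List S → ℝ → ℂ → ℂ, (Φ [] = fun _ _ => 1) ∧
      (∀ u ∈ P, Φ u b = Y u ∧ IsContinuationOn γ (Φ u) (Icc b c)) ∧
      ∀ σ u, σ :: u ∈ P → ∀ t ∈ Ioc b c, ∀ᶠ p in 𝓝 (γ t),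
        HasDerivAt (Φ (σ :: u) t) (Φ u t p / (p - σ)) p := by
  refine exists_list_recursion
    (fun u F => u ∈ P → F b = Y u ∧ IsContinuationOn γ F (Icc b c))
    (fun σ u G F => σ :: u ∈ P → ∀ t ∈ Ioc b c, ∀ᶠ p in 𝓝 (γ t),
      HasDerivAt (F t) (G t p / (p - σ)) p) (fun _ _ => 1)
    (fun _ => ⟨hY.nil.symm, IsContinuationOn.const fun _ _ => analyticAt_const⟩) ?_
  intro σ u G hG
  by_cases h : σ :: u ∈ P
  · obtain ⟨hG0, hGc⟩ := hG (hY.tail_mem h)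
    obtain ⟨F, hF0, hFc, hF⟩ := IsContinuationOn.exists_solution hbc hγ (σ := (σ : ℂ))
      (fun t ht h' => hγS t ht (h' ▸ σ.2)) hGc (hY.analyticAt h) (by rw [hG0]; exact hY.deriv_eq h)
    exact ⟨F, fun _ => ⟨hF0, hFc⟩, fun _ => hF⟩
  · exact ⟨fun _ _ => 0, fun h' => (h h').elim, fun h' => (h h').elim⟩

/-- The germ of `f` at `a` can be continued along all paths that avoid `S` after their start. -/
def IsContinuable (S : Finset ℂ) (a : ℂ) (f : ℂ → ℂ) : Prop :=
  ∀ γ : ℝ → ℂ, ContinuousOn γ (Icc 0 1) → γ 0 = a → (∀ t ∈ Ioc (0 : ℝ) 1, γ t ∉ S) →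
    ∃ F : ℝ → ℂ → ℂ, F 0 = f ∧ IsContinuationOn γ F (Icc 0 1)

lemma IsPrimitiveSystemAt.isContinuable (hY : IsPrimitiveSystemAt P a Y) {u : List S}
    (hu : u ∈ P) : IsContinuable S a (Y u) := by
  rintro γ hγ rfl hγS
  obtain ⟨Φ, -, hΦ, -⟩ := hY.exists_continuation zero_le_one hγ hγS
  exact ⟨Φ u, hΦ u hu⟩

-- An iterated integral vanishes at the start of its path, and so do the functions `Y u`.
lemma IsPrimitiveSystemAt.exists_continuation_iterInt {δ : ℝ → ℂ}
    (hδ : ContDiffOn ℝ 1 δ (Icc 0 1)) (hδS : ∀ s ∈ Ioc (0 : ℝ) 1, δ s ∉ S)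
    (hY : IsPrimitiveSystemAt P (δ 0) Y) (hY0 : ∀ u ∈ P, u ≠ [] → Y u (δ 0) = 0) {u : List S}
    (hu : u ∈ P) : ∃ F : ℝ → ℂ → ℂ, F 0 = Y u ∧ IsContinuationOn δ F (Icc 0 1) ∧
      iterInt δ (u.map Subtype.val) 1 = F 1 (δ 1) := by
  obtain ⟨Φ, hΦnil, hΦ, hΦder⟩ := hY.exists_continuation zero_le_one hδ.continuousOn hδS
  suffices h : ∀ u ∈ P, ∀ s ∈ Icc (0 : ℝ) 1, iterInt δ (u.map Subtype.val) s = Φ u s (δ s) from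
    ⟨Φ u, (hΦ u hu).1, (hΦ u hu).2, h u hu 1 ⟨zero_le_one, le_rfl⟩⟩
  intro u
  induction u with
  | nil => intro _ s _; rw [List.map_nil, iterInt, hΦnil]
  | cons σ u ih =>
    intro hu s hs
    refine iterInt_cons_eq hδ (hΦ _ hu).2 (hΦder σ u hu) ?_ (ih (hY.tail_mem hu)) hs
    rw [(hΦ _ hu).1, hY0 _ hu (List.cons_ne_nil _ _)]

end ContinuableSystems

section

variable {S : Finset ℂ} {o τ : S} {t r : ℝ} {V Ω : Set ℂ} {K : ℂ → ℂ} {E : List S → ℂ → ℂ}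

lemma LetterChart.isContinuable_hlog (D : LetterChart S o τ t r V Ω K) {w : List S}
    (hw : w ∈ notEndingIn o) : IsContinuable S 0 (hlog w) := by
  refine IsPrimitiveSystemAt.isContinuable (P := notEndingIn o) ⟨tail_mem_notEndingIn, hlog_nil,
    fun hu => D.analyticOnNhd_hlog hu 0 D.zero_mem, fun {σ u} h => ?_⟩ hw
  filter_upwards [D.isOpen_V.mem_nhds D.zero_mem] with p hp hpσ
  exact (D.hasDerivAt_hlog h hp hpσ).deriv

namespace IsTangentialSystem

variable (T : IsTangentialSystem τ r Ω K E)
include T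

lemma mem_smallLogPoly_zero {u : List S} (hu : u ∈ notEndingIn τ) (hne : u ≠ []) :
    E u ∈ smallLogPoly (τ : ℂ) r K 0 := by
  rcases T.isTangential u with ⟨h, -⟩ | ⟨-, n, hn, hE⟩
  · exact (hne (eq_nil_of_mem_notEndingIn h hu)).elim
  · rwa [hn hu] at hE

lemma analyticOnNhd {u : List S} (hu : u ∈ notEndingIn τ) :
    AnalyticOnNhd ℂ (E u) (Metric.ball (τ : ℂ) r) := by
  rcases eq_or_ne u [] with rfl | hne
  · rw [T.nil]
    exact analyticOnNhd_const
  · exact analyticOnNhd_of_mem_logPoly_zero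
      (smallLogPoly_le_logPoly (T.mem_smallLogPoly_zero hu hne))

lemma apply_letter {u : List S} (hu : u ∈ notEndingIn τ) (hne : u ≠ []) : E u τ = 0 := by
  obtain ⟨g, -, hg⟩ := T.mem_smallLogPoly_zero hu hne
  rw [← hg, LinearMap.mulLeft_apply, Pi.mul_apply, sub_self, zero_mul]

-- The differential equation holds on the slit disc; by the identity theorem the slit does not
-- matter.
lemma deriv_eq (D : LetterChart S o τ t r V Ω K) {σ : S} {u : List S}
    (hu : σ :: u ∈ notEndingIn τ) {p : ℂ} (hp : p ∈ Metric.ball (τ : ℂ) r) (hpσ : p ≠ σ) :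
    deriv (E (σ :: u)) p = E u p / (p - σ) := by
  obtain ⟨q, hq⟩ := Filter.nonempty_of_mem D.overlap_mem_toLetter
  have hqB := D.overlap_subset hq
  have heq : EqOn (fun p => (p - σ) * deriv (E (σ :: u)) p) (E u) (Metric.ball (τ : ℂ) r) := by
    refine AnalyticOnNhd.eqOn_of_preconnected_of_eventuallyEq (𝕜 := ℂ)
      ((analyticOnNhd_id.sub analyticOnNhd_const).mul (T.analyticOnNhd hu).deriv)
      (T.analyticOnNhd (tail_mem_notEndingIn hu)) (convex_ball _ _).isPreconnected hqB.1 ?_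
    filter_upwards [D.isOpen_overlap.mem_nhds hq] with p hp
    rw [(T.hasDerivAt (mem_univ _) p (D.overlap_subset hp)).deriv,
      mul_div_cancel₀ _ (sub_ne_zero.2 (D.ne_of_mem_right (D.overlap_subset_right hp) σ))]
  rw [eq_div_iff (sub_ne_zero.2 hpσ), ← heq hp, mul_comm]

lemma isPrimitiveSystemAt (D : LetterChart S o τ t r V Ω K) :
    IsPrimitiveSystemAt (notEndingIn τ) (τ : ℂ) E where
  tail_mem := tail_mem_notEndingIn
  nil := T.nil
  analyticAt hu := T.analyticOnNhd hu _ (Metric.mem_ball_self D.r_pos)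
  deriv_eq hu := eventually_of_mem (Metric.ball_mem_nhds _ D.r_pos) fun _ hp hpσ =>
    T.deriv_eq D hu hp hpσ

lemma exists_continuation_iterInt (D : LetterChart S o τ t r V Ω K) {δ : ℝ → ℂ}
    (hδ : ContDiffOn ℝ 1 δ (Icc 0 1)) (hδ0 : δ 0 = τ) (hδS : ∀ s ∈ Ioc (0 : ℝ) 1, δ s ∉ S)
    {u : List S} (hu : u ∈ notEndingIn τ) :
    ∃ F : ℝ → ℂ → ℂ, F 0 = E u ∧ IsContinuationOn δ F (Icc 0 1) ∧
      iterInt δ (u.map Subtype.val) 1 = F 1 (δ 1) :=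
  (hδ0 ▸ T.isPrimitiveSystemAt D).exists_continuation_iterInt hδ hδS
    (fun u hu hne => by rw [hδ0, T.apply_letter hu hne]) hu

end IsTangentialSystem

end

/-! ### Homotopies of deformed segments -/

section Homotopy

/-- The paths `γ` and `γ'` are homotopic through paths from `a` to `z` that do not meet `S` after
their start. -/
def AreHomotopicOff (S : Finset ℂ) (a z : ℂ) (γ γ' : ℝ → ℂ) : Prop :=
  ∃ H : ℝ × ℝ → ℂ, ContinuousOn H (Icc 0 1 ×ˢ Icc 0 1) ∧
    (∀ t ∈ Icc (0 : ℝ) 1, H (0, t) = γ t) ∧ (∀ t ∈ Icc (0 : ℝ) 1, H (1, t) = γ' t) ∧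
    (∀ s ∈ Icc (0 : ℝ) 1, H (s, 0) = a ∧ H (s, 1) = z) ∧
    ∀ s ∈ Icc (0 : ℝ) 1, ∀ t ∈ Ioc (0 : ℝ) 1, H (s, t) ∉ S

variable {S : Finset ℂ} {a z : ℂ} {γ γ' : ℝ → ℂ}

lemma AreHomotopicOff.path (h : AreHomotopicOff S a z γ γ') :
    ContinuousOn γ (Icc 0 1) ∧ γ 0 = a ∧ γ 1 = z ∧ ∀ t ∈ Ioc (0 : ℝ) 1, γ t ∉ S := by
  obtain ⟨H, hH, hγ, -, hend, hHS⟩ := h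
  have zero_mem : (0 : ℝ) ∈ Icc (0 : ℝ) 1 := ⟨le_rfl, zero_le_one⟩
  refine ⟨?_, ?_, ?_, fun t ht => ?_⟩
  · refine ContinuousOn.congr (f := fun t => H (0, t)) ?_ fun t ht => (hγ t ht).symm
    exact hH.comp (by fun_prop) fun t ht => ⟨zero_mem, ht⟩
  · rw [← hγ 0 zero_mem, (hend 0 zero_mem).1]
  · rw [← hγ 1 ⟨zero_le_one, le_rfl⟩, (hend 0 zero_mem).2]
  · rw [← hγ t ⟨ht.1.le, ht.2⟩]
    exact hHS 0 zero_mem t ht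

lemma AreHomotopicOff.continuation_eq (h : AreHomotopicOff S a z γ γ') {f : ℂ → ℂ}
    (hf : IsContinuable S a f) {F F' : ℝ → ℂ → ℂ}
    (hF : IsContinuationOn γ F (Icc 0 1)) (hF0 : F 0 =ᶠ[𝓝 a] f)
    (hF' : IsContinuationOn γ' F' (Icc 0 1)) (hF'0 : F' 0 =ᶠ[𝓝 a] f) :
    F 1 =ᶠ[𝓝 z] F' 1 := by
  obtain ⟨H, hH, hγ, hγ', hend, hHS⟩ := h
  have zero_mem : (0 : ℝ) ∈ Icc (0 : ℝ) 1 := ⟨le_rfl, zero_le_one⟩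
  have one_mem : (1 : ℝ) ∈ Icc (0 : ℝ) 1 := ⟨zero_le_one, le_rfl⟩
  have hHs : ∀ s ∈ Icc (0 : ℝ) 1, ContinuousOn (fun t => H (s, t)) (Icc 0 1) := fun s hs =>
    hH.comp (by fun_prop) fun t ht => ⟨hs, ht⟩
  choose! Φ hΦ0 hΦ using fun s (hs : s ∈ Icc (0 : ℝ) 1) =>
    hf (fun t => H (s, t)) (hHs s hs) (hend s hs).1 (hHS s hs)
  have unique : ∀ s ∈ Icc (0 : ℝ) 1, ∀ {G : ℝ → ℂ → ℂ},
      IsContinuationOn (fun t => H (s, t)) G (Icc 0 1) → G 0 =ᶠ[𝓝 a] f →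
      G 1 =ᶠ[𝓝 z] Φ s 1 := fun s hs G hG hG0 => by
    have hstart : G 0 =ᶠ[𝓝 (H (s, 0))] Φ s 0 := by rwa [(hend s hs).1, hΦ0 s hs]
    simpa only [(hend s hs).2] using
      IsContinuationOn.unique isPreconnected_Icc (hHs s hs) hG (hΦ s hs) zero_mem hstart one_mem
  calc F 1 =ᶠ[𝓝 z] Φ 0 1 := unique 0 zero_mem (hF.congr_path hγ) hF0
    _ =ᶠ[𝓝 z] Φ 1 1 := monodromy hH (fun s hs => (hend s hs).1) (fun s hs => (hend s hs).2) hΦ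
      fun s hs => by rw [hΦ0 s hs]
    _ =ᶠ[𝓝 z] F' 1 := (unique 1 one_mem (hF'.congr_path hγ') hF'0).symm

end Homotopy

section Heights

open Classical in
/-- The sign `+1` if the real point `x` is passed above, and `-1` if it is passed below. -/
def side (above : Set ℝ) (x : ℝ) : ℝ := if x ∈ above then 1 else -1

/-- The heights `y` such that the vertical segment from the real point below or above the letter
`σ` to height `y` avoids `σ`, and `y` has the prescribed sign if `σ` is real. -/
def heightsPast (above : Set ℝ) (σ : ℂ) : Set ℝ :=
  if 0 < σ.im then Iio σ.im else if σ.im < 0 then Ioi σ.im else {y | 0 < side above σ.re * y}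

/-- The heights over the real point `x` that are on the prescribed side of all letters with real
part `x`. -/
def admissibleHeights (S : Finset ℂ) (above : Set ℝ) (x : ℝ) : Set ℝ :=
  {y | ∀ σ ∈ S, σ.re = x → y ∈ heightsPast above σ}

variable {S : Finset ℂ} {above : Set ℝ} {x y : ℝ}

lemma convex_heightsPast (above : Set ℝ) (σ : ℂ) : Convex ℝ (heightsPast above σ) := by
  unfold heightsPast
  split_ifs
  · exact convex_Iio _
  · exact convex_Ioi _
  · exact convex_halfSpace_gt (IsLinearMap.isLinearMap_smul (side above σ.re)) 0

lemma convex_admissibleHeights (S : Finset ℂ) (above : Set ℝ) (x : ℝ) :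
    Convex ℝ (admissibleHeights S above x) := fun _ hy _ hy' _ _ hc hd hcd σ hσ hre =>
  convex_heightsPast above σ (hy σ hσ hre) (hy' σ hσ hre) hc hd hcd

lemma im_notMem_heightsPast (above : Set ℝ) (σ : ℂ) : σ.im ∉ heightsPast above σ := by
  unfold heightsPast
  split_ifs with hpos hneg
  · exact self_notMem_Iio
  · exact self_notMem_Ioi
  · simp [le_antisymm (not_lt.1 hpos) (not_lt.1 hneg)]

lemma mul_mem_heightsPast {σ : ℂ} (hy : y ∈ heightsPast above σ) {s : ℝ}
    (hs : s ∈ Ioc (0 : ℝ) 1) : s * y ∈ heightsPast above σ := by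
  unfold heightsPast at hy ⊢
  obtain ⟨hs0, hs1⟩ := hs
  split_ifs at hy ⊢ with hpos hneg
  · rw [mem_Iio] at hy ⊢
    nlinarith
  · rw [mem_Ioi] at hy ⊢
    nlinarith
  · rw [mem_ofPred_eq, mul_left_comm]
    exact mul_pos hs0 hy

lemma mem_heightsPast_of_forall_ne {σ : ℂ} (hne : ∀ s ∈ Ioc (0 : ℝ) 1, s * y ≠ σ.im)
    (hreal : σ.im = 0 → 0 < side above σ.re * y) : y ∈ heightsPast above σ := by
  unfold heightsPast
  split_ifs with hpos hneg
  · refine mem_Iio.2 (lt_of_not_ge fun hle => ?_)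
    have hy : 0 < y := hpos.trans_le hle
    exact hne (σ.im / y) ⟨div_pos hpos hy, (div_le_one hy).2 hle⟩ (div_mul_cancel₀ _ hy.ne')
  · refine mem_Ioi.2 (lt_of_not_ge fun hle => ?_)
    have hy : y < 0 := hle.trans_lt hneg
    exact hne (σ.im / y) ⟨div_pos_of_neg_of_neg hneg hy, (div_le_one_of_neg hy).2 hle⟩
      (div_mul_cancel₀ _ hy.ne)
  · exact hreal (le_antisymm (not_lt.1 hpos) (not_lt.1 hneg))

lemma mk_notMem_of_mem_admissibleHeights (h : y ∈ admissibleHeights S above x) :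
    (⟨x, y⟩ : ℂ) ∉ S := fun hS =>
  im_notMem_heightsPast above ⟨x, y⟩ (h _ hS rfl)

lemma mul_mem_admissibleHeights (hy : y ∈ admissibleHeights S above x) {s : ℝ}
    (hs : s ∈ Ioc (0 : ℝ) 1) : s * y ∈ admissibleHeights S above x := fun σ hσ hre =>
  mul_mem_heightsPast (hy σ hσ hre) hs

lemma continuousOn_mk {α : Type*} [TopologicalSpace α] {X : Set α} {f g : α → ℝ}
    (hf : ContinuousOn f X) (hg : ContinuousOn g X) :
    ContinuousOn (fun x => (⟨f x, g x⟩ : ℂ)) X := by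
  simp only [Complex.mk_eq_add_mul_I]
  exact (Complex.continuous_ofReal.comp_continuousOn hf).add
    ((Complex.continuous_ofReal.comp_continuousOn hg).mul continuousOn_const)

/-- The graph of a height function, as a path in the plane that is parametrized by its real
part. -/
def graph (M : ℝ → ℝ) (x : ℝ) : ℂ := ⟨x, M x⟩

/-- Height functions over `[a, z]` whose graphs pass the letters on the prescribed sides. -/
structure IsHeight (S : Finset ℂ) (above : Set ℝ) (a z : ℝ) (M : ℝ → ℝ) : Prop where
  continuousOn : ContinuousOn M (Icc a z)
  left : M a = 0
  right : M z = 0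
  mem_admissibleHeights : ∀ x ∈ Ioc a z, M x ∈ admissibleHeights S above x

variable {a z : ℝ} {M N : ℝ → ℝ}

lemma IsHeight.continuousOn_graph (h : IsHeight S above a z M) :
    ContinuousOn (graph M) (Icc a z) := continuousOn_mk continuousOn_id h.continuousOn

lemma mapsTo_add_mul_Icc (haz : a ≤ z) :
    MapsTo (fun t => a + t * (z - a)) (Icc 0 1) (Icc a z) := fun t ht =>
  ⟨by nlinarith [ht.1], by nlinarith [ht.2]⟩

lemma mapsTo_add_mul_Ioc (haz : a < z) :
    MapsTo (fun t => a + t * (z - a)) (Ioc 0 1) (Ioc a z) := fun t ht =>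
  ⟨by nlinarith [ht.1], by nlinarith [ht.2]⟩

lemma IsHeight.areHomotopicOff (haz : a < z) (hM : IsHeight S above a z M)
    (hN : IsHeight S above a z N) :
    AreHomotopicOff S a z (fun t => graph M (a + t * (z - a)))
      (fun t => graph N (a + t * (z - a))) := by
  set x : ℝ → ℝ := fun t => a + t * (z - a) with hx
  have hxc : ContinuousOn (fun q : ℝ × ℝ => x q.2) (Icc 0 1 ×ˢ Icc 0 1) := by fun_prop
  have hxm : MapsTo (fun q : ℝ × ℝ => x q.2) (Icc 0 1 ×ˢ Icc 0 1) (Icc a z) := fun q hq =>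
    mapsTo_add_mul_Icc haz.le hq.2
  refine ⟨fun q => ⟨x q.2, (1 - q.1) * M (x q.2) + q.1 * N (x q.2)⟩, continuousOn_mk hxc ?_,
    fun t _ => by simp [graph, hx], fun t _ => by simp [graph, hx], fun s _ => ⟨?_, ?_⟩,
    fun s hs t ht => ?_⟩
  · exact (ContinuousOn.mul (by fun_prop) (hM.continuousOn.comp hxc hxm)).add
      (ContinuousOn.mul (by fun_prop) (hN.continuousOn.comp hxc hxm))
  · apply Complex.ext <;> simp [hx, hM.left, hN.left]
  · apply Complex.ext <;> simp [hx, hM.right, hN.right]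
  · have hxt := mapsTo_add_mul_Ioc haz ht
    exact mk_notMem_of_mem_admissibleHeights
      (convex_admissibleHeights S above _ (hM.mem_admissibleHeights _ hxt)
        (hN.mem_admissibleHeights _ hxt) (sub_nonneg.2 hs.2) hs.1 (sub_add_cancel 1 s))

lemma isHeight_comp_of_forall_notMem (haz : a < z) {h : ℝ → ℝ} (hc : ContinuousOn h (Icc 0 1))
    (h0 : h 0 = 0) (h1 : h 1 = 0)
    (hS : ∀ s ∈ Ioc (0 : ℝ) 1, ∀ t ∈ Ioc (0 : ℝ) 1, (⟨a + t * (z - a), s * h t⟩ : ℂ) ∉ S)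
    (hside : ∀ t ∈ Ioo (0 : ℝ) 1, ((a + t * (z - a) : ℝ) : ℂ) ∈ S →
      (a + t * (z - a) ∈ above → 0 < h t) ∧ (a + t * (z - a) ∉ above → h t < 0)) :
    IsHeight S above a z (fun x => h ((x - a) / (z - a))) := by
  have hza : 0 < z - a := sub_pos.2 haz
  refine ⟨?_, by simp [h0], by simp [div_self hza.ne', h1], fun x hx σ hσ hre => ?_⟩
  · refine hc.comp (by fun_prop) fun x hx => ⟨div_nonneg (sub_nonneg.2 hx.1) hza.le, ?_⟩
    rw [div_le_one hza]
    linarith [hx.2]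
  set t := (x - a) / (z - a) with ht
  have hxt : a + t * (z - a) = x := by rw [ht, div_mul_cancel₀ _ hza.ne', add_sub_cancel]
  have ht0 : 0 < t := div_pos (sub_pos.2 hx.1) hza
  have ht1 : t ≤ 1 := by rw [ht, div_le_one hza]; linarith [hx.2]
  have hne : ∀ s ∈ Ioc (0 : ℝ) 1, s * h t ≠ σ.im := fun s hs he => by
    have hmem := hS s hs t ⟨ht0, ht1⟩
    rw [hxt, he, ← hre] at hmem
    exact hmem hσ
  refine mem_heightsPast_of_forall_ne hne fun him => ?_
  have ht1' : t ≠ 1 := by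
    intro he
    refine hne 1 ⟨zero_lt_one, le_rfl⟩ ?_
    rw [he, h1, him, mul_zero]
  have hmem : ((a + t * (z - a) : ℝ) : ℂ) ∈ S := by
    convert hσ using 1
    apply Complex.ext <;> simp [hxt, hre, him]
  obtain ⟨habove, hbelow⟩ := hside t ⟨ht0, lt_of_le_of_ne ht1 ht1'⟩ hmem
  rw [hxt] at habove hbelow
  rw [hre, side]
  split_ifs with hxa
  · simpa using habove hxa
  · simpa using hbelow hxa

lemma IsDeformedSegment.exists_height (haz : a < z) {γ : ℝ → ℂ}
    (hγ : IsDeformedSegment S above a z γ) :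
    ∃ M, IsHeight S above a z M ∧
      AreHomotopicOff S a z γ (fun t => graph M (a + t * (z - a))) := by
  obtain ⟨h, H, hc, h0, h1, hS, hside, hH, hHγ, hHh, hHe, hHS⟩ := hγ
  refine ⟨_, isHeight_comp_of_forall_notMem haz hc h0 h1 hS hside, H, hH, hHγ, fun t ht => ?_,
    hHe, hHS⟩
  simp only [hHh t ht, graph, add_sub_cancel_left, mul_div_cancel_right₀ _ (sub_pos.2 haz).ne']

-- All graphs of height functions with the same sides are homotopic, by convexity.
lemma IsDeformedSegment.continuation_eq (haz : a < z) {γ : ℝ → ℂ}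
    (hγ : IsDeformedSegment S above a z γ) {f : ℂ → ℂ} (hf : IsContinuable S a f)
    {F : ℝ → ℂ → ℂ} (hF : IsContinuationOn γ F (Icc 0 1)) (hF0 : F 0 =ᶠ[𝓝 (a : ℂ)] f)
    (hN : IsHeight S above a z N) {Φ : ℝ → ℂ → ℂ}
    (hΦ : IsContinuationOn (graph N) Φ (Icc a z)) (hΦa : Φ a =ᶠ[𝓝 (a : ℂ)] f) :
    F 1 =ᶠ[𝓝 (z : ℂ)] Φ z := by
  obtain ⟨M, hM, hγM⟩ := hγ.exists_height haz
  obtain ⟨hMc, hM0, -, hMS⟩ := (hM.areHomotopicOff haz hN).path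
  obtain ⟨G, hG0, hG⟩ := hf _ hMc hM0 hMS
  have hΦ' : IsContinuationOn (fun t => graph N (a + t * (z - a)))
      (fun t => Φ (a + t * (z - a))) (Icc 0 1) :=
    hΦ.comp (by fun_prop) (mapsTo_add_mul_Icc haz.le)
  refine (hγM.continuation_eq hf hF hF0 hG (by rw [hG0])).trans ?_
  simpa using (hM.areHomotopicOff haz hN).continuation_eq hf hG (by rw [hG0]) hΦ'
    (by simpa using hΦa)

end Heights

section Merging

variable {S : Finset ℂ} {above : Set ℝ} {a z : ℝ} {M N : ℝ → ℝ}

lemma IsHeight.exists_mul_lt (hM : IsHeight S above a z M) {ρ : ℝ} (hρ : 0 < ρ) :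
    ∃ ε ∈ Ioc (0 : ℝ) 1, ∀ x ∈ Icc a z, |ε * M x| < ρ := by
  obtain ⟨C, hC⟩ := isCompact_Icc.exists_bound_of_continuousOn hM.continuousOn
  have hC' : 0 < |C| + 1 := by positivity
  refine ⟨min 1 (ρ / (|C| + 1)), ⟨lt_min one_pos (div_pos hρ hC'), min_le_left _ _⟩,
    fun x hx => ?_⟩
  have hε : 0 ≤ min 1 (ρ / (|C| + 1)) := le_min zero_le_one (div_pos hρ hC').le
  have hMx : |M x| < |C| + 1 := ((hC x hx).trans (le_abs_self C)).trans_lt (lt_add_one _)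
  calc |min 1 (ρ / (|C| + 1)) * M x|
      = min 1 (ρ / (|C| + 1)) * |M x| := by rw [abs_mul, abs_of_nonneg hε]
    _ ≤ ρ / (|C| + 1) * |M x| := mul_le_mul_of_nonneg_right (min_le_right _ _) (abs_nonneg _)
    _ < ρ / (|C| + 1) * (|C| + 1) := mul_lt_mul_of_pos_left hMx (div_pos hρ hC')
    _ = ρ := div_mul_cancel₀ _ hC'.ne'

lemma exists_continuous_cutoff {t b : ℝ} (htb : t < b) :
    ∃ χ : ℝ → ℝ, Continuous χ ∧ (∀ x, χ x ∈ Icc (0 : ℝ) 1) ∧ (∀ x ≤ t, χ x = 0) ∧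
      ∀ x, b ≤ x → χ x = 1 := by
  have hbt : 0 < b - t := sub_pos.2 htb
  refine ⟨fun x => (projIcc (0 : ℝ) 1 zero_le_one ((x - t) / (b - t)) : ℝ),
    continuous_subtype_val.comp (continuous_projIcc.comp (by fun_prop)), fun x => Subtype.prop _,
    fun x hx => ?_, fun x hx => ?_⟩
  · exact congrArg Subtype.val
      (projIcc_of_le_left _ (div_nonpos_of_nonpos_of_nonneg (sub_nonpos.2 hx) hbt.le))
  · exact congrArg Subtype.val
      (projIcc_of_right_le _ ((one_le_div hbt).2 (sub_le_sub_right hx t)))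

-- The merged function is a convex combination of `N` and a small multiple of `M`.
lemma IsHeight.exists_merge {t b : ℝ} (hat : a < t) (htb : t < b) (hbz : b ≤ z)
    (hM : IsHeight S above a z M) (hN : IsHeight S above t z N) {ρ : ℝ} (hρ : 0 < ρ) :
    ∃ m : ℝ → ℝ, IsHeight S above a z m ∧ EqOn m N (Icc b z) ∧ (∀ x ∈ Icc a t, |m x| < ρ) ∧
      ∀ x ∈ Icc t b, ∃ y, |y| < ρ ∧ m x ∈ segment ℝ y (N x) := by
  obtain ⟨ε, hε, hsmall⟩ := hM.exists_mul_lt hρ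
  obtain ⟨χ, hχc, hχI, hχ0, hχ1⟩ := exists_continuous_cutoff htb
  have htz : t ≤ z := htb.le.trans hbz
  refine ⟨fun x => (1 - χ x) * (ε * M x) + χ x * N (max x t), ⟨?_, ?_, ?_, fun x hx => ?_⟩,
    fun x hx => ?_, fun x hx => ?_, fun x hx => ⟨ε * M x, hsmall x ?_, 1 - χ x, χ x, ?_⟩⟩
  · have hNmax : ContinuousOn (fun x => N (max x t)) (Icc a z) :=
      hN.continuousOn.comp (by fun_prop) fun x hx => ⟨le_max_right _ _, max_le hx.2 htz⟩
    exact ((continuous_const.sub hχc).continuousOn.mul (continuousOn_const.mul hM.continuousOn)).add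
      (hχc.continuousOn.mul hNmax)
  · simp [hχ0 a hat.le, hM.left]
  · simp [hχ1 z hbz, max_eq_left htz, hN.right]
  · have hεM := mul_mem_admissibleHeights (hM.mem_admissibleHeights x hx) hε
    rcases le_or_gt x t with hxt | hxt
    · simpa [hχ0 x hxt] using hεM
    · rw [max_eq_left hxt.le]
      exact convex_admissibleHeights S above x hεM (hN.mem_admissibleHeights x ⟨hxt, hx.2⟩)
        (sub_nonneg.2 (hχI x).2) (hχI x).1 (sub_add_cancel 1 _)
  · simp [hχ1 x hx.1, max_eq_left (htb.le.trans hx.1)]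
  · simpa [hχ0 x hx.2] using hsmall x ⟨hx.1, hx.2.trans htz⟩
  · exact ⟨hat.le.trans hx.1, hx.2.trans hbz⟩
  · simp [max_eq_left hx.1, (hχI x).1, (hχI x).2]

lemma IsHeight.exists_initial_lt {t r : ℝ} (htz : t < z) (hr : 0 < r)
    (hN : IsHeight S above t z N) :
    ∃ b ∈ Ioo t z, b ≤ t + r ∧ ∀ x ∈ Icc t b, |N x| < r := by
  have hlim : Tendsto N (𝓝[≥] t) (𝓝 0) := by
    have hcont := hN.continuousOn t ⟨le_rfl, htz.le⟩
    rwa [ContinuousWithinAt, hN.left, nhdsWithin_Icc_eq_nhdsGE htz] at hcont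
  have hsmall : ∀ᶠ x in 𝓝[≥] t, |N x| < r := by
    simpa using hlim.eventually (Metric.ball_mem_nhds 0 hr)
  obtain ⟨e, hte, he⟩ := (mem_nhdsGE_iff_exists_Ico_subset' htz).1 hsmall
  obtain ⟨b, htb, hb⟩ := exists_between (lt_min (lt_min hte htz) (lt_add_of_pos_right t hr))
  obtain ⟨hbez, hbr⟩ := lt_min_iff.1 hb
  obtain ⟨hbe, hbz⟩ := lt_min_iff.1 hbez
  exact ⟨b, ⟨htb, hbz⟩, hbr.le, fun x hx => he ⟨hx.1, hx.2.trans_lt hbe⟩⟩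

end Merging

/-! ### The cut plane -/

section CutPlane

/-- The plane without the vertical ray that starts at `t` and leaves to the side on which `t` is
not passed. -/
def cutPlane (above : Set ℝ) (t : ℝ) : Set ℂ := {p | 0 < side above t * p.im ∨ p.re ≠ t}

/-- The branch of `log (1 - p / t)` on the cut plane that vanishes at `0`. -/
def cutLog (above : Set ℝ) (t : ℝ) (p : ℂ) : ℂ :=
  Complex.log (side above t * Complex.I * (1 - p / t)) - Complex.log (side above t * Complex.I)

variable {above : Set ℝ} {t r : ℝ}

lemma side_eq_one_or (above : Set ℝ) (t : ℝ) : side above t = 1 ∨ side above t = -1 := by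
  unfold side
  split_ifs <;> simp

lemma abs_side (above : Set ℝ) (t : ℝ) : |side above t| = 1 :=
  (abs_eq zero_le_one).2 (side_eq_one_or above t)

lemma side_mul_self (above : Set ℝ) (t : ℝ) : side above t * side above t = 1 := by
  rw [← abs_mul_abs_self, abs_side, one_mul]

lemma side_ne_zero (above : Set ℝ) (t : ℝ) : side above t ≠ 0 := by
  rw [← abs_ne_zero, abs_side]
  exact one_ne_zero

lemma side_mul_I_ne_zero (above : Set ℝ) (t : ℝ) : (side above t : ℂ) * Complex.I ≠ 0 :=
  mul_ne_zero (Complex.ofReal_ne_zero.2 (side_ne_zero above t)) Complex.I_ne_zero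

lemma side_mul_I_mul_mem_slitPlane (ht : 0 < t) {p : ℂ} (hp : p ∈ cutPlane above t) :
    (side above t : ℂ) * Complex.I * (1 - p / t) ∈ Complex.slitPlane := by
  have hcoord : (side above t : ℂ) * Complex.I * (1 - p / t) =
      ⟨side above t * p.im / t, side above t * (1 - p.re / t)⟩ := by
    apply Complex.ext <;> simp [Complex.div_ofReal_re, Complex.div_ofReal_im, mul_div_assoc]
  rw [hcoord, Complex.mem_slitPlane_iff]
  rcases hp with him | hre
  · exact Or.inl (div_pos him ht)
  · refine Or.inr (mul_ne_zero (side_ne_zero _ _) (sub_ne_zero.2 fun h => hre ?_))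
    exact (div_eq_one_iff_eq ht.ne').1 h.symm

lemma notMem_cutPlane (above : Set ℝ) (t : ℝ) : (t : ℂ) ∉ cutPlane above t := by
  rintro (h | h) <;> simp at h

lemma isOpen_cutPlane (above : Set ℝ) (t : ℝ) : IsOpen (cutPlane above t) :=
  (isOpen_lt continuous_const (continuous_const.mul Complex.continuous_im)).union
    (isOpen_ne_fun Complex.continuous_re continuous_const)

lemma hasDerivAt_cutLog (ht : 0 < t) {p : ℂ} (hp : p ∈ cutPlane above t) :
    HasDerivAt (cutLog above t) (1 / (p - t)) p := by
  have ht' : (t : ℂ) ≠ 0 := Complex.ofReal_ne_zero.2 ht.ne'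
  have hpt : p - t ≠ 0 := sub_ne_zero.2 fun h => notMem_cutPlane above t (h ▸ hp)
  have hinner : HasDerivAt (fun p : ℂ => (side above t : ℂ) * Complex.I * (1 - p / t))
      ((side above t : ℂ) * Complex.I * (-(1 / t))) p :=
    (((hasDerivAt_id p).div_const (t : ℂ)).const_sub 1).const_mul _
  refine ((hinner.clog (side_mul_I_mul_mem_slitPlane ht hp)).sub_const _).congr_deriv ?_
  have hfactor : (1 : ℂ) - p / t = -(p - t) / t := by field_simp; ring
  rw [mul_div_mul_left _ _ (side_mul_I_ne_zero above t), hfactor]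
  field_simp

lemma cutLog_of_lt (ht : 0 < t) {s : ℝ} (hs : s < 1) :
    cutLog above t ((s : ℂ) * t) = (Real.log (1 - s) : ℂ) := by
  have ht' : (t : ℂ) ≠ 0 := Complex.ofReal_ne_zero.2 ht.ne'
  rw [cutLog, mul_div_cancel_right₀ _ ht', mul_comm, ← Complex.ofReal_one, ← Complex.ofReal_sub,
    Complex.log_ofReal_mul (sub_pos.2 hs) (side_mul_I_ne_zero above t), add_sub_cancel_right]

-- Here the two logarithms of `±I` contribute `∓ I * π`.
lemma cutLog_of_gt (ht : 0 < t) {z : ℝ} (hz : t < z) :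
    cutLog above t z = branchValue above t z := by
  have ht' : (t : ℂ) ≠ 0 := Complex.ofReal_ne_zero.2 ht.ne'
  have harg : (side above t : ℂ) * Complex.I * (1 - z / t) =
      (((z - t) / t : ℝ) : ℂ) * (-(side above t * Complex.I)) := by
    push_cast
    field_simp
    ring
  rw [cutLog, harg, Complex.log_ofReal_mul (div_pos (sub_pos.2 hz) ht)
    (neg_ne_zero.2 (side_mul_I_ne_zero above t)), branchValue]
  unfold side
  split_ifs
  · simp only [Complex.ofReal_one, one_mul, Complex.log_neg_I, Complex.log_I]
    ring
  · simp only [Complex.ofReal_neg, Complex.ofReal_one, one_mul, neg_mul, neg_neg,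
      Complex.log_neg_I, Complex.log_I]
    ring

lemma starConvex_cutPlane (above : Set ℝ) (t : ℝ) {r : ℝ} (hr : 0 < r) :
    StarConvex ℝ (⟨t, side above t * r⟩ : ℂ) (cutPlane above t) := by
  intro p hp a b ha hb hab
  have him : side above t * (a • (⟨t, side above t * r⟩ : ℂ) + b • p).im =
      a * r + b * (side above t * p.im) := by
    simp only [Complex.add_im, Complex.smul_im, smul_eq_mul]
    linear_combination a * r * side_mul_self above t
  have hre : (a • (⟨t, side above t * r⟩ : ℂ) + b • p).re - t = b * (p.re - t) := by
    simp only [Complex.add_re, Complex.smul_re, smul_eq_mul]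
    linear_combination t * hab
  rcases hb.eq_or_lt with rfl | hb
  · refine Or.inl ?_
    rw [him, zero_mul, add_zero, ← add_zero a, hab, one_mul]
    exact hr
  rcases hp with hp | hp
  · exact Or.inl (him ▸ add_pos_of_nonneg_of_pos (mul_nonneg ha hr.le) (mul_pos hb hp))
  · exact Or.inr (sub_ne_zero.1 (hre ▸ mul_ne_zero hb.ne' (sub_ne_zero.2 hp)))

lemma isPreconnected_ball_inter_cutPlane (above : Set ℝ) (t : ℝ) (hr : 0 < r) :
    IsPreconnected (Metric.ball (t : ℂ) r ∩ cutPlane above t) := by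
  set c : ℂ := ⟨t, side above t * (r / 2)⟩ with hc
  have hct : c - t = ((side above t * (r / 2) : ℝ) : ℂ) * Complex.I := by
    apply Complex.ext <;> simp [hc]
  have hcb : c ∈ Metric.ball (t : ℂ) r := by
    rw [mem_ball_iff_norm, hct, norm_mul, Complex.norm_I, mul_one, Complex.norm_real,
      Real.norm_eq_abs, abs_mul, abs_side, one_mul, abs_of_pos (half_pos hr)]
    exact half_lt_self hr
  have hcp : c ∈ cutPlane above t := Or.inl (by
    rw [hc, ← mul_assoc, side_mul_self, one_mul]
    exact half_pos hr)
  exact ((((convex_ball _ _).starConvex hcb).inter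
    (starConvex_cutPlane above t (half_pos hr))).isPathConnected
      ⟨hcb, hcp⟩).isConnected.isPreconnected

lemma mk_mem_cutPlane {S : Finset ℂ} (htS : (t : ℂ) ∈ S) {x y : ℝ}
    (h : y ∈ admissibleHeights S above x) : (⟨x, y⟩ : ℂ) ∈ cutPlane above t := by
  rcases eq_or_ne x t with rfl | hx
  · left
    simpa [heightsPast] using h _ htS (Complex.ofReal_re _)
  · exact Or.inr hx

end CutPlane

section Cone

/-- The union of the discs around the points of `[0, t)` whose radii decrease linearly from `r`
at `0` to `0` at `t`. -/
def cone (t r : ℝ) : Set ℂ := {p | ∃ s ∈ Ico (0 : ℝ) 1, ‖p - s * t‖ < (1 - s) * r}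

variable {t r : ℝ}

lemma isOpen_cone (t r : ℝ) : IsOpen (cone t r) := by
  have hunion : cone t r = ⋃ s ∈ Ico (0 : ℝ) 1, {p : ℂ | ‖p - s * t‖ < (1 - s) * r} := by
    ext p
    simp [cone]
  rw [hunion]
  exact isOpen_biUnion fun s _ => isOpen_lt (by fun_prop) continuous_const

lemma convex_cone (t r : ℝ) : Convex ℝ (cone t r) := by
  rintro p ⟨s, hs, hp⟩ p' ⟨s', hs', hp'⟩ a b ha hb hab
  refine ⟨a * s + b * s', convex_Ico 0 1 hs hs' ha hb hab, ?_⟩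
  have hsplit : a • p + b • p' - ((a * s + b * s' : ℝ) : ℂ) * t =
      a • (p - s * t) + b • (p' - s' * t) := by
    simp only [Complex.real_smul]
    push_cast
    ring
  have hlt : a * (‖p - s * t‖ - (1 - s) * r) + b * (‖p' - s' * t‖ - (1 - s') * r) < 0 :=
    convex_Iio 0 (sub_neg.2 hp) (sub_neg.2 hp') ha hb hab
  calc ‖a • p + b • p' - ((a * s + b * s' : ℝ) : ℂ) * t‖
      ≤ ‖a • (p - s * t)‖ + ‖b • (p' - s' * t)‖ := hsplit ▸ norm_add_le _ _
    _ = a * ‖p - s * t‖ + b * ‖p' - s' * t‖ := by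
      rw [norm_smul, norm_smul, Real.norm_of_nonneg ha, Real.norm_of_nonneg hb]
    _ < a * ((1 - s) * r) + b * ((1 - s') * r) := by linarith
    _ = (1 - (a * s + b * s')) * r := by linear_combination r * hab

lemma mul_mem_cone (t : ℝ) (hr : 0 < r) {s : ℝ} (hs : s ∈ Ico (0 : ℝ) 1) :
    (s : ℂ) * t ∈ cone t r :=
  ⟨s, hs, by rw [sub_self, norm_zero]; exact mul_pos (sub_pos.2 hs.2) hr⟩

lemma re_lt_of_mem_cone (hrt : r ≤ t) {p : ℂ} (hp : p ∈ cone t r) : p.re < t := by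
  obtain ⟨s, hs, hp⟩ := hp
  have hre := (Complex.re_le_norm _).trans_lt hp
  rw [Complex.sub_re, ← Complex.ofReal_mul, Complex.ofReal_re] at hre
  nlinarith [hs.2]

lemma mk_mem_cone (ht : 0 < t) (hr : 0 < r) {c x y : ℝ} (hx : x ∈ Icc 0 c) (hc : c < t)
    (hy : |y| < (1 - c / t) * r) : (⟨x, y⟩ : ℂ) ∈ cone t r := by
  have hxc : x / t ≤ c / t := div_le_div_of_nonneg_right hx.2 ht.le
  refine ⟨x / t, ⟨div_nonneg hx.1 ht.le, hxc.trans_lt ((div_lt_one ht).2 hc)⟩, ?_⟩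
  have hxy : (⟨x, y⟩ : ℂ) - ((x / t : ℝ) : ℂ) * t = (y : ℂ) * Complex.I := by
    rw [← Complex.ofReal_mul, div_mul_cancel₀ _ ht.ne']
    apply Complex.ext <;> simp
  rw [hxy, norm_mul, Complex.norm_I, mul_one, Complex.norm_real, Real.norm_eq_abs]
  exact hy.trans_le (mul_le_mul_of_nonneg_right (sub_le_sub_left hxc 1) hr.le)

lemma mk_mem_ball {x y : ℝ} (hx : |x - t| ≤ r / 2) (hy : |y| < r / 2) :
    (⟨x, y⟩ : ℂ) ∈ Metric.ball (t : ℂ) r := by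
  rw [mem_ball_iff_norm]
  refine (Complex.norm_le_abs_re_add_abs_im _).trans_lt ?_
  simp only [Complex.sub_re, Complex.sub_im, Complex.ofReal_re, Complex.ofReal_im, sub_zero]
  linarith

variable {S : Finset ℂ}

lemma exists_pos_le_norm_sub_segment (ht : IsLeast {x : ℝ | (x : ℂ) ∈ S ∧ 0 < x} t) {σ : ℂ}
    (hσ : σ ∈ S) (hσ0 : σ ≠ 0) (hσt : σ ≠ t) :
    ∃ c > 0, ∀ s ∈ Icc (0 : ℝ) 1, c ≤ ‖σ - s * t‖ := by
  have hpos : ∀ s ∈ Icc (0 : ℝ) 1, 0 < ‖σ - s * t‖ := by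
    intro s hs
    rw [norm_pos_iff, sub_ne_zero]
    intro h
    have hs0 : 0 < s := lt_of_le_of_ne hs.1 fun h' => hσ0 (by rw [h, ← h']; simp)
    have hle : t ≤ s * t := ht.2 ⟨by push_cast; rw [← h]; exact hσ, mul_pos hs0 ht.1.2⟩
    have hs1 : s = 1 := le_antisymm hs.2 (by nlinarith [ht.1.2])
    exact hσt (by rw [h, hs1]; simp)
  exact isCompact_Icc.exists_forall_le' (f := fun s : ℝ => ‖σ - s * t‖) (by fun_prop) hpos

lemma exists_radius (ht : IsLeast {x : ℝ | (x : ℂ) ∈ S ∧ 0 < x} t) :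
    ∃ r ∈ Ioc 0 t, ∀ σ ∈ S, σ ≠ 0 → σ ≠ t → ∀ s ∈ Icc (0 : ℝ) 1, r ≤ ‖σ - s * t‖ := by
  have hsmall : ∀ σ ∈ S, ∀ᶠ r in 𝓝[>] (0 : ℝ), σ ≠ 0 → σ ≠ t →
      ∀ s ∈ Icc (0 : ℝ) 1, r ≤ ‖σ - s * t‖ := by
    intro σ hσ
    by_cases h : σ ≠ 0 ∧ σ ≠ t
    · obtain ⟨c, hc, hle⟩ := exists_pos_le_norm_sub_segment ht hσ h.1 h.2
      filter_upwards [Ioc_mem_nhdsGT hc] with r hr _ _ s hs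
      exact hr.2.trans (hle s hs)
    · exact .of_forall fun _ h0 ht => (h ⟨h0, ht⟩).elim
  obtain ⟨r, hrS, hr⟩ := (((eventually_all_finset S).2 hsmall).and (Ioc_mem_nhdsGT ht.1.2)).exists
  exact ⟨r, hr, hrS⟩

lemma letterChart_cone (h0 : (0 : ℂ) ∈ S) (ht : (t : ℂ) ∈ S) (hr : r ∈ Ioc 0 t)
    (hS : ∀ σ ∈ S, σ ≠ 0 → σ ≠ t → ∀ s ∈ Icc (0 : ℝ) 1, r ≤ ‖σ - s * t‖) (above : Set ℝ) :
    LetterChart S ⟨0, h0⟩ ⟨t, ht⟩ t (r / 2) (cone t r) (cutPlane above t) (cutLog above t) where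
  coe_o := rfl
  coe_τ := rfl
  t_pos := hr.1.trans_le hr.2
  r_pos := half_pos hr.1
  r_lt := by linarith [hr.1, hr.2]
  isOpen_V := isOpen_cone t r
  convex_V := convex_cone t r
  zero_mem := by simpa using mul_mem_cone t hr.1 (s := 0) ⟨le_rfl, zero_lt_one⟩
  notMem_V σ hσ hV := by
    by_cases hσt : (σ : ℂ) = t
    · exact (re_lt_of_mem_cone hr.2 hV).ne (by rw [hσt, Complex.ofReal_re])
    · obtain ⟨s, hs, h⟩ := hV
      have hle := hS σ σ.2 (fun h' => hσ (Subtype.ext h')) hσt s ⟨hs.1, hs.2.le⟩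
      nlinarith [hs.1, hr.1]
  segment_mem s hs := mul_mem_cone t hr.1 hs
  notMem_ball σ hσ h := by
    rw [mem_ball_iff_norm] at h
    by_cases hσ0 : (σ : ℂ) = 0
    · rw [hσ0, zero_sub, norm_neg, Complex.norm_real] at h
      linarith [Real.le_norm_self t, hr.1, hr.2]
    · have hle := hS σ σ.2 hσ0 (fun h' => hσ (Subtype.ext h')) 1 ⟨zero_le_one, le_rfl⟩
      rw [Complex.ofReal_one, one_mul] at hle
      linarith [hr.1]
  isOpen_Ω := isOpen_cutPlane above t
  V_subset p hp := Or.inr (re_lt_of_mem_cone hr.2 hp).ne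
  notMem_Ω := notMem_cutPlane above t
  hasDerivAt p hp := hasDerivAt_cutLog (hr.1.trans_le hr.2) hp
  K_segment s hs := cutLog_of_lt (hr.1.trans_le hr.2) hs.2
  preconnected := isPreconnected_ball_inter_cutPlane above t (half_pos hr.1)

end Cone

/-! ### Connection between the two base points -/

section ContinuedSystems

variable {S : Finset ℂ} {P : Set (List S)} {U : Set ℂ} {Y : List S → ℂ → ℂ}

lemma IsPrimitiveSystem.isPrimitiveSystemAt (hY : IsPrimitiveSystem P U Y)
    (htail : ∀ {σ u}, σ :: u ∈ P → u ∈ P) (hU : IsOpen U) {a : ℂ} (ha : a ∈ U) :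
    IsPrimitiveSystemAt P a Y where
  tail_mem := htail
  nil := hY.nil
  analyticAt {u} hu := by
    cases u with
    | nil => exact hY.nil ▸ analyticAt_const
    | cons σ u =>
      exact DifferentiableOn.analyticAt (fun p hp =>
        (hY.hasDerivAt hu p hp).differentiableAt.differentiableWithinAt) (hU.mem_nhds ha)
  deriv_eq hu := by
    filter_upwards [hU.mem_nhds ha] with p hp _
    exact (hY.hasDerivAt hu p hp).deriv

/-- The functions `Φ u x`, for `x` in `[b, c]`, continue the functions `Y u` along the path `γ`,
for all words `u`. -/
structure IsContinuedSystem (γ : ℝ → ℂ) (b c : ℝ) (Y : List S → ℂ → ℂ)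
    (Φ : List S → ℝ → ℂ → ℂ) : Prop where
  start : ∀ u, Φ u b = Y u
  isContinuationOn : ∀ u, IsContinuationOn γ (Φ u) (Icc b c)

variable {γ : ℝ → ℂ} {b c : ℝ} {Φ : List S → ℝ → ℂ → ℂ}

lemma IsPrimitiveSystem.exists_isContinuedSystem (hY : IsPrimitiveSystem univ U Y) (hU : IsOpen U)
    (hbc : b ≤ c) (hγ : ContinuousOn γ (Icc b c)) (hγS : ∀ x ∈ Ioc b c, γ x ∉ S)
    (hγb : γ b ∈ U) : ∃ Φ : List S → ℝ → ℂ → ℂ, IsContinuedSystem γ b c Y Φ := by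
  obtain ⟨Φ, -, hΦ, -⟩ := (hY.isPrimitiveSystemAt (fun _ => mem_univ _) hU hγb).exists_continuation
    hbc hγ hγS
  exact ⟨Φ, fun u => (hΦ u (mem_univ u)).1, fun u => (hΦ u (mem_univ u)).2⟩

namespace IsContinuedSystem

variable (hΦ : IsContinuedSystem γ b c Y Φ) (hbc : b ≤ c) (hγ : ContinuousOn γ (Icc b c))
include hΦ hbc hγ

lemma evalLin_shuffleWords {u v : List S}
    (h : ∀ᶠ p in 𝓝 (γ b), evalLin Y p (shuffleWords u v) = Y u p * Y v p) :
    evalLin (fun u => Φ u c) (γ c) (shuffleWords u v) = Φ u c (γ c) * Φ v c (γ c) := by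
  have hshuffle : IsContinuationOn γ (fun x p => ∑ w ∈ (shuffleWords u v).support,
      ((shuffleWords u v w : ℚ) : ℂ) * Φ w x p) (Icc b c) :=
    IsContinuationOn.sum _ fun w _ => (hΦ.isContinuationOn w).const_mul _
  have key := IsContinuationOn.unique isPreconnected_Icc hγ hshuffle
    ((hΦ.isContinuationOn u).mul (hΦ.isContinuationOn v)) (left_mem_Icc.2 hbc)
    (by simpa only [hΦ.start, EventuallyEq, evalLin_apply] using h) (right_mem_Icc.2 hbc)
  rw [evalLin_apply]
  exact key.self_of_nhds

lemma apply_eq {u : List S} {f : ℂ → ℂ} (hf : ∀ x ∈ Icc b c, AnalyticAt ℂ f (γ x)) (h : Y u = f) :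
    Φ u c (γ c) = f (γ c) :=
  (IsContinuationOn.unique isPreconnected_Icc hγ (hΦ.isContinuationOn u) (IsContinuationOn.const hf)
    (left_mem_Icc.2 hbc) (by rw [hΦ.start, h]) (right_mem_Icc.2 hbc)).self_of_nhds

end IsContinuedSystem

end ContinuedSystems

section Connection

variable {S : Finset ℂ} {o τ : S} {t r : ℝ} {V Ω : Set ℂ} {K : ℂ → ℂ} {E : List S → ℂ → ℂ}
  {above : Set ℝ} {z b : ℝ} {M N : ℝ → ℝ} {Φ : List S → ℝ → ℂ → ℂ}

lemma graph_of_right (hN : IsHeight S above t z N) : graph N z = z := by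
  rw [graph, hN.right]
  rfl

lemma IsHeight.exists_merge_near_letter (ht : (t : ℂ) ∈ S) (hr : r ∈ Ioc 0 t) (hb : b ∈ Ioo t z)
    (hbr : b ≤ t + r / 4) (hM : IsHeight S above 0 z M) (hN : IsHeight S above t z N)
    (hNb : ∀ x ∈ Icc t b, |N x| < r / 4) :
    ∃ m, IsHeight S above 0 z m ∧ EqOn m N (Icc b z) ∧
      ∃ c ∈ Ico 0 b, (∀ x ∈ Icc 0 c, graph m x ∈ cone t r) ∧
        ∀ x ∈ Icc c b, graph m x ∈ Metric.ball (t : ℂ) (r / 2) ∩ cutPlane above t := by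
  obtain ⟨hr0, hrt⟩ := hr
  have ht0 : 0 < t := hr0.trans_le hrt
  have hct : t - r / 4 < t := by linarith
  have hwidth : 0 < (1 - (t - r / 4) / t) * r :=
    mul_pos (sub_pos.2 ((div_lt_one ht0).2 hct)) hr0
  obtain ⟨m, hm, hmN, hmt, hmb⟩ := hM.exists_merge ht0 hb.1 hb.2.le hN
    (lt_min hwidth (show 0 < r / 4 by linarith))
  have hm_lt : ∀ x ∈ Icc 0 b, |m x| < r / 4 := by
    intro x hx
    rcases le_or_gt x t with hxt | hxt
    · exact (hmt x ⟨hx.1, hxt⟩).trans_le (min_le_right _ _)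
    · obtain ⟨y, hy, hseg⟩ := hmb x ⟨hxt.le, hx.2⟩
      have hmem := (convex_ball (0 : ℝ) (r / 4)).segment_subset
        (by simpa using hy.trans_le (min_le_right _ _)) (by simpa using hNb x ⟨hxt.le, hx.2⟩) hseg
      simpa using hmem
  refine ⟨m, hm, hmN, t - r / 4, ⟨by linarith, hct.trans hb.1⟩, fun x hx => ?_,
    fun x hx => ⟨?_, ?_⟩⟩
  · exact mk_mem_cone ht0 hr0 hx hct
      ((hmt x ⟨hx.1, hx.2.trans hct.le⟩).trans_le (min_le_left _ _))
  · refine mk_mem_ball (abs_le.2 ⟨by linarith [hx.1], by linarith [hx.2]⟩) ?_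
    linarith [hm_lt x ⟨by linarith [hx.1], hx.2⟩]
  · exact mk_mem_cutPlane ht
      (hm.mem_admissibleHeights x ⟨by linarith [hx.1], hx.2.trans hb.2.le⟩)

namespace IsTangentialSystem

variable (T : IsTangentialSystem τ r Ω K E)
include T

lemma iterInt_eq_continuation (D : LetterChart S o τ t r V Ω K) (hN : IsHeight S above t z N)
    (hb : b ∈ Ioo t z) (hball : ∀ x ∈ Icc t b, graph N x ∈ Metric.ball (τ : ℂ) r)
    (hΦ : IsContinuedSystem (graph N) b z E Φ) {δ : ℝ → ℂ}
    (hδ : IsDeformedSegment S above t z δ) (hδ' : ContDiffOn ℝ 1 δ (Icc 0 1)) {u : List S}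
    (hu : u ∈ notEndingIn τ) : iterInt δ (u.map Subtype.val) 1 = Φ u z z := by
  have htz : t < z := hb.1.trans hb.2
  obtain ⟨-, hδ0, hδ1, hδS⟩ := (hδ.exists_height htz).choose_spec.2.path
  obtain ⟨F, hF0, hF, hF1⟩ :=
    T.exists_continuation_iterInt D hδ' (hδ0.trans D.coe_τ.symm) hδS hu
  have hgraph := IsContinuationOn.glue hb.1.le hb.2.le hN.continuousOn_graph
    (IsContinuationOn.const fun x hx => T.analyticOnNhd hu _ (hball x hx))
    (hΦ.isContinuationOn u) (by rw [hΦ.start])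
  have hcont : IsContinuable S t (E u) := D.coe_τ ▸ (T.isPrimitiveSystemAt D).isContinuable hu
  have key := hδ.continuation_eq htz hcont hF (by rw [hF0]) hN hgraph (by rw [if_pos hb.1.le])
  rw [hF1, hδ1, key.self_of_nhds, if_neg (not_le.2 hb.2)]

lemma exists_continuation_hlog (D : LetterChart S o τ t r V Ω K) {w : List S}
    (hw : w ∈ notEndingIn o) {γ : ℝ → ℂ} {a c : ℝ} (hac : a ≤ c) (hcb : c < b) (hbz : b < z)
    (hγ : ContinuousOn γ (Icc a z)) (hγV : ∀ x ∈ Icc a c, γ x ∈ V)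
    (hγΩ : ∀ x ∈ Icc c b, γ x ∈ Metric.ball (τ : ℂ) r ∩ Ω) (hΦ : IsContinuedSystem γ b z E Φ) :
    ∃ F, F a = hlog w ∧ IsContinuationOn γ F (Icc a z) ∧ F z = fun p =>
      ∑ k ∈ Finset.range (w.length + 1), regValue τ (w.drop k) * Φ (w.take k) z p := by
  have hE : ∀ u, ∀ x ∈ Icc c b, AnalyticAt ℂ (E u) (γ x) := fun u x hx =>
    (T.toIsPrimitiveSystem.isPrimitiveSystemAt (fun _ => mem_univ _)
      (Metric.isOpen_ball.inter D.isOpen_Ω) (hγΩ x hx)).analyticAt (mem_univ u)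
  have hsumE : IsContinuationOn γ (fun _ p => ∑ k ∈ Finset.range (w.length + 1),
      regValue τ (w.drop k) * E (w.take k) p) (Icc c b) :=
    IsContinuationOn.sum _ fun k _ => (IsContinuationOn.const (hE _)).const_mul _
  have hsumΦ : IsContinuationOn γ (fun x p => ∑ k ∈ Finset.range (w.length + 1),
      regValue τ (w.drop k) * Φ (w.take k) x p) (Icc b z) :=
    IsContinuationOn.sum _ fun k _ => (hΦ.isContinuationOn _).const_mul _
  have hleft := IsContinuationOn.glue hac hcb.le (hγ.mono (Icc_subset_Icc_right hbz.le))
    (IsContinuationOn.const fun x hx => D.analyticOnNhd_hlog hw _ (hγV x hx)) hsumE (by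
      filter_upwards [D.isOpen_overlap.mem_nhds
        ⟨hγV c (right_mem_Icc.2 hac), (hγΩ c (left_mem_Icc.2 hcb.le)).1⟩] with p hp
      rw [T.hlog_eq_sum D hw hp]
      exact Finset.sum_congr rfl fun k _ => mul_comm _ _)
  have hall := IsContinuationOn.glue (hac.trans hcb.le) hbz.le hγ hleft hsumΦ
    (by simp only [if_neg (not_le.2 hcb), hΦ.start]; rfl)
  exact ⟨_, by simp only [if_pos (hac.trans hcb.le), if_pos hac], hall,
    by simp only [if_neg (not_le.2 hbz)]⟩

lemma isExtendedIntegral (D : LetterChart S o τ t r V Ω K) (hN : IsHeight S above t z N)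
    (hb : b ∈ Ioo t z) (hball : ∀ x ∈ Icc t b, graph N x ∈ Metric.ball (τ : ℂ) r)
    (hΩ : ∀ x ∈ Icc b z, graph N x ∈ Ω) (hΦ : IsContinuedSystem (graph N) b z E Φ) {δ : ℝ → ℂ}
    (hδ : IsDeformedSegment S above t z δ) (hδ' : ContDiffOn ℝ 1 δ (Icc 0 1)) :
    IsExtendedIntegral τ δ (K z) (evalLin (fun u => Φ u z) z) := by
  have hNc : ContinuousOn (graph N) (Icc b z) :=
    hN.continuousOn_graph.mono (Icc_subset_Icc_left hb.1.le)
  have hU : Metric.ball (τ : ℂ) r ∩ Ω ∈ 𝓝 (graph N b) :=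
    (Metric.isOpen_ball.inter D.isOpen_Ω).mem_nhds
      ⟨hball b (right_mem_Icc.2 hb.1.le), hΩ b (left_mem_Icc.2 hb.2.le)⟩
  have hK : ∀ x ∈ Icc b z, AnalyticAt ℂ K (graph N x) := fun x hx =>
    DifferentiableOn.analyticAt (fun p hp =>
      (D.hasDerivAt p hp).differentiableAt.differentiableWithinAt) (D.isOpen_Ω.mem_nhds (hΩ x hx))
  refine ⟨fun u hu => ?_, fun u v => ?_, ?_⟩
  · rw [evalLin_word, T.iterInt_eq_continuation D hN hb hball hΦ hδ hδ' hu]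
  · have hshuffle := hΦ.evalLin_shuffleWords hb.2.le hNc
      (eventually_of_mem hU fun p hp => T.evalLin_shuffleWords D u v hp)
    simpa only [graph_of_right hN, evalLin_word] using hshuffle
  · have hletter := hΦ.apply_eq hb.2.le hNc (u := [τ]) hK (by simpa using T.apply_replicate 1)
    simpa only [graph_of_right hN, evalLin_word] using hletter

end IsTangentialSystem

lemma IsTangentialSystem.continuation_hlog_eq_sum
    (T : IsTangentialSystem τ (r / 2) (cutPlane above t) (cutLog above t) E)
    (D : LetterChart S o τ t (r / 2) (cone t r) (cutPlane above t) (cutLog above t))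
    (hr : r ∈ Ioc 0 t) (hb : b ∈ Ioo t z) (hbr : b ≤ t + r / 4) (hN : IsHeight S above t z N)
    (hNb : ∀ x ∈ Icc t b, |N x| < r / 4) (hΦ : IsContinuedSystem (graph N) b z E Φ) {γ : ℝ → ℂ}
    (hγ : IsDeformedSegment S above 0 z γ) {w : List S} (hw : w ∈ notEndingIn o) {F : ℝ → ℂ → ℂ}
    (hF : IsContinuationOn γ F (Icc 0 1)) (hF0 : F 0 =ᶠ[𝓝 0] hlog w) :
    F 1 z = ∑ k ∈ Finset.range (w.length + 1), Φ (w.take k) z z * regValue τ (w.drop k) := by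
  have hz : 0 < z := D.t_pos.trans (hb.1.trans hb.2)
  obtain ⟨M, hM, -⟩ := hγ.exists_height hz
  obtain ⟨m, hm, hmN, c, hc, hmV, hmΩ⟩ :=
    hM.exists_merge_near_letter (D.coe_τ ▸ τ.2) hr hb hbr hN hNb
  have hΦm : IsContinuedSystem (graph m) b z E Φ :=
    ⟨hΦ.start, fun u => (hΦ.isContinuationOn u).congr_path fun x hx => by
      rw [graph, graph, hmN hx]⟩
  obtain ⟨G, hG0, hG, hGz⟩ := T.exists_continuation_hlog D hw hc.1 hc.2 hb.2 hm.continuousOn_graph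
    hmV (fun x hx => D.coe_τ ▸ hmΩ x hx) hΦm
  have key := hγ.continuation_eq hz (by simpa using D.isContinuable_hlog hw) hF
    (by simpa using hF0) hm hG (by rw [hG0])
  rw [key.self_of_nhds, hGz]
  exact Finset.sum_congr rfl fun k _ => mul_comm _ _

lemma IsAnalyticContinuation.isContinuationOn {f : ℂ → ℂ} {γ : ℝ → ℂ} {F : ℝ → ℂ → ℂ}
    (h : IsAnalyticContinuation f γ F) : IsContinuationOn γ F (Icc 0 1) :=
  ⟨h.analytic, h.compatible⟩

lemma IsDeformedSegment.exists_isAnalyticContinuation {a : ℝ} (haz : a < z) {γ : ℝ → ℂ}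
    (hγ : IsDeformedSegment S above a z γ) {f : ℂ → ℂ} (hf : IsContinuable S a f) :
    ∃ F, IsAnalyticContinuation f γ F := by
  obtain ⟨M, -, hγM⟩ := hγ.exists_height haz
  obtain ⟨hγc, hγ0, -, hγS⟩ := hγM.path
  obtain ⟨F, hF0, hF⟩ := hf γ hγc hγ0 hγS
  exact ⟨F, by rw [hF0], hF.analytic, hF.compatible⟩

theorem exists_connection (h0 : (0 : ℂ) ∈ S) (ht : IsLeast {x : ℝ | (x : ℂ) ∈ S ∧ 0 < x} t)
    (htz : t < z) {δ : ℝ → ℂ} (hδ : IsDeformedSegment S above t z δ)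
    (hδ' : ContDiffOn ℝ 1 δ (Icc 0 1)) :
    ∃ I : WordSpace S →ₗ[ℚ] ℂ, IsExtendedIntegral ⟨t, ht.1.1⟩ δ (branchValue above t z) I ∧
      ∀ γ : ℝ → ℂ, IsDeformedSegment S above 0 z γ → ∀ w ∈ notEndingIn (⟨0, h0⟩ : S),
        (∃ F, IsAnalyticContinuation (hlog w) γ F) ∧
        ∀ F, IsAnalyticContinuation (hlog w) γ F →
          F 1 z = ∑ k ∈ Finset.range (w.length + 1), I (word (w.take k)) *
            hyperlogLin (regularize ⟨t, ht.1.1⟩ (word (w.drop k))) t := by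
  obtain ⟨r, hr, hrS⟩ := exists_radius ht
  have D := letterChart_cone h0 ht.1.1 hr hrS above
  obtain ⟨E, T⟩ := D.exists_isTangentialSystem
  obtain ⟨N, hN, -⟩ := hδ.exists_height htz
  obtain ⟨b, hb, hbr, hNb⟩ := hN.exists_initial_lt htz (show 0 < r / 4 by linarith [hr.1])
  have hNΩ : ∀ x ∈ Ioc t z, graph N x ∈ cutPlane above t := fun x hx =>
    mk_mem_cutPlane ht.1.1 (hN.mem_admissibleHeights x hx)
  have hNB : ∀ x ∈ Icc t b, graph N x ∈ Metric.ball (t : ℂ) (r / 2) := fun x hx =>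
    mk_mem_ball (abs_le.2 ⟨by linarith [hx.1, hr.1], by linarith [hx.2]⟩)
      (by linarith [hNb x hx])
  obtain ⟨Φ, hΦ⟩ := T.toIsPrimitiveSystem.exists_isContinuedSystem
    (Metric.isOpen_ball.inter D.isOpen_Ω) hb.2.le
    (hN.continuousOn_graph.mono (Icc_subset_Icc_left hb.1.le))
    (fun x hx => mk_notMem_of_mem_admissibleHeights
      (hN.mem_admissibleHeights x ⟨hb.1.trans hx.1, hx.2⟩))
    ⟨hNB b (right_mem_Icc.2 hb.1.le), hNΩ b ⟨hb.1, hb.2.le⟩⟩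
  refine ⟨evalLin (fun u => Φ u z) z, ?_, fun γ hγ w hw => ⟨?_, fun F hF => ?_⟩⟩
  · exact cutLog_of_gt (above := above) ht.1.2 htz ▸ T.isExtendedIntegral D hN hb hNB
      (fun x hx => hNΩ x ⟨hb.1.trans_le hx.1, hx.2⟩) hΦ hδ hδ'
  · exact hγ.exists_isAnalyticContinuation (ht.1.2.trans htz)
      (by simpa using D.isContinuable_hlog hw)
  · obtain ⟨M, -, hγM⟩ := hγ.exists_height (ht.1.2.trans htz)
    have hF0 : F 0 =ᶠ[𝓝 0] hlog w := by simpa [hγM.path.2.1] using hF.start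
    rw [T.continuation_hlog_eq_sum D hr hb hbr hN hNb hΦ hγ hw hF.isContinuationOn hF0]
    simp only [evalLin_word, hyperlogLin_eq_evalLin, regValue]

lemma IsWordReg.sum_letter {reg : WordSpace S →ₗ[ℚ] WordSpace S} (hreg : IsWordReg ∅ {τ} reg)
    (I : WordSpace S →ₗ[ℚ] ℂ) (p : ℂ) :
    ∑ k ∈ Finset.range ([τ].length + 1), I (word ([τ].take k)) *
      hyperlogLin (reg (word ([τ].drop k))) p = I (word [τ]) := by
  have hletter : reg (word [τ]) = 0 := hreg.map_singular [τ] (by simp) (by simp)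
  simp [Finset.sum_range_succ, hletter, hreg.map_nil, hyperlogLin, hyperlog]

end Connection

end Hyperlogs

end

theorem mainTheorem2 (S : Finset ℂ) (h0 : (0 : ℂ) ∈ S) (τ : ℝ)
    (hτ : IsLeast {x : ℝ | (x : ℂ) ∈ S ∧ 0 < x} τ)
    (w : List S) (hw : ∀ σ ∈ w.getLast?, (σ : ℂ) ≠ 0)
    (z : ℝ) (hz : τ < z) (above : Set ℝ)
    (γ : ℝ → ℂ) (hγ : Hyperlogs.IsDeformedSegment S above 0 z γ)
    (δ : ℝ → ℂ) (hδ : Hyperlogs.IsDeformedSegment S above τ z δ)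
    (hδ' : ContDiffOn ℝ 1 δ (Set.Icc 0 1)) :
    (∃! reg, Hyperlogs.IsWordReg ∅ {(⟨(τ : ℂ), hτ.1.1⟩ : S)} reg) ∧
    (∃! I, Hyperlogs.IsExtendedIntegral ⟨(τ : ℂ), hτ.1.1⟩ δ (Hyperlogs.branchValue above τ z) I) ∧
    (∃ F, Hyperlogs.IsAnalyticContinuation (Hyperlogs.hyperlog (w.map Subtype.val)) γ F) ∧
    (∀ G, Hyperlogs.IsAnalyticContinuation (Hyperlogs.hyperlog [(τ : ℂ)]) γ G →
      G 1 (z : ℂ) = Hyperlogs.branchValue above τ z) ∧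
    ∀ reg I F,
      Hyperlogs.IsWordReg ∅ {(⟨(τ : ℂ), hτ.1.1⟩ : S)} reg →
      Hyperlogs.IsExtendedIntegral ⟨(τ : ℂ), hτ.1.1⟩ δ (Hyperlogs.branchValue above τ z) I →
      Hyperlogs.IsAnalyticContinuation (Hyperlogs.hyperlog (w.map Subtype.val)) γ F →
      F 1 (z : ℂ) = ∑ k ∈ Finset.range (w.length + 1),
        I (Hyperlogs.word (w.take k)) *
          Hyperlogs.hyperlogLin (reg (Hyperlogs.word (w.drop k))) (τ : ℂ) := by
  open Hyperlogs in
  obtain ⟨I₀, hI₀, hconn⟩ := exists_connection h0 hτ hz hδ hδ'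
  have hreg := isWordReg_regularize (⟨τ, hτ.1.1⟩ : S)
  have hw0 : w ∈ notEndingIn (⟨0, h0⟩ : S) := fun hlast => hw _ hlast rfl
  have hτ0 : [⟨τ, hτ.1.1⟩] ∈ notEndingIn (⟨0, h0⟩ : S) := by
    simpa [notEndingIn] using hτ.1.2.ne'
  refine ⟨⟨_, hreg, fun _ h => h.unique hreg⟩, ⟨I₀, hI₀, fun _ h => h.unique hI₀⟩,
    (hconn γ hγ w hw0).1, fun G hG => ?_, fun reg I F hr hI hF => ?_⟩
  · rw [(hconn γ hγ _ hτ0).2 G hG, hreg.sum_letter, hI₀.map_letter]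
  · rw [hr.unique hreg, hI.unique hI₀]
    exact (hconn γ hγ w hw0).2 F hF
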